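/- Let $\mathbb{T}^3=\mathbb{R}^3/\mathbb{Z}^3$ and let $L^2_{\mathrm{sol},0}(\mathbb{T}^3)$ be the space of vector fields $b\in L^2(\mathbb{T}^3;\mathbb{R}^3)$ with $\nabla\cdot b=0$ (in the sense of distributions) and $\int_{\mathbb{T}^3} b\,dx=0$. There is a universal constant $C>0$ such that the following holds. Let $\kappa\ge 0$ and $T\ge 0$, let $u\in L^\infty(0,T;W^{1,\infty}(\mathbb{T}^3;\mathbb{R}^3))$ satisfy $\nabla\cdot u=0$ and $\nabla^2u\in L^1(0,T;L^\infty(\mathbb{T}^3))$, and let $b\in C([0,T];L^2_{\mathrm{sol},0}(\mathbb{T}^3))$ be a weak solution on $[0,T]$ of the induction equation \[\partial_t b-\kappa\Delta b+u\cdot\nabla b-b\cdot\nabla u=0\] with $b(0,\cdot)\in H^1(\mathbb{T}^3)$. Then 1. If $b(0,\cdot)\neq 0$, then for every $t\in[0,T]$, \[\|b(t,\cdot)\|_{L^2}^2\;\ge\;\exp\!\Bigg(-2\int_0^t\bigg(\kappa\,\exp\Big(C\int_0^s\|\nabla^2u(r,\cdot)\|_{L^\infty}\,dr\Big)\frac{\|\nabla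 b(0,\cdot)\|_{L^2}^2}{\|b(0,\cdot)\|_{L^2}^2}+\|\nabla u(s,\cdot)\|_{L^\infty}\bigg)ds\Bigg)\,\|b(0,\cdot)\|_{L^2}^2 .\] (If $b(0,\cdot)=0$, the bound holds trivially, its right-hand side being $0$.) 2. In particular, if $b(0,\cdot)\ne 0$, then $b(t,\cdot)\neq 0$ for every $t\in[0,T]$, including $t=T$. Here $|\nabla u|$ in $\|\nabla u\|_{L^\infty}$ is the operator norm of the matrix $\nabla u(s,x)$, and $|\nabla b|$ and $|\nabla^2 u|$ are the Euclidean norms of the arrays of all first, respectively second, derivatives. -/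

import Mathlib

open MeasureTheory Set
open scoped ContDiff

namespace Induction

/-- Three-dimensional Euclidean space, in which the fields take their values. -/
abbrev E3 : Type := EuclideanSpace ℝ (Fin 3)

/-- The flat torus `ℝ³/ℤ³`, with its normalised Haar measure as `volume`. -/
abbrev T3 : Type := UnitAddTorus (Fin 3)

/-- A function on the torus is smooth if its periodic lift to `ℝ³` is `C^∞`. -/
def SmoothOnTorus (φ : T3 → ℝ) : Prop :=
  ContDiff ℝ ∞ (fun x : Fin 3 → ℝ => φ (fun i => (x i : UnitAddCircle)))

/-- The classical partial derivative `∂ᵢ φ` on the torus. -/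
noncomputable def partialD (i : Fin 3) (φ : T3 → ℝ) (x : T3) : ℝ :=
  deriv (fun s : ℝ => φ (x + Pi.single i (s : UnitAddCircle))) 0

/-- The Laplacian `Δ φ` on the torus. -/
noncomputable def laplacian (φ : T3 → ℝ) (x : T3) : ℝ :=
  ∑ i, partialD i (partialD i φ) x

/-- `g` is the weak partial derivative `∂ᵢ f` of the vector field `f` on the torus. -/
structure HasWeakPartial (i : Fin 3) (f g : T3 → E3) : Prop where
  integrable : Integrable f volume
  integrable_deriv : Integrable g volume
  eq : ∀ φ : T3 → ℝ, SmoothOnTorus φ →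
    ∫ x, partialD i φ x • f x = - ∫ x, φ x • g x

/-- `L²_{sol,0}`: the square integrable vector fields on the torus that are divergence-free
in the sense of distributions and have mean zero. -/
def L2sol0 : Set (Lp E3 2 (volume : Measure T3)) :=
  {b | (∀ φ : T3 → ℝ, SmoothOnTorus φ → ∫ x, ∑ i, b x i * partialD i φ x = 0) ∧
    ∫ x, b x = 0}

/-- Given the three partial derivatives `∂ⱼ u` at a point, the linear map
`v ↦ v · ∇u = ∑ⱼ vⱼ ∂ⱼ u`. Its norm is the operator norm `|∇u|`. -/
noncomputable def gradOp (du : Fin 3 → E3) : E3 →L[ℝ] E3 :=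
  ∑ j, (EuclideanSpace.proj j : E3 →L[ℝ] ℝ).smulRight (du j)

/-- `u` is a divergence-free velocity field in `L^∞(0,T; W^{1,∞}(𝕋³))`, and `Du t j` is the weak
partial derivative `∂ⱼ u(t)`. -/
structure IsVelocity (T : ℝ) (u : ℝ → T3 → E3) (Du : ℝ → Fin 3 → T3 → E3) : Prop where
  measurable : Measurable (fun p : ℝ × T3 => u p.1 p.2)
  measurable_grad : ∀ j, Measurable (fun p : ℝ × T3 => Du p.1 j p.2)
  bounded : ∃ M : ℝ, ∀ᵐ t ∂(volume.restrict (Icc 0 T)), ∀ᵐ x : T3,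
    ‖u t x‖ ≤ M ∧ ∀ j, ‖Du t j x‖ ≤ M
  weak_grad : ∀ᵐ t ∂(volume.restrict (Icc 0 T)), ∀ j, HasWeakPartial j (u t) (Du t j)
  div_free : ∀ᵐ t ∂(volume.restrict (Icc 0 T)), ∀ᵐ x : T3, ∑ j, Du t j x j = 0

/-- `‖∇u‖_{L^∞}` at a fixed time, as an extended nonnegative number. -/
noncomputable def gradSup (du : Fin 3 → T3 → E3) : ENNReal :=
  eLpNorm (fun x => gradOp (fun j => du j x)) ⊤ volume

/-- `‖∇²u‖_{L^∞}` at a fixed time, as an extended nonnegative number, with the Euclidean norm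
of the array of all second derivatives. -/
noncomputable def hessSup (d2u : Fin 3 → Fin 3 → T3 → E3) : ENNReal :=
  eLpNorm (fun x => Real.sqrt (∑ i, ∑ j, ‖d2u i j x‖ ^ 2)) ⊤ volume

/-- The weak second derivatives `D2u t i j = ∂ᵢ ∂ⱼ u(t)` exist and `∇²u ∈ L¹(0,T; L^∞(𝕋³))`. -/
structure IsHessianL1 (T : ℝ) (Du : ℝ → Fin 3 → T3 → E3)
    (D2u : ℝ → Fin 3 → Fin 3 → T3 → E3) : Prop where
  measurable : ∀ i j, Measurable (fun p : ℝ × T3 => D2u p.1 i j p.2)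
  weak_hess : ∀ᵐ t ∂(volume.restrict (Icc 0 T)), ∀ i j,
    HasWeakPartial i (Du t j) (D2u t i j)
  integrable : ∫⁻ t in Icc 0 T, hessSup (D2u t) < ⊤

/-- `b ∈ C([0,T]; L²_{sol,0})` is a weak solution of
`∂ₜ b - κ Δ b + u · ∇ b - b · ∇ u = 0` on `[0,T]`. Because `u` is divergence-free, the transport
term `u · ∇ b`, tested against `φ`, is `- ∫ (u · ∇ φ) b`. -/
structure IsSolution (κ T : ℝ) (u : ℝ → T3 → E3) (Du : ℝ → Fin 3 → T3 → E3)
    (b : ℝ → Lp E3 2 (volume : Measure T3)) : Prop where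
  continuousOn : ContinuousOn b (Icc 0 T)
  mem : ∀ t ∈ Icc 0 T, b t ∈ L2sol0
  weak_eq : ∀ φ : T3 → ℝ, SmoothOnTorus φ → ∀ t ∈ Icc 0 T,
    (∫ x, φ x • b t x) - ∫ x, φ x • b 0 x =
      ∫ s in (0 : ℝ)..t, ∫ x,
        ((κ * laplacian φ x) • b s x + (∑ j, u s x j * partialD j φ x) • b s x
          + φ x • gradOp (fun j => Du s j x) (b s x))

/-- `f ∈ H¹(𝕋³)`, with square integrable weak partial derivatives `Df j = ∂ⱼ f`. -/
structure IsH1Gradient (f : Lp E3 2 (volume : Measure T3)) (Df : Fin 3 → T3 → E3) : Prop where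
  memLp : ∀ j, MemLp (Df j) 2 volume
  weak : ∀ j, HasWeakPartial j f (Df j)

/-- `‖∇f‖²_{L²}`, with the Euclidean (Frobenius) norm of the gradient matrix. -/
noncomputable def gradL2Sq (Df : Fin 3 → T3 → E3) : ℝ :=
  ∫ x, ∑ j, ‖Df j x‖ ^ 2

end Induction

/-! The quantity to follow is the Dirichlet quotient G/E, where E = ‖b‖², G = ‖∇b‖², L = ‖Δb‖².
Formally E' = 2S − 2κG and G' = 2R − 2κL, where S = ∫ (b·∇u)·b and R pairs b·∇u − u·∇b with −Δb. In
the derivative of G/E diffusion contributes −2κ(LE − G²)/E² ≤ 0 by Cauchy–Schwarz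
(`gradEnergy_sq_le`), so it can only lower the quotient. Integrating by parts and using div u = 0, R
is bounded by terms of type |∇u||∇b|² and |∇²u||b||∇b| (`IsSlice.abs_tsum_mu_inner_le`). Poincaré's
inequality for the mean-zero field b, and ‖∇u‖ ≤ 9‖∇²u‖ in L^∞ because ∇u has mean zero
(`HasWeakPartial.ae_norm_le`), turn this into (G/E)' ≤ 396 ‖∇²u‖ (G/E). Inserting the resulting
bound on G into E' ≥ −2κG − 2‖∇u‖E and using Grönwall gives the estimate as long as b does not
vanish (`IsSolution.le_normSq_of_ne_zero`). The bound stays away from 0 up to a hypothetical first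
zero, so by continuity there is none (`IsSolution.ne_zero`).

The labour is in justifying these identities for a weak solution that is only continuous into L².
Everything is done on coefficients in the real trigonometric system, where the equation becomes one
absolutely continuous function of time per mode. The energy equality needs the transport term to
disappear. The equation is paired with b_ε = (1 − εΔ)⁻¹b; since b = b_ε − εΔb_ε, the transport term
reduces to ε times a quadratic form in ∇b_ε with coefficients ∇u, and ε‖∇b_ε‖² → 0
(`IsSlice.abs_sum_res_le`, `IsSlice.tendsto_tsum_res`). The limit yields the equality together with
the summability of the dissipation (`IsSolution.hasSum_dissipation`), so for κ > 0 the solution lies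
in H¹ for almost every time.

Then b·∇u − u·∇b is in L² for almost every time, Young's inequality gives H² regularity
(`IsSolution.summable_integral_lap`), and the balance of G follows (`IsSolution.gradEnergy_eq`). For
κ = 0 no gradient is needed, only the energy equality. -/

namespace Induction

open UnitAddTorus ComplexConjugate

/-! ### The real trigonometric system and Parseval's identity -/

/-- Indices of the real trigonometric system: a frequency, and cosine or sine. -/
abbrev Idx : Type := (Fin 3 → ℤ) × Bool

/-- The real trigonometric system on the torus. -/
noncomputable def trig (p : Idx) (x : T3) : ℝ :=
  if p.2 then (mFourier p.1 x).re else (mFourier p.1 x).im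

/-- The coefficient of a vector field with respect to the real trigonometric system. -/
noncomputable def coef (p : Idx) (f : T3 → E3) : E3 := ∫ x, trig p x • f x

lemma volume_eq_pi_haar :
    (volume : Measure T3) = Measure.pi (fun _ : Fin 3 => AddCircle.haarAddCircle (T := 1)) := by
  have : (volume : Measure UnitAddCircle) = AddCircle.haarAddCircle := by
    rw [AddCircle.volume_eq_smul_haarAddCircle]; simp
  rw [← this]; rfl

lemma continuous_trig (p : Idx) : Continuous (trig p) := by
  unfold trig
  split_ifs
  · exact Complex.continuous_re.comp (mFourier p.1).continuous
  · exact Complex.continuous_im.comp (mFourier p.1).continuous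

lemma abs_trig_le (p : Idx) (x : T3) : |trig p x| ≤ 1 := by
  have h : ‖mFourier p.1 x‖ ≤ 1 := ((mFourier p.1).norm_coe_le_norm x).trans mFourier_norm.le
  unfold trig
  split_ifs
  · exact (Complex.abs_re_le_norm _).trans h
  · exact (Complex.abs_im_le_norm _).trans h

instance : IsProbabilityMeasure (volume : Measure T3) := by
  rw [volume_eq_pi_haar]; infer_instance

/-- For real f the complex Fourier coefficient at k is c − i s, with c and s the cosine and sine
coefficients, so the real part of the complex Parseval identity is a sum of cc' + ss'. All k are
kept, so k and −k give the same functions up to sign: the system is a redundant Parseval frame, not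
an orthonormal basis. -/
lemma hasSum_coef_pair {f g : T3 → ℝ} (hf : MemLp f 2 volume) (hg : MemLp g 2 volume) :
    HasSum (fun k : Fin 3 → ℤ => (∫ x, trig (k, true) x * f x) * (∫ x, trig (k, true) x * g x)
      + (∫ x, trig (k, false) x * f x) * (∫ x, trig (k, false) x * g x)) (∫ x, f x * g x) := by
  -- A variable measure lets `rfl` substitute the product of Haar measures, which avoids rewriting
  -- the measure inside an `Lp` type.
  have key : ∀ (μ : Measure T3), μ = Measure.pi (fun _ : Fin 3 => AddCircle.haarAddCircle (T := 1)) →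
      ∀ F G : Lp ℂ 2 μ, HasSum (fun k : Fin 3 → ℤ =>
        conj (∫ x, mFourier (-k) x * F x ∂μ) * (∫ x, mFourier (-k) x * G x ∂μ))
        (∫ x, conj (F x) * G x ∂μ) := by
    rintro μ rfl F G
    exact hasSum_prod_mFourierCoeff F G
  have ex : ∀ {f : T3 → ℝ}, MemLp f 2 volume →
      ∃ F : Lp ℂ 2 (volume : Measure T3), F =ᵐ[volume] fun x => (f x : ℂ) := fun hf =>
    ⟨(hf.ofReal (K := ℂ)).toLp _, (hf.ofReal (K := ℂ)).coeFn_toLp⟩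
  obtain ⟨F, hF⟩ := ex hf
  obtain ⟨G, hG⟩ := ex hg
  have h := key volume volume_eq_pi_haar F G
  have aux : ∀ {f : T3 → ℝ} (_ : MemLp f 2 volume) {F : Lp ℂ 2 (volume : Measure T3)}
      (_ : F =ᵐ[volume] fun x => (f x : ℂ)) (k : Fin 3 → ℤ),
      (∫ x, mFourier (-k) x * F x) =
        ⟨∫ x, trig (k, true) x * f x, -∫ x, trig (k, false) x * f x⟩ := by
    intro f hf F hF k
    have hfi : Integrable f volume := hf.integrable (by norm_num)
    have e1 : (∫ x, mFourier (-k) x * F x) =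
        ∫ x, mFourier (-k) x * (f x : ℂ) := by
      refine integral_congr_ae ?_
      filter_upwards [hF] with x hx
      rw [hx]
    have hI : Integrable (fun x => mFourier (-k) x * (f x : ℂ)) volume :=
      (hfi.ofReal (𝕜 := ℂ)).bdd_mul (c := 1) (mFourier (-k)).continuous.aestronglyMeasurable
        (Filter.Eventually.of_forall fun x =>
          ((mFourier (-k)).norm_coe_le_norm x).trans mFourier_norm.le)
    rw [e1]
    apply Complex.ext
    · have := integral_re hI
      simp only [RCLike.re_to_complex] at this
      rw [← this]
      refine integral_congr_ae (Filter.Eventually.of_forall fun x => ?_)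
      simp [mFourier_neg, trig]
    · have := integral_im hI
      simp only [RCLike.im_to_complex] at this
      rw [← this, ← integral_neg]
      refine integral_congr_ae (Filter.Eventually.of_forall fun x => ?_)
      simp [mFourier_neg, trig]
  have e2 : (∫ x, conj (F x) * G x)
      = ((∫ x, f x * g x : ℝ) : ℂ) := by
    rw [← integral_complex_ofReal]
    refine integral_congr_ae ?_
    filter_upwards [hF, hG] with x hx hy
    rw [hx, hy]; simp
  simp only [e2, aux hf hF, aux hg hG] at h
  have h2 := Complex.hasSum_re h
  simpa using h2

lemma summable_coef_mul_self {f : T3 → ℝ} (hf : MemLp f 2 volume) :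
    Summable (fun p : Idx => (∫ x, trig p x * f x) * (∫ x, trig p x * f x)) := by
  refine (summable_prod_of_nonneg (fun p => mul_self_nonneg _)).2 ⟨fun k => ?_, ?_⟩
  · exact (hasSum_fintype _).summable
  · simpa [tsum_fintype] using (hasSum_coef_pair hf hf).summable

/-- Parseval's identity for the real trigonometric system. -/
lemma hasSum_coef_mul {f g : T3 → ℝ} (hf : MemLp f 2 volume) (hg : MemLp g 2 volume) :
    HasSum (fun p : Idx => (∫ x, trig p x * f x) * (∫ x, trig p x * g x)) (∫ x, f x * g x) := by
  have hs : Summable (fun p : Idx => (∫ x, trig p x * f x) * (∫ x, trig p x * g x)) := by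
    refine Summable.of_norm_bounded
      ((summable_coef_mul_self hf).add (summable_coef_mul_self hg)) fun p => ?_
    rw [Real.norm_eq_abs, abs_le]
    constructor <;> nlinarith [mul_self_nonneg ((∫ x, trig p x * f x) + (∫ x, trig p x * g x)),
      mul_self_nonneg ((∫ x, trig p x * f x) - (∫ x, trig p x * g x)),
      mul_self_nonneg (∫ x, trig p x * f x), mul_self_nonneg (∫ x, trig p x * g x)]
  have h1 := hs.hasSum.prod_fiberwise (fun k => hasSum_fintype _)
  simp only [Fintype.sum_bool] at h1
  rw [← h1.unique (hasSum_coef_pair hf hg)]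
  exact hs.hasSum

lemma integrable_trig_smul {f : T3 → E3} (hf : Integrable f volume) (p : Idx) :
    Integrable (fun x => trig p x • f x) volume :=
  hf.bdd_smul (φ := trig p) 1 (continuous_trig p).aestronglyMeasurable
    (Filter.Eventually.of_forall fun x => abs_trig_le p x)

lemma integral_E3_apply {f : T3 → E3} (hf : Integrable f volume) (l : Fin 3) :
    (∫ x, f x) l = ∫ x, f x l :=
  ((EuclideanSpace.proj l : E3 →L[ℝ] ℝ).integral_comp_comm hf).symm

lemma coef_apply {f : T3 → E3} (hf : Integrable f volume) (p : Idx) (l : Fin 3) :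
    coef p f l = ∫ x, trig p x * f x l := by
  rw [coef, integral_E3_apply (integrable_trig_smul hf p)]; simp

lemma MemLp.integrable_two {f : T3 → E3} (hf : MemLp f 2 volume) : Integrable f volume :=
  hf.integrable (by norm_num)

lemma memLp_apply {f : T3 → E3} (hf : MemLp f 2 volume) (l : Fin 3) :
    MemLp (fun x => f x l) 2 volume :=
  (EuclideanSpace.proj l : E3 →L[ℝ] ℝ).comp_memLp' hf

lemma inner_E3 (v w : E3) : inner ℝ v w = ∑ l, v l * w l := by
  simp [PiLp.inner_apply, mul_comm]

lemma integral_inner_eq_sum {f g : T3 → E3} (hf : MemLp f 2 volume) (hg : MemLp g 2 volume) :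
    ∫ x, inner ℝ (f x) (g x) = ∑ l, ∫ x, f x l * g x l := by
  simp only [inner_E3]
  exact integral_finsetSum _ fun l _ => (memLp_apply hf l).integrable_mul (memLp_apply hg l)

/-- Parseval's identity for vector fields. -/
lemma hasSum_inner_coef {f g : T3 → E3} (hf : MemLp f 2 volume) (hg : MemLp g 2 volume) :
    HasSum (fun p : Idx => inner ℝ (coef p f) (coef p g)) (∫ x, inner ℝ (f x) (g x)) := by
  rw [integral_inner_eq_sum hf hg]
  simp only [inner_E3, coef_apply (MemLp.integrable_two hf), coef_apply (MemLp.integrable_two hg)]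
  exact hasSum_sum fun l _ => hasSum_coef_mul (memLp_apply hf l) (memLp_apply hg l)

lemma hasSum_coef_sq {f : T3 → E3} (hf : MemLp f 2 volume) :
    HasSum (fun p : Idx => ‖coef p f‖ ^ 2) (∫ x, ‖f x‖ ^ 2) := by
  simpa using hasSum_inner_coef hf hf

/-! ### Cauchy–Schwarz and approximation by trigonometric polynomials -/

lemma integrable_inner_of_memLp {f g : T3 → E3} (hf : MemLp f 2 volume) (hg : MemLp g 2 volume) :
    Integrable (fun x => inner ℝ (f x) (g x)) volume := by
  simp only [inner_E3]
  exact integrable_finsetSum _ fun l _ => (memLp_apply hf l).integrable_mul (memLp_apply hg l)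

lemma integrable_normSq {f : T3 → E3} (hf : MemLp f 2 volume) :
    Integrable (fun x => ‖f x‖ ^ 2) volume := hf.integrable_norm_pow (by norm_num)

lemma integrable_norm_mul_norm {f g : T3 → E3} (hf : MemLp f 2 volume) (hg : MemLp g 2 volume) :
    Integrable (fun x => ‖f x‖ * ‖g x‖) volume := hf.norm.integrable_mul hg.norm

/-- Cauchy–Schwarz inequality. -/
lemma integral_norm_mul_norm_le {f g : T3 → E3} (hf : MemLp f 2 volume) (hg : MemLp g 2 volume) :
    ∫ x, ‖f x‖ * ‖g x‖ ≤ √(∫ x, ‖f x‖ ^ 2) * √(∫ x, ‖g x‖ ^ 2) := by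
  have h := integral_mul_le_Lp_mul_Lq_of_nonneg (μ := (volume : Measure T3)) (p := 2) (q := 2)
    (f := fun x => ‖f x‖) (g := fun x => ‖g x‖) (by constructor <;> norm_num)
    (Filter.Eventually.of_forall fun x => norm_nonneg _)
    (Filter.Eventually.of_forall fun x => norm_nonneg _)
    (by simpa using hf.norm) (by simpa using hg.norm)
  simpa [Real.sqrt_eq_rpow] using h

lemma abs_integral_inner_le {f g : T3 → E3} (hf : MemLp f 2 volume) (hg : MemLp g 2 volume) :
    |∫ x, inner ℝ (f x) (g x)| ≤ √(∫ x, ‖f x‖ ^ 2) * √(∫ x, ‖g x‖ ^ 2) := by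
  refine le_trans ?_ (integral_norm_mul_norm_le hf hg)
  refine (abs_integral_le_integral_abs).trans ?_
  exact integral_mono (integrable_inner_of_memLp hf hg).abs (integrable_norm_mul_norm hf hg)
    fun x => abs_real_inner_le_norm _ _

/-- A trigonometric polynomial with values in `ℝ³`. -/
noncomputable def synth (F : Finset Idx) (d : Idx → E3) (x : T3) : E3 := ∑ p ∈ F, trig p x • d p

lemma continuous_synth (F : Finset Idx) (d : Idx → E3) : Continuous (synth F d) :=
  continuous_finsetSum _ fun p _ => (continuous_trig p).smul continuous_const

lemma memLp_of_continuous {f : T3 → E3} (hf : Continuous f) (q : ENNReal) :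
    MemLp f q volume := by
  obtain ⟨C, hC⟩ := (isCompact_univ (X := T3)).exists_bound_of_continuousOn hf.continuousOn
  exact MemLp.of_bound hf.aestronglyMeasurable C
    (Filter.Eventually.of_forall fun x => hC x (mem_univ x))

lemma memLp_synth (F : Finset Idx) (d : Idx → E3) : MemLp (synth F d) 2 volume :=
  memLp_of_continuous (continuous_synth F d) 2

lemma integral_inner_synth {f : T3 → E3} (hf : Integrable f volume) (F : Finset Idx)
    (d : Idx → E3) :
    ∫ x, inner ℝ (f x) (synth F d x) = ∑ p ∈ F, inner ℝ (coef p f) (d p) := by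
  have h : ∀ p, Integrable (fun x => inner ℝ (trig p x • f x) (d p)) volume := fun p =>
    (integrable_trig_smul hf p).inner_const (d p)
  have e : ∀ x, inner ℝ (f x) (synth F d x) = ∑ p ∈ F, inner ℝ (trig p x • f x) (d p) := by
    intro x
    rw [synth, inner_sum]
    refine Finset.sum_congr rfl fun p _ => ?_
    rw [real_inner_smul_left, real_inner_smul_right]
  simp only [e]
  rw [integral_finsetSum _ fun p _ => h p]
  refine Finset.sum_congr rfl fun p _ => ?_
  rw [coef, real_inner_comm, ← integral_inner (integrable_trig_smul hf p)]
  simp only [real_inner_comm]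

lemma sum_inner_le_sqrt (F : Finset Idx) (c d : Idx → E3) :
    ∑ p ∈ F, inner ℝ (c p) (d p) ≤ √(∑ p ∈ F, ‖c p‖ ^ 2) * √(∑ p ∈ F, ‖d p‖ ^ 2) := by
  refine (Finset.sum_le_sum fun p _ => real_inner_le_norm _ _).trans ?_
  exact Real.sum_mul_le_sqrt_mul_sqrt F _ _

/-- Closes duality estimates in which the norm being bounded reappears on the right after
Cauchy–Schwarz. -/
lemma sq_le_of_le_sqrt_mul {a b : ℝ} (ha : 0 ≤ a) (hb : 0 ≤ b) (h : a ≤ √a * √b) : a ≤ b := by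
  by_contra! hab
  have h1 : √b < √a := Real.sqrt_lt_sqrt hb hab
  have h2 : √a * √b < √a * √a := mul_lt_mul_of_pos_left h1 (Real.sqrt_pos.2 (hb.trans_lt hab))
  rw [Real.mul_self_sqrt ha] at h2
  linarith

/-- Synthesis is the adjoint of the coefficient map, which is an isometry, so it does not increase
norms. Equality fails in general because the frame is redundant. -/
lemma integral_normSq_synth_le (F : Finset Idx) (d : Idx → E3) :
    ∫ x, ‖synth F d x‖ ^ 2 ≤ ∑ p ∈ F, ‖d p‖ ^ 2 := by
  have hm := memLp_synth F d
  refine sq_le_of_le_sqrt_mul (integral_nonneg fun x => by positivity) (by positivity) ?_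
  calc ∫ x, ‖synth F d x‖ ^ 2 = ∑ p ∈ F, inner ℝ (coef p (synth F d)) (d p) := by
        rw [← integral_inner_synth (MemLp.integrable_two hm)]; simp
    _ ≤ _ := sum_inner_le_sqrt _ _ _
    _ ≤ _ := by
        gcongr
        exact sum_le_hasSum F (fun p _ => by positivity) (hasSum_coef_sq hm)

lemma tendsto_of_hasSum {ι E : Type*} [AddCommMonoid E] [TopologicalSpace E] {f : ι → E} {a : E}
    (h : HasSum f a) :
    Filter.Tendsto (fun s : Finset ι => ∑ i ∈ s, f i) Filter.atTop (nhds a) := by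
  simpa [HasSum] using h

lemma coef_sub {f g : T3 → E3} (hf : Integrable f volume) (hg : Integrable g volume) (p : Idx) :
    coef p (f - g) = coef p f - coef p g := by
  simp only [coef, Pi.sub_apply, smul_sub]
  exact integral_sub (integrable_trig_smul hf p) (integrable_trig_smul hg p)

/-- The partial sums of the trigonometric series converge in `L²`. -/
lemma integral_normSq_sub_synth_le {f : T3 → E3} (hf : MemLp f 2 volume) (F : Finset Idx) :
    ∫ x, ‖f x - synth F (fun p => coef p f) x‖ ^ 2 ≤
      (∫ x, ‖f x‖ ^ 2) - ∑ p ∈ F, ‖coef p f‖ ^ 2 := by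
  set v := synth F (fun p => coef p f) with hv
  have hvm : MemLp v 2 volume := memLp_synth F _
  have hr : MemLp (f - v) 2 volume := hf.sub hvm
  have hri := MemLp.integrable_two hr
  have h0 : ∫ x, ‖(f - v) x‖ ^ 2 =
      (∫ x, inner ℝ ((f - v) x) (f x)) - ∑ p ∈ F, inner ℝ (coef p (f - v)) (coef p f) := by
    rw [← integral_inner_synth hri, ← hv, ← integral_sub (integrable_inner_of_memLp hr hf)
      (integrable_inner_of_memLp hr hvm)]
    refine integral_congr_ae (Filter.Eventually.of_forall fun x => ?_)
    simp only
    rw [← inner_sub_right, ← real_inner_self_eq_norm_sq]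
    rfl
  have hsq := hasSum_coef_sq hf
  have hsr := hasSum_coef_sq hr
  -- Without orthogonality, ‖f − v‖² is still the pairing of the coefficients of f − v and f over
  -- the modes outside F. Cauchy–Schwarz bounds it by ‖f − v‖ times the root of the coefficient tail
  -- of f.
  have hlim : Filter.Tendsto (fun G : Finset Idx => ∑ p ∈ G, inner ℝ (coef p (f - v)) (coef p f)
      - ∑ p ∈ F, inner ℝ (coef p (f - v)) (coef p f)) Filter.atTop
      (nhds (∫ x, ‖(f - v) x‖ ^ 2)) := by
    rw [h0]; exact (tendsto_of_hasSum (hasSum_inner_coef hr hf)).sub_const _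
  have hle : ∑ p ∈ F, ‖coef p f‖ ^ 2 ≤ ∫ x, ‖f x‖ ^ 2 :=
    sum_le_hasSum F (fun p _ => by positivity) hsq
  refine sq_le_of_le_sqrt_mul (integral_nonneg fun x => by positivity) (by linarith) ?_
  refine le_of_tendsto hlim ?_
  filter_upwards [Filter.eventually_ge_atTop F] with G hG
  rw [← Finset.sum_sdiff hG, add_sub_cancel_right]
  refine (sum_inner_le_sqrt _ _ _).trans ?_
  gcongr
  · exact sum_le_hasSum _ (fun p _ => by positivity) hsr
  · have := sum_le_hasSum G (fun p _ => by positivity) hsq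
    rw [← Finset.sum_sdiff hG] at this
    linarith

/-! ### Smooth functions on the torus -/

/-- The projection `ℝ³ → ℝ³/ℤ³`. -/
def toTorus (x : Fin 3 → ℝ) : T3 := fun i => (x i : UnitAddCircle)

lemma toTorus_surjective (x : T3) : ∃ y, toTorus y = x := by
  choose y hy using fun i => QuotientAddGroup.mk_surjective (x i)
  exact ⟨y, funext hy⟩

lemma toTorus_add_single (y : Fin 3 → ℝ) (i : Fin 3) (s : ℝ) :
    toTorus (y + Pi.single i s) = toTorus y + Pi.single i (s : UnitAddCircle) := by
  funext j
  by_cases h : j = i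
  · subst h; simp [toTorus]
  · simp [toTorus, h]

lemma isOpenQuotientMap_toTorus : IsOpenQuotientMap toTorus := by
  have : IsOpenQuotientMap (Pi.map fun (_ : Fin 3) (x : ℝ) => (x : UnitAddCircle)) :=
    IsOpenQuotientMap.piMap fun _ => QuotientAddGroup.isOpenQuotientMap_mk
  exact this

lemma SmoothOnTorus.contDiff_lift {φ : T3 → ℝ} (h : SmoothOnTorus φ) :
    ContDiff ℝ ∞ (φ ∘ toTorus) := h

lemma SmoothOnTorus.continuous {φ : T3 → ℝ} (h : SmoothOnTorus φ) : Continuous φ :=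
  isOpenQuotientMap_toTorus.isQuotientMap.continuous_iff.2 h.contDiff_lift.continuous

lemma SmoothOnTorus.hasDerivAt_lift {φ : T3 → ℝ} (h : SmoothOnTorus φ) (i : Fin 3)
    (y : Fin 3 → ℝ) :
    HasDerivAt (fun s : ℝ => φ (toTorus y + Pi.single i (s : UnitAddCircle)))
      (fderiv ℝ (φ ∘ toTorus) y (Pi.single i 1)) 0 := by
  have h1 : HasFDerivAt (φ ∘ toTorus) (fderiv ℝ (φ ∘ toTorus) y)
      (y + (0 : ℝ) • Pi.single i (1 : ℝ)) := by
    simpa using (h.contDiff_lift.differentiable (by simp) y).hasFDerivAt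
  have h2 : HasDerivAt (fun s : ℝ => y + s • (Pi.single i 1 : Fin 3 → ℝ)) (Pi.single i 1) 0 := by
    simpa using ((hasDerivAt_id (0 : ℝ)).smul_const (Pi.single i 1 : Fin 3 → ℝ)).const_add y
  have h3 := h1.comp_hasDerivAt (0 : ℝ) h2
  have e : (fun s : ℝ => φ (toTorus y + Pi.single i (s : UnitAddCircle))) =
      (φ ∘ toTorus) ∘ fun s : ℝ => y + s • (Pi.single i 1 : Fin 3 → ℝ) := by
    funext s
    rw [Function.comp_apply, Function.comp_apply, ← toTorus_add_single, ← Pi.single_smul]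
    simp
  rw [e]
  exact h3

lemma SmoothOnTorus.partialD_toTorus {φ : T3 → ℝ} (h : SmoothOnTorus φ) (i : Fin 3)
    (y : Fin 3 → ℝ) :
    partialD i φ (toTorus y) = fderiv ℝ (φ ∘ toTorus) y (Pi.single i 1) :=
  (h.hasDerivAt_lift i y).deriv

lemma SmoothOnTorus.hasDerivAt {φ : T3 → ℝ} (h : SmoothOnTorus φ) (i : Fin 3) (x : T3) :
    HasDerivAt (fun s : ℝ => φ (x + Pi.single i (s : UnitAddCircle))) (partialD i φ x) 0 := by
  obtain ⟨y, rfl⟩ := toTorus_surjective x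
  rw [h.partialD_toTorus]
  exact h.hasDerivAt_lift i y

lemma SmoothOnTorus.partialD {φ : T3 → ℝ} (h : SmoothOnTorus φ) (i : Fin 3) :
    SmoothOnTorus (partialD i φ) := by
  have : ContDiff ℝ ∞ (fun y => fderiv ℝ (φ ∘ toTorus) y (Pi.single i 1)) :=
    (h.contDiff_lift.fderiv_right (by simp)).clm_apply contDiff_const
  have e : (fun y : Fin 3 → ℝ => Induction.partialD i φ (fun j => (y j : UnitAddCircle))) =
      fun y => fderiv ℝ (φ ∘ toTorus) y (Pi.single i 1) := funext fun y => h.partialD_toTorus i y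
  unfold SmoothOnTorus
  rw [e]
  exact this

lemma SmoothOnTorus.const (c : ℝ) : SmoothOnTorus fun _ => c := contDiff_const

lemma SmoothOnTorus.mul {φ ψ : T3 → ℝ} (hφ : SmoothOnTorus φ) (hψ : SmoothOnTorus ψ) :
    SmoothOnTorus fun x => φ x * ψ x := ContDiff.mul hφ hψ

lemma SmoothOnTorus.sum {ι : Type*} {s : Finset ι} {φ : ι → T3 → ℝ}
    (h : ∀ i ∈ s, SmoothOnTorus (φ i)) : SmoothOnTorus fun x => ∑ i ∈ s, φ i x :=
  ContDiff.sum h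

lemma partialD_mul {φ ψ : T3 → ℝ} (hφ : SmoothOnTorus φ) (hψ : SmoothOnTorus ψ) (i : Fin 3)
    (x : T3) :
    partialD i (fun x => φ x * ψ x) x = partialD i φ x * ψ x + φ x * partialD i ψ x := by
  have := ((hφ.hasDerivAt i x).fun_mul (hψ.hasDerivAt i x)).deriv
  simpa [partialD] using this

lemma partialD_sum {ι : Type*} {s : Finset ι} {φ : ι → T3 → ℝ}
    (h : ∀ a ∈ s, SmoothOnTorus (φ a)) (i : Fin 3) (x : T3) :
    partialD i (fun x => ∑ a ∈ s, φ a x) x = ∑ a ∈ s, partialD i (φ a) x :=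
  (HasDerivAt.fun_sum fun a ha => (h a ha).hasDerivAt i x).deriv

lemma partialD_const (c : ℝ) (i : Fin 3) (x : T3) : partialD i (fun _ => c) x = 0 := by
  simp [partialD]

/-! ### Derivatives of the trigonometric system -/

/-- Exchange of cosine and sine. -/
def flip (p : Idx) : Idx := (p.1, !p.2)

lemma flip_flip (p : Idx) : flip (flip p) = p := by simp [flip]

/-- The factor in `∂ⱼ (trig p) = freq p j * trig (flip p)`. -/
noncomputable def freq (p : Idx) (j : Fin 3) : ℝ :=
  if p.2 then -(2 * Real.pi * p.1 j) else 2 * Real.pi * p.1 j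

lemma freq_flip (p : Idx) (j : Fin 3) : freq (flip p) j = -freq p j := by
  rcases p with ⟨k, _ | _⟩ <;> simp [freq, flip]

lemma mFourier_add_single (k : Fin 3 → ℤ) (x : T3) (j : Fin 3) (s : UnitAddCircle) :
    mFourier k (x + Pi.single j s) = mFourier k x * fourier (k j) s := by
  have : ∀ i, fourier (k i) ((x + Pi.single j s : T3) i) =
      fourier (k i) (x i) * (if i = j then fourier (k j) s else 1) := by
    intro i
    by_cases h : i = j
    · subst h; simp [fourier_apply, smul_add, AddCircle.toCircle_add]
    · simp [h]
  change ∏ i, fourier (k i) ((x + Pi.single j s : T3) i) = (∏ i, fourier (k i) (x i)) * _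
  simp only [this, Finset.prod_mul_distrib, Finset.prod_ite_eq', Finset.mem_univ, if_true]

lemma partialD_trig (p : Idx) (j : Fin 3) (x : T3) :
    partialD j (trig p) x = freq p j * trig (flip p) x := by
  have h : HasDerivAt (fun s : ℝ => mFourier p.1 (x + Pi.single j (s : UnitAddCircle)))
      (mFourier p.1 x * (2 * Real.pi * Complex.I * p.1 j)) 0 := by
    simp only [mFourier_add_single]
    have := (hasDerivAt_fourier 1 (p.1 j) 0).const_mul (mFourier p.1 x)
    simpa using this
  rcases p with ⟨k, _ | _⟩
  · have := (Complex.imCLM.hasFDerivAt.comp_hasDerivAt (0 : ℝ) h).deriv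
    simp only [partialD, trig, freq, flip]
    simpa [Function.comp_def, mul_comm, mul_assoc, mul_left_comm] using this
  · have := (Complex.reCLM.hasFDerivAt.comp_hasDerivAt (0 : ℝ) h).deriv
    simp only [partialD, trig, freq, flip]
    simpa [Function.comp_def, mul_comm, mul_assoc, mul_left_comm] using this

lemma smoothOnTorus_trig (p : Idx) : SmoothOnTorus (trig p) := by
  have h : ContDiff ℝ ∞ (fun y : Fin 3 → ℝ => mFourier p.1 (toTorus y)) := by
    change ContDiff ℝ ∞ (fun y : Fin 3 → ℝ => ∏ i, fourier (p.1 i) (y i : UnitAddCircle))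
    simp only [fourier_coe_apply]
    refine contDiff_prod fun i _ => ?_
    have : ContDiff ℝ ∞ (fun y : Fin 3 → ℝ => ((y i : ℝ) : ℂ)) :=
      Complex.ofRealCLM.contDiff.comp (contDiff_apply ℝ ℝ i)
    exact ((contDiff_const.mul this).div_const _).cexp
  unfold SmoothOnTorus
  rcases p with ⟨k, _ | _⟩
  · exact Complex.imCLM.contDiff.comp h
  · exact Complex.reCLM.contDiff.comp h

/-! ### Differentiation of trigonometric polynomials -/

section

lemma flip_injective : Function.Injective flip := fun p q h => by
  rw [← flip_flip p, h, flip_flip]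

/-- The image of a finite set of indices under `flip`. -/
def flipSet (F : Finset Idx) : Finset Idx := F.map ⟨flip, flip_injective⟩

lemma sum_flipSet {E : Type*} [AddCommMonoid E] (F : Finset Idx) (f : Idx → E) :
    ∑ p ∈ flipSet F, f p = ∑ p ∈ F, f (flip p) := by simp [flipSet]

lemma flipSet_flipSet (F : Finset Idx) : flipSet (flipSet F) = F := by
  ext p
  simp only [flipSet, Finset.mem_map, Function.Embedding.coeFn_mk, exists_exists_and_eq_and,
    flip_flip, exists_eq_right]

/-- The coefficients of `∂ⱼ (synth F d)`. -/
noncomputable def dcoef (j : Fin 3) (d : Idx → E3) (p : Idx) : E3 := freq (flip p) j • d (flip p)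

/-- The derivative `∂ⱼ (synth F d)`. -/
noncomputable def dsynth (j : Fin 3) (F : Finset Idx) (d : Idx → E3) : T3 → E3 :=
  synth (flipSet F) (dcoef j d)

/-- The eigenvalues of `-Δ`. -/
noncomputable def mu (p : Idx) : ℝ := ∑ j, freq p j ^ 2

lemma mu_nonneg (p : Idx) : 0 ≤ mu p := Finset.sum_nonneg fun _ _ => sq_nonneg _

lemma freq_sq_le_mu (p : Idx) (j : Fin 3) : freq p j ^ 2 ≤ mu p :=
  Finset.single_le_sum (f := fun j => freq p j ^ 2) (fun _ _ => sq_nonneg _) (Finset.mem_univ j)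

lemma synth_apply (F : Finset Idx) (d : Idx → E3) (x : T3) (l : Fin 3) :
    synth F d x l = ∑ p ∈ F, trig p x * d p l := by
  simp [synth]

lemma smoothOnTorus_synth (F : Finset Idx) (d : Idx → E3) (l : Fin 3) :
    SmoothOnTorus fun x => synth F d x l := by
  simp only [synth_apply]
  exact SmoothOnTorus.sum fun p _ => (smoothOnTorus_trig p).mul (SmoothOnTorus.const _)

lemma partialD_synth (F : Finset Idx) (d : Idx → E3) (j l : Fin 3) (x : T3) :
    partialD j (fun x => synth F d x l) x = dsynth j F d x l := by
  simp only [dsynth, synth_apply]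
  rw [partialD_sum fun p _ => (smoothOnTorus_trig p).mul (SmoothOnTorus.const _), sum_flipSet]
  refine Finset.sum_congr rfl fun p _ => ?_
  rw [partialD_mul (smoothOnTorus_trig p) (SmoothOnTorus.const _), partialD_const, partialD_trig]
  simp only [dcoef, flip_flip, PiLp.smul_apply, smul_eq_mul]
  ring

lemma dsynth_dsynth (i j : Fin 3) (F : Finset Idx) (d : Idx → E3) :
    dsynth i (flipSet F) (dcoef j d) = synth F (fun p => -(freq p i * freq p j) • d p) := by
  unfold dsynth
  rw [flipSet_flipSet]
  congr 1
  funext p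
  simp only [dcoef, flip_flip, freq_flip, smul_smul]
  congr 1
  ring

lemma dsynth_comm (i j : Fin 3) (F : Finset Idx) (d : Idx → E3) :
    dsynth i (flipSet F) (dcoef j d) = dsynth j (flipSet F) (dcoef i d) := by
  simp only [dsynth_dsynth, mul_comm]

/-- The Laplacian of a trigonometric polynomial. -/
noncomputable def lapSynth (F : Finset Idx) (d : Idx → E3) : T3 → E3 :=
  synth F fun p => -mu p • d p

lemma lapSynth_eq (F : Finset Idx) (d : Idx → E3) (x : T3) :
    lapSynth F d x = ∑ i, dsynth i (flipSet F) (dcoef i d) x := by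
  simp only [dsynth_dsynth, lapSynth, synth]
  rw [Finset.sum_comm]
  refine Finset.sum_congr rfl fun p _ => ?_
  rw [← Finset.smul_sum, ← Finset.sum_smul]
  simp [mu, sq]

lemma integral_normSq_dsynth_le (j : Fin 3) (F : Finset Idx) (d : Idx → E3) :
    ∫ x, ‖dsynth j F d x‖ ^ 2 ≤ ∑ p ∈ F, mu p * ‖d p‖ ^ 2 := by
  refine (integral_normSq_synth_le _ _).trans ?_
  rw [sum_flipSet]
  refine Finset.sum_le_sum fun p _ => ?_
  rw [dcoef, flip_flip, norm_smul, mul_pow, Real.norm_eq_abs, sq_abs]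
  gcongr
  exact freq_sq_le_mu p j

lemma memLp_dsynth (j : Fin 3) (F : Finset Idx) (d : Idx → E3) : MemLp (dsynth j F d) 2 volume :=
  memLp_synth _ _

lemma continuous_dsynth (j : Fin 3) (F : Finset Idx) (d : Idx → E3) :
    Continuous (dsynth j F d) := continuous_synth _ _

/-! ### The velocity at a fixed time: elementary bounds -/

/-- A bounded divergence-free vector field with bounded weak gradient. -/
structure IsSlice (M K : ℝ) (w : T3 → E3) (Dw : Fin 3 → T3 → E3) : Prop where
  bound : ∀ᵐ x, ‖w x‖ ≤ M
  bound_grad : ∀ j, ∀ᵐ x, ‖Dw j x‖ ≤ K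
  weak : ∀ j, HasWeakPartial j w (Dw j)
  div : ∀ᵐ x, ∑ j, Dw j x j = 0

lemma abs_apply_le (v : E3) (l : Fin 3) : |v l| ≤ ‖v‖ := by
  simpa using PiLp.norm_apply_le v l

lemma integrable_mul_continuous {f g : T3 → ℝ} (hf : Integrable f volume) (hg : Continuous g) :
    Integrable (fun x => g x * f x) volume := by
  obtain ⟨C, hC⟩ := (isCompact_univ (X := T3)).exists_bound_of_continuousOn hg.continuousOn
  exact hf.bdd_mul hg.aestronglyMeasurable (Filter.Eventually.of_forall fun x => hC x (mem_univ x))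

lemma integrable_smul_continuous {f : T3 → E3} {g : T3 → ℝ} (hf : Integrable f volume)
    (hg : Continuous g) : Integrable (fun x => g x • f x) volume := by
  obtain ⟨C, hC⟩ := (isCompact_univ (X := T3)).exists_bound_of_continuousOn hg.continuousOn
  exact hf.bdd_smul (φ := g) C hg.aestronglyMeasurable
    (Filter.Eventually.of_forall fun x => hC x (mem_univ x))

lemma integrable_apply {f : T3 → E3} (hf : Integrable f volume) (l : Fin 3) :
    Integrable (fun x => f x l) volume :=
  (EuclideanSpace.proj l : E3 →L[ℝ] ℝ).integrable_comp hf

lemma HasWeakPartial.apply {i : Fin 3} {f g : T3 → E3} (h : HasWeakPartial i f g) {φ : T3 → ℝ}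
    (hφ : SmoothOnTorus φ) (l : Fin 3) :
    ∫ x, partialD i φ x * f x l = -∫ x, φ x * g x l := by
  have := congrArg (fun v : E3 => v l) (h.eq φ hφ)
  simp only [PiLp.neg_apply] at this
  rw [integral_E3_apply (integrable_smul_continuous h.integrable (hφ.partialD i).continuous),
    integral_E3_apply (integrable_smul_continuous h.integrable_deriv hφ.continuous)] at this
  simpa using this

variable {M K : ℝ} {w : T3 → E3} {Dw : Fin 3 → T3 → E3}

lemma IsSlice.integrable (h : IsSlice M K w Dw) : Integrable w volume := (h.weak 0).integrable

lemma IsSlice.integrable_grad (h : IsSlice M K w Dw) (j : Fin 3) : Integrable (Dw j) volume :=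
  (h.weak j).integrable_deriv

/-- Moving the derivatives onto w leaves χ div w = 0. Applied to products, this is what makes
transport antisymmetric. -/
lemma IsSlice.integral_adv_smooth (h : IsSlice M K w Dw) {χ : T3 → ℝ} (hχ : SmoothOnTorus χ) :
    ∫ x, ∑ j, w x j * partialD j χ x = 0 := by
  have h1 : ∀ j, Integrable (fun x => w x j * partialD j χ x) volume := fun j => by
    simp only [mul_comm (w _ j)]
    exact integrable_mul_continuous (integrable_apply h.integrable j) (hχ.partialD j).continuous
  have h2 : ∀ j, Integrable (fun x => χ x * Dw j x j) volume := fun j =>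
    integrable_mul_continuous (integrable_apply (h.integrable_grad j) j) hχ.continuous
  rw [integral_finsetSum _ fun j _ => h1 j]
  have h3 : ∀ j, ∫ x, w x j * partialD j χ x = -∫ x, χ x * Dw j x j := fun j => by
    rw [← (h.weak j).apply hχ j]; simp only [mul_comm]
  simp only [h3]
  rw [Finset.sum_neg_distrib, ← integral_finsetSum _ fun j _ => h2 j, neg_eq_zero]
  rw [← integral_zero T3 ℝ]
  refine integral_congr_ae ?_
  filter_upwards [h.div] with x hx
  rw [← Finset.mul_sum, hx, mul_zero]

/-- The transport term `w · ∇v`, where `V j = ∂ⱼ v`. -/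
noncomputable def adv (w : T3 → E3) (V : Fin 3 → T3 → E3) (x : T3) : E3 := ∑ j, w x j • V j x

lemma gradOp_apply (du : Fin 3 → E3) (v : E3) : gradOp du v = ∑ j, v j • du j := by
  simp [gradOp]

/-- A crude bound term by term; the 3 counts the summands and is the source of every factor 3K
below. -/
lemma norm_sum_smul_le {a : ℝ} (c : E3) (z : Fin 3 → E3) (ha : ∀ j, ‖z j‖ ≤ a) :
    ‖∑ j, c j • z j‖ ≤ 3 * a * ‖c‖ := by
  have : ∀ j : Fin 3, ‖c j • z j‖ ≤ ‖c‖ * a := fun j => by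
    rw [norm_smul]; exact mul_le_mul (abs_apply_le c j) (ha j) (norm_nonneg _) (norm_nonneg _)
  refine (norm_sum_le _ _).trans ((Finset.sum_le_sum fun j _ => this j).trans (le_of_eq ?_))
  simp; ring

lemma norm_gradOp_apply_le {a : ℝ} (du : Fin 3 → E3) (v : E3) (ha : ∀ j, ‖du j‖ ≤ a) :
    ‖gradOp du v‖ ≤ 3 * a * ‖v‖ := by
  rw [gradOp_apply]; exact norm_sum_smul_le v du ha

lemma memLp_bdd_smul {c : T3 → ℝ} {f : T3 → E3} {a : ℝ} (hc : AEStronglyMeasurable c volume)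
    (hb : ∀ᵐ x, |c x| ≤ a) (hf : MemLp f 2 volume) : MemLp (fun x => c x • f x) 2 volume := by
  refine MemLp.of_le_mul (c := a) hf (hc.smul hf.1) ?_
  filter_upwards [hb] with x hx
  rw [norm_smul]
  exact mul_le_mul_of_nonneg_right hx (norm_nonneg _)

lemma memLp_smul_bdd {c : T3 → ℝ} {f : T3 → E3} {a : ℝ} (hf : AEStronglyMeasurable f volume)
    (hb : ∀ᵐ x, ‖f x‖ ≤ a) (hc : MemLp c 2 volume) : MemLp (fun x => c x • f x) 2 volume := by
  refine MemLp.of_le_mul (c := a) hc (hc.1.smul hf) ?_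
  filter_upwards [hb] with x hx
  rw [norm_smul, mul_comm]
  exact mul_le_mul_of_nonneg_right hx (norm_nonneg _)

lemma IsSlice.abs_apply (h : IsSlice M K w Dw) (j : Fin 3) : ∀ᵐ x, |w x j| ≤ M := by
  filter_upwards [h.bound] with x hx using (abs_apply_le _ _).trans hx

lemma IsSlice.memLp_adv (h : IsSlice M K w Dw) {V : Fin 3 → T3 → E3}
    (hV : ∀ j, MemLp (V j) 2 volume) : MemLp (adv w V) 2 volume := by
  refine memLp_finsetSum (f := fun j x => w x j • V j x) _ fun j _ => ?_
  exact memLp_bdd_smul (integrable_apply h.integrable j).1 (h.abs_apply j) (hV j)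

lemma IsSlice.memLp_stretch (h : IsSlice M K w Dw) {v : T3 → E3} (hv : MemLp v 2 volume) :
    MemLp (fun x => gradOp (fun j => Dw j x) (v x)) 2 volume := by
  simp only [gradOp_apply]
  refine memLp_finsetSum (f := fun j x => v x j • Dw j x) _ fun j _ => ?_
  exact memLp_smul_bdd (h.integrable_grad j).1 (h.bound_grad j) (memLp_apply hv j)

lemma IsSlice.bound_grad_all (h : IsSlice M K w Dw) : ∀ᵐ x, ∀ j, ‖Dw j x‖ ≤ K :=
  ae_all_iff.2 h.bound_grad

lemma IsSlice.integral_normSq_stretch_le (h : IsSlice M K w Dw) {v : T3 → E3}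
    (hv : MemLp v 2 volume) :
    ∫ x, ‖gradOp (fun j => Dw j x) (v x)‖ ^ 2 ≤ (3 * K) ^ 2 * ∫ x, ‖v x‖ ^ 2 := by
  rw [← integral_const_mul]
  refine integral_mono_ae (integrable_normSq (h.memLp_stretch hv))
    ((integrable_normSq hv).const_mul _) ?_
  filter_upwards [h.bound_grad_all] with x hx
  rw [← mul_pow]
  exact pow_le_pow_left₀ (norm_nonneg _) (norm_gradOp_apply_le _ _ hx) 2

lemma IsSlice.integral_normSq_smul_le (h : IsSlice M K w Dw) {v : T3 → E3}
    (hv : MemLp v 2 volume) (j : Fin 3) :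
    ∫ x, ‖w x j • v x‖ ^ 2 ≤ M ^ 2 * ∫ x, ‖v x‖ ^ 2 := by
  rw [← integral_const_mul]
  refine integral_mono_ae
    (integrable_normSq (memLp_bdd_smul (integrable_apply h.integrable j).1 (h.abs_apply j) hv))
    ((integrable_normSq hv).const_mul _) ?_
  filter_upwards [h.abs_apply j] with x hx
  simp only [norm_smul, mul_pow, Real.norm_eq_abs]
  gcongr

/-- The 9 combines a factor 3 from Cauchy–Schwarz on the sum over j with the three terms of that
sum. -/
lemma IsSlice.integral_normSq_adv_le (h : IsSlice M K w Dw) {V : Fin 3 → T3 → E3} {G : ℝ}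
    (hV : ∀ j, MemLp (V j) 2 volume) (hG : ∀ j, ∫ x, ‖V j x‖ ^ 2 ≤ G) :
    ∫ x, ‖adv w V x‖ ^ 2 ≤ 9 * M ^ 2 * G := by
  have hm : ∀ j, MemLp (fun x => w x j • V j x) 2 volume := fun j =>
    memLp_bdd_smul (integrable_apply h.integrable j).1 (h.abs_apply j) (hV j)
  calc ∫ x, ‖adv w V x‖ ^ 2 ≤ ∫ x, 3 * ∑ j, ‖w x j • V j x‖ ^ 2 := by
        refine integral_mono (integrable_normSq (h.memLp_adv hV))
          ((integrable_finsetSum _ fun j _ => integrable_normSq (hm j)).const_mul _) fun x => ?_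
        have h1 : ‖adv w V x‖ ≤ ∑ j, ‖w x j • V j x‖ := norm_sum_le _ _
        have h2 := sq_sum_le_card_mul_sum_sq (s := (Finset.univ : Finset (Fin 3)))
          (f := fun j => ‖w x j • V j x‖)
        refine (pow_le_pow_left₀ (norm_nonneg _) h1 2).trans (h2.trans (le_of_eq ?_))
        simp
    _ = 3 * ∑ j, ∫ x, ‖w x j • V j x‖ ^ 2 := by
        rw [integral_const_mul, integral_finsetSum _ fun j _ => integrable_normSq (hm j)]
    _ ≤ 3 * ∑ _j : Fin 3, M ^ 2 * G := by
        gcongr with j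
        exact (h.integral_normSq_smul_le (hV j) j).trans
          (mul_le_mul_of_nonneg_left (hG j) (sq_nonneg M))
    _ = _ := by simp; ring

end

/-! ### Integration by parts against trigonometric polynomials -/

section

variable {M K : ℝ} {w : T3 → E3} {Dw : Fin 3 → T3 → E3}

lemma smoothOnTorus_inner_synth (F F' : Finset Idx) (d d' : Idx → E3) :
    SmoothOnTorus fun x => inner ℝ (synth F d x) (synth F' d' x) := by
  simp only [inner_E3]
  exact SmoothOnTorus.sum fun l _ => (smoothOnTorus_synth F d l).mul (smoothOnTorus_synth F' d' l)

lemma partialD_inner_synth (F F' : Finset Idx) (d d' : Idx → E3) (i : Fin 3) (x : T3) :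
    partialD i (fun x => inner ℝ (synth F d x) (synth F' d' x)) x =
      inner ℝ (dsynth i F d x) (synth F' d' x) + inner ℝ (synth F d x) (dsynth i F' d' x) := by
  simp only [inner_E3]
  rw [partialD_sum fun l _ => (smoothOnTorus_synth F d l).mul (smoothOnTorus_synth F' d' l),
    ← Finset.sum_add_distrib]
  refine Finset.sum_congr rfl fun l _ => ?_
  rw [partialD_mul (smoothOnTorus_synth F d l) (smoothOnTorus_synth F' d' l), partialD_synth,
    partialD_synth]

lemma partialD_inner_dsynth (F : Finset Idx) (d : Idx → E3) (i j k : Fin 3) (x : T3) :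
    partialD i (fun x => inner ℝ (dsynth j F d x) (dsynth k F d x)) x =
      inner ℝ (dsynth i (flipSet F) (dcoef j d) x) (dsynth k F d x) +
        inner ℝ (dsynth j F d x) (dsynth i (flipSet F) (dcoef k d) x) :=
  partialD_inner_synth _ _ _ _ i x

lemma inner_adv (w : T3 → E3) (V : Fin 3 → T3 → E3) (c : E3) (x : T3) :
    inner ℝ c (adv w V x) = ∑ j, w x j * inner ℝ c (V j x) := by
  simp [adv, inner_sum, real_inner_smul_right]

/-- v · (w·∇v) is half of w · ∇|v|², which integrates to zero because w is divergence-free. -/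
lemma IsSlice.integral_inner_adv_self (h : IsSlice M K w Dw) (F : Finset Idx) (d : Idx → E3) :
    ∫ x, inner ℝ (synth F d x) (adv w (fun j => dsynth j F d) x) = 0 := by
  have h1 := h.integral_adv_smooth (smoothOnTorus_inner_synth F F d d)
  have h2 : ∀ x, ∑ j, w x j * partialD j (fun x => inner ℝ (synth F d x) (synth F d x)) x =
      2 * inner ℝ (synth F d x) (adv w (fun j => dsynth j F d) x) := by
    intro x
    rw [inner_adv, Finset.mul_sum]
    refine Finset.sum_congr rfl fun j _ => ?_
    rw [partialD_inner_synth, real_inner_comm (synth F d x)]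
    ring
  simp only [h2] at h1
  rw [integral_const_mul] at h1
  linarith

lemma integrable_apply_mul_inner {f : T3 → E3} (hf : Integrable f volume) (l : Fin 3)
    {a c : T3 → E3} (ha : Continuous a) (hc : Continuous c) :
    Integrable (fun x => f x l * inner ℝ (a x) (c x)) volume := by
  simp only [mul_comm (f _ l)]
  exact integrable_mul_continuous (integrable_apply hf l) (ha.inner hc)

/-- One integration by parts in ∂ᵢ lets the derivative fall on w or on ∂ⱼv. The second case is
transport of ∂ᵢv tested against ∂ᵢv and vanishes by antisymmetry. So only first derivatives of w and
v remain, although the left side contains Δv. -/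
lemma IsSlice.integral_inner_lap_adv (h : IsSlice M K w Dw) (F : Finset Idx) (d : Idx → E3) :
    ∫ x, inner ℝ (lapSynth F d x) (adv w (fun j => dsynth j F d) x) =
      -∑ i, ∑ j, ∫ x, Dw i x j * inner ℝ (dsynth i F d x) (dsynth j F d x) := by
  have hsm : ∀ i j, SmoothOnTorus fun x => inner ℝ (dsynth i F d x) (dsynth j F d x) :=
    fun i j => smoothOnTorus_inner_synth _ _ _ _
  have key : ∀ i j, ∫ x, Dw i x j * inner ℝ (dsynth i F d x) (dsynth j F d x) =
      -((∫ x, w x j * inner ℝ (dsynth i (flipSet F) (dcoef i d) x) (dsynth j F d x)) +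
        ∫ x, w x j * inner ℝ (dsynth i F d x) (dsynth j (flipSet F) (dcoef i d) x)) := by
    intro i j
    -- The weak derivative of w is tested against ∂ᵢv · ∂ⱼv, which is smooth because v is a
    -- trigonometric polynomial.
    have h1 := (h.weak i).apply (hsm i j) j
    rw [← integral_add
      (integrable_apply_mul_inner h.integrable j (continuous_dsynth _ _ _) (continuous_dsynth _ _ _))
      (integrable_apply_mul_inner h.integrable j (continuous_dsynth _ _ _) (continuous_dsynth _ _ _)),
      eq_neg_iff_add_eq_zero, add_comm, ← eq_neg_iff_add_eq_zero]
    simp only [mul_comm (Dw i _ j)]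
    rw [← h1]
    refine integral_congr_ae (Filter.Eventually.of_forall fun x => ?_)
    simp only
    rw [partialD_inner_dsynth, dsynth_comm j i]
    ring
  simp only [key, Finset.sum_neg_distrib, neg_neg, Finset.sum_add_distrib]
  have h0 : ∀ i, ∑ j, ∫ x, w x j * inner ℝ (dsynth i F d x) (dsynth j (flipSet F) (dcoef i d) x)
      = 0 := by
    intro i
    rw [← integral_finsetSum _ fun j _ => integrable_apply_mul_inner h.integrable j
      (continuous_dsynth _ _ _) (continuous_dsynth _ _ _)]
    simp only [← inner_adv]
    exact h.integral_inner_adv_self (flipSet F) (dcoef i d)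
  simp only [h0, Finset.sum_const_zero, add_zero]
  rw [Finset.sum_comm]
  have e : ∀ x, inner ℝ (lapSynth F d x) (adv w (fun j => dsynth j F d) x) =
      ∑ j, ∑ i, w x j * inner ℝ (dsynth i (flipSet F) (dcoef i d) x) (dsynth j F d x) := by
    intro x
    rw [inner_adv]
    refine Finset.sum_congr rfl fun j _ => ?_
    rw [lapSynth_eq, sum_inner, Finset.mul_sum]
  simp only [e]
  have hi : ∀ i j, Integrable (fun x =>
      w x j * inner ℝ (dsynth i (flipSet F) (dcoef i d) x) (dsynth j F d x)) volume := fun i j =>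
    integrable_apply_mul_inner h.integrable j (continuous_dsynth _ _ _) (continuous_dsynth _ _ _)
  rw [integral_finsetSum _ fun j _ => integrable_finsetSum _ fun i _ => hi i j]
  exact Finset.sum_congr rfl fun j _ => integral_finsetSum _ fun i _ => hi i j

/-- Moving one derivative of Δv onto v · ∇w produces ∇²w. Stretching is the only term that brings in
second derivatives of the velocity. -/
lemma IsSlice.integral_inner_stretch_lap (h : IsSlice M K w Dw) {D2w : Fin 3 → Fin 3 → T3 → E3}
    (h2 : ∀ i j, HasWeakPartial i (Dw j) (D2w i j)) (F : Finset Idx) (d : Idx → E3) :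
    ∫ x, inner ℝ (gradOp (fun j => Dw j x) (synth F d x)) (lapSynth F d x) =
      -∑ i, ∑ j, ((∫ x, dsynth i F d x j * inner ℝ (Dw j x) (dsynth i F d x)) +
        ∫ x, synth F d x j * inner ℝ (D2w i j x) (dsynth i F d x)) := by
  have hcs : ∀ l, Continuous fun x => synth F d x l := fun l =>
    (smoothOnTorus_synth F d l).continuous
  have hcd : ∀ i l, Continuous fun x => dsynth i F d x l := fun i l =>
    (smoothOnTorus_synth _ _ l).continuous
  have hcdd : ∀ i l, Continuous fun x => dsynth i (flipSet F) (dcoef i d) x l := fun i l =>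
    (smoothOnTorus_synth _ _ l).continuous
  have hi : ∀ i j l, Integrable (fun x =>
      synth F d x j * dsynth i (flipSet F) (dcoef i d) x l * Dw j x l) volume := fun i j l =>
    integrable_mul_continuous (integrable_apply (h.integrable_grad j) l) ((hcs j).mul (hcdd i l))
  have hi1 : ∀ i j l, Integrable (fun x =>
      dsynth i F d x j * dsynth i F d x l * Dw j x l) volume := fun i j l =>
    integrable_mul_continuous (integrable_apply (h.integrable_grad j) l) ((hcd i j).mul (hcd i l))
  have hi2 : ∀ i j l, Integrable (fun x =>
      synth F d x j * dsynth i F d x l * D2w i j x l) volume := fun i j l =>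
    integrable_mul_continuous (integrable_apply (h2 i j).integrable_deriv l)
      ((hcs j).mul (hcd i l))
  have key : ∀ i j l, ∫ x, synth F d x j * dsynth i F d x l * D2w i j x l =
      -((∫ x, dsynth i F d x j * dsynth i F d x l * Dw j x l) +
        ∫ x, synth F d x j * dsynth i (flipSet F) (dcoef i d) x l * Dw j x l) := by
    intro i j l
    have hs : SmoothOnTorus fun x => synth F d x j * dsynth i F d x l :=
      (smoothOnTorus_synth F d j).mul (smoothOnTorus_synth _ _ l)
    have h1 := (h2 i j).apply hs l
    rw [← integral_add (hi1 i j l) (hi i j l), eq_neg_iff_add_eq_zero, add_comm, ← eq_neg_iff_add_eq_zero,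
      ← h1]
    refine integral_congr_ae (Filter.Eventually.of_forall fun x => ?_)
    simp only
    rw [dsynth, partialD_mul (smoothOnTorus_synth F d j) (smoothOnTorus_synth _ _ l),
      partialD_synth, partialD_synth, ← dsynth]
    ring
  have e1 : ∀ i j, (∫ x, dsynth i F d x j * inner ℝ (Dw j x) (dsynth i F d x)) =
      ∑ l, ∫ x, dsynth i F d x j * dsynth i F d x l * Dw j x l := by
    intro i j
    rw [← integral_finsetSum _ fun l _ => hi1 i j l]
    refine integral_congr_ae (Filter.Eventually.of_forall fun x => ?_)
    simp only
    rw [inner_E3, Finset.mul_sum]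
    exact Finset.sum_congr rfl fun l _ => by ring
  have e2 : ∀ i j, (∫ x, synth F d x j * inner ℝ (D2w i j x) (dsynth i F d x)) =
      ∑ l, ∫ x, synth F d x j * dsynth i F d x l * D2w i j x l := by
    intro i j
    rw [← integral_finsetSum _ fun l _ => hi2 i j l]
    refine integral_congr_ae (Filter.Eventually.of_forall fun x => ?_)
    simp only
    rw [inner_E3, Finset.mul_sum]
    exact Finset.sum_congr rfl fun l _ => by ring
  have e3 : ∀ x, inner ℝ (gradOp (fun j => Dw j x) (synth F d x)) (lapSynth F d x) =
      ∑ i, ∑ j, ∑ l, synth F d x j * dsynth i (flipSet F) (dcoef i d) x l * Dw j x l := by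
    intro x
    rw [gradOp_apply, lapSynth_eq, inner_sum]
    refine Finset.sum_congr rfl fun i _ => ?_
    rw [sum_inner]
    refine Finset.sum_congr rfl fun j _ => ?_
    rw [real_inner_smul_left, inner_E3, Finset.mul_sum]
    exact Finset.sum_congr rfl fun l _ => by ring
  simp only [e3, e1, e2, key]
  rw [integral_finsetSum _ fun i _ => integrable_finsetSum _ fun j _ =>
    integrable_finsetSum _ fun l _ => hi i j l, ← Finset.sum_neg_distrib]
  refine Finset.sum_congr rfl fun i _ => ?_
  rw [integral_finsetSum _ fun j _ => integrable_finsetSum _ fun l _ => hi i j l,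
    ← Finset.sum_neg_distrib]
  refine Finset.sum_congr rfl fun j _ => ?_
  rw [integral_finsetSum _ fun l _ => hi i j l, ← Finset.sum_add_distrib,
    ← Finset.sum_neg_distrib]
  exact Finset.sum_congr rfl fun l _ => by ring

/-! ### The forcing b · ∇w − w · ∇b in weak form -/

/-- The coefficients of `b · ∇w - w · ∇b`, in weak form. -/
noncomputable def forc (w : T3 → E3) (Dw : Fin 3 → T3 → E3) (p : Idx) (b : T3 → E3) : E3 :=
  ∫ x, ((∑ j, w x j * partialD j (trig p) x) • b x + trig p x • gradOp (fun j => Dw j x) (b x))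

lemma IsSlice.integrable_transport (h : IsSlice M K w Dw) {χ : T3 → ℝ} (hχ : SmoothOnTorus χ)
    {b : T3 → E3} (hb : MemLp b 2 volume) :
    Integrable (fun x => (∑ j, w x j * partialD j χ x) • b x) volume := by
  simp only [Finset.sum_smul]
  refine integrable_finsetSum _ fun j _ => ?_
  have := integrable_smul_continuous (MemLp.integrable_two
    (memLp_bdd_smul (integrable_apply h.integrable j).1 (h.abs_apply j) hb))
    (hχ.partialD j).continuous
  simpa only [smul_smul, mul_comm] using this

lemma IsSlice.integrable_smul_stretch (h : IsSlice M K w Dw) {χ : T3 → ℝ} (hχ : Continuous χ)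
    {b : T3 → E3} (hb : MemLp b 2 volume) :
    Integrable (fun x => χ x • gradOp (fun j => Dw j x) (b x)) volume :=
  integrable_smul_continuous (MemLp.integrable_two (h.memLp_stretch hb)) hχ

/-- The right-hand side `b · ∇w - w · ∇b` for a trigonometric polynomial `b`. -/
noncomputable def rhsSynth (w : T3 → E3) (Dw : Fin 3 → T3 → E3) (F : Finset Idx) (d : Idx → E3)
    (x : T3) : E3 :=
  gradOp (fun j => Dw j x) (synth F d x) - adv w (fun j => dsynth j F d) x

lemma IsSlice.memLp_rhsSynth (h : IsSlice M K w Dw) (F : Finset Idx) (d : Idx → E3) :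
    MemLp (rhsSynth w Dw F d) 2 volume :=
  (h.memLp_stretch (memLp_synth F d)).sub (h.memLp_adv fun _ => memLp_dsynth _ _ _)

/-- Weak incompressibility, applied to the product of `trig p` with each component of the
polynomial, moves the derivative from the test function to the field, so the weak coefficients are
those of a genuine L² field. -/
lemma IsSlice.forc_synth (h : IsSlice M K w Dw) (p : Idx) (F : Finset Idx) (d : Idx → E3) :
    forc w Dw p (synth F d) = coef p (rhsSynth w Dw F d) := by
  have hs := memLp_synth F d
  have i1 := h.integrable_transport (smoothOnTorus_trig p) hs
  have i2 := h.integrable_smul_stretch (continuous_trig p) hs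
  have i3 := integrable_trig_smul (MemLp.integrable_two (h.memLp_rhsSynth F d)) p
  have i12 : Integrable (fun x => (∑ j, w x j * partialD j (trig p) x) • synth F d x +
      trig p x • gradOp (fun j => Dw j x) (synth F d x)) volume := i1.add i2
  rw [← sub_eq_zero, forc, coef, ← integral_sub i12 i3]
  ext l
  rw [PiLp.zero_apply]
  refine (integral_E3_apply (i12.sub i3) l).trans ?_
  have h1 := h.integral_adv_smooth ((smoothOnTorus_trig p).mul (smoothOnTorus_synth F d l))
  rw [← h1]
  refine integral_congr_ae (Filter.Eventually.of_forall fun x => ?_)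
  simp only [partialD_mul (smoothOnTorus_trig p) (smoothOnTorus_synth F d l), partialD_synth]
  simp [rhsSynth, adv, Finset.sum_mul, Finset.mul_sum, mul_sub]
  rw [show ∀ a b c : ℝ, a + b - (b - c) = a + c from fun a b c => by ring, ← Finset.sum_add_distrib]
  exact Finset.sum_congr rfl fun j _ => by ring

end

/-! ### Bounds for the forcing coefficients of an L² field -/

section

variable {M K : ℝ} {w : T3 → E3} {Dw : Fin 3 → T3 → E3}

lemma integrable_fun_add {α : Type*} [MeasurableSpace α] {μ : Measure α} {f g : α → ℝ}
    (hf : Integrable f μ) (hg : Integrable g μ) : Integrable (fun x => f x + g x) μ := hf.add hg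

lemma IsSlice.nonneg_bound (h : IsSlice M K w Dw) : 0 ≤ M := by
  obtain ⟨x, hx⟩ := h.bound.exists
  exact (norm_nonneg _).trans hx

lemma IsSlice.nonneg_bound_grad (h : IsSlice M K w Dw) : 0 ≤ K := by
  obtain ⟨x, hx⟩ := (h.bound_grad 0).exists
  exact (norm_nonneg _).trans hx

lemma IsSlice.memLp_smul (h : IsSlice M K w Dw) {b : T3 → E3} (hb : MemLp b 2 volume)
    (j : Fin 3) : MemLp (fun x => w x j • b x) 2 volume :=
  memLp_bdd_smul (integrable_apply h.integrable j).1 (h.abs_apply j) hb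

lemma IsSlice.forc_eq (h : IsSlice M K w Dw) {b : T3 → E3} (hb : MemLp b 2 volume) (p : Idx) :
    forc w Dw p b = ∑ j, freq p j • coef (flip p) (fun x => w x j • b x) +
      coef p (fun x => gradOp (fun j => Dw j x) (b x)) := by
  rw [forc, integral_add (h.integrable_transport (smoothOnTorus_trig p) hb)
    (h.integrable_smul_stretch (continuous_trig p) hb)]
  congr 1
  simp only [Finset.sum_smul, coef, ← integral_smul]
  rw [← integral_finsetSum]
  · refine integral_congr_ae (Filter.Eventually.of_forall fun x => ?_)
    refine Finset.sum_congr rfl fun j _ => ?_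
    rw [partialD_trig, smul_smul, smul_smul]
    congr 1; ring
  · intro j _
    exact (integrable_trig_smul (MemLp.integrable_two (h.memLp_smul hb j)) (flip p)).smul (freq p j)

lemma normSq_coef_le {f : T3 → E3} (hf : MemLp f 2 volume) (p : Idx) :
    ‖coef p f‖ ^ 2 ≤ ∫ x, ‖f x‖ ^ 2 := by
  simpa using sum_le_hasSum {p} (fun q _ => by positivity) (hasSum_coef_sq hf)

lemma norm_coef_le {f : T3 → E3} (hf : MemLp f 2 volume) (p : Idx) :
    ‖coef p f‖ ≤ √(∫ x, ‖f x‖ ^ 2) :=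
  Real.le_sqrt_of_sq_le (normSq_coef_le hf p)

lemma abs_freq_le (p : Idx) (j : Fin 3) : |freq p j| ≤ √(mu p) :=
  Real.abs_le_sqrt (freq_sq_le_mu p j)

lemma IsSlice.norm_forc_le_coef (h : IsSlice M K w Dw) {b : T3 → E3} (hb : MemLp b 2 volume)
    (p : Idx) :
    ‖forc w Dw p b‖ ≤ √(mu p) * ∑ j, ‖coef (flip p) (fun x => w x j • b x)‖ +
      ‖coef p (fun x => gradOp (fun j => Dw j x) (b x))‖ := by
  rw [h.forc_eq hb, Finset.mul_sum]
  refine (norm_add_le _ _).trans (add_le_add_left ((norm_sum_le _ _).trans ?_) _)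
  refine Finset.sum_le_sum fun j _ => ?_
  rw [norm_smul]
  exact mul_le_mul_of_nonneg_right (abs_freq_le p j) (norm_nonneg _)

lemma IsSlice.norm_forc_le (h : IsSlice M K w Dw) {b : T3 → E3} (hb : MemLp b 2 volume)
    (p : Idx) :
    ‖forc w Dw p b‖ ≤ (3 * √(mu p) * M + 3 * K) * √(∫ x, ‖b x‖ ^ 2) := by
  have hM := h.nonneg_bound
  have hK := h.nonneg_bound_grad
  refine (h.norm_forc_le_coef hb p).trans ?_
  have h1 : ∀ j, ‖coef (flip p) (fun x => w x j • b x)‖ ≤ M * √(∫ x, ‖b x‖ ^ 2) := fun j => by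
    refine (norm_coef_le (h.memLp_smul hb j) _).trans ?_
    refine (Real.sqrt_le_sqrt (h.integral_normSq_smul_le hb j)).trans ?_
    rw [Real.sqrt_mul (sq_nonneg M), Real.sqrt_sq hM]
  have h2 : ‖coef p (fun x => gradOp (fun j => Dw j x) (b x))‖ ≤ 3 * K * √(∫ x, ‖b x‖ ^ 2) := by
    refine (norm_coef_le (h.memLp_stretch hb) _).trans ?_
    refine (Real.sqrt_le_sqrt (h.integral_normSq_stretch_le hb)).trans ?_
    rw [Real.sqrt_mul (sq_nonneg _), Real.sqrt_sq (by positivity)]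
  have h3 : √(mu p) * ∑ j, ‖coef (flip p) (fun x => w x j • b x)‖ ≤
      √(mu p) * (3 * (M * √(∫ x, ‖b x‖ ^ 2))) := by
    refine mul_le_mul_of_nonneg_left ((Finset.sum_le_sum fun j _ => h1 j).trans ?_)
      (Real.sqrt_nonneg _)
    simp
  linarith

lemma IsSlice.forc_sub (h : IsSlice M K w Dw) {b c : T3 → E3} (hb : MemLp b 2 volume)
    (hc : MemLp c 2 volume) (p : Idx) :
    forc w Dw p (b - c) = forc w Dw p b - forc w Dw p c := by
  have i : ∀ {b : T3 → E3}, MemLp b 2 volume → Integrable (fun x =>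
      (∑ j, w x j * partialD j (trig p) x) • b x + trig p x • gradOp (fun j => Dw j x) (b x))
      volume := fun hb => (h.integrable_transport (smoothOnTorus_trig p) hb).add
        (h.integrable_smul_stretch (continuous_trig p) hb)
  rw [forc, forc, forc, ← integral_sub (i hb) (i hc)]
  refine integral_congr_ae (Filter.Eventually.of_forall fun x => ?_)
  simp only [Pi.sub_apply, smul_sub, map_sub]
  abel

lemma tendsto_normSq_sub_synth {b : T3 → E3} (hb : MemLp b 2 volume) :
    Filter.Tendsto (fun F : Finset Idx => (∫ x, ‖b x‖ ^ 2) - ∑ p ∈ F, ‖coef p b‖ ^ 2)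
      Filter.atTop (nhds 0) := by
  have := (tendsto_of_hasSum (hasSum_coef_sq hb)).const_sub (∫ x, ‖b x‖ ^ 2)
  rwa [sub_self] at this

lemma IsSlice.tendsto_forc_synth (h : IsSlice M K w Dw) {b : T3 → E3} (hb : MemLp b 2 volume)
    (p : Idx) :
    Filter.Tendsto (fun F : Finset Idx => forc w Dw p (synth F fun q => coef q b)) Filter.atTop
      (nhds (forc w Dw p b)) := by
  rw [tendsto_iff_norm_sub_tendsto_zero]
  have h1 := ((Real.continuous_sqrt.tendsto 0).comp (tendsto_normSq_sub_synth hb)).const_mul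
    (3 * √(mu p) * M + 3 * K)
  rw [Real.sqrt_zero, mul_zero] at h1
  refine squeeze_zero (fun _ => norm_nonneg _) (fun F => ?_) h1
  have hs := memLp_synth F fun q => coef q b
  rw [norm_sub_rev, ← h.forc_sub hb hs]
  refine (h.norm_forc_le (hb.sub hs) p).trans ?_
  have hM := h.nonneg_bound
  have hK := h.nonneg_bound_grad
  exact mul_le_mul_of_nonneg_left (Real.sqrt_le_sqrt (integral_normSq_sub_synth_le hb F))
    (by positivity)

/-- Pairing the coefficients with d amounts to testing with the polynomial built from d. All
derivatives fall on that polynomial, so b need only be in L². -/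
lemma IsSlice.sum_inner_forc (h : IsSlice M K w Dw) {b : T3 → E3} (hb : MemLp b 2 volume)
    (F : Finset Idx) (d : Idx → E3) :
    ∑ p ∈ F, inner ℝ (forc w Dw p b) (d p) =
      (∫ x, inner ℝ (b x) (adv w (fun j => dsynth j F d) x)) +
        ∫ x, inner ℝ (gradOp (fun j => Dw j x) (b x)) (synth F d x) := by
  rw [integral_inner_synth (MemLp.integrable_two (h.memLp_stretch hb))]
  have e : ∀ x, inner ℝ (b x) (adv w (fun j => dsynth j F d) x) =
      ∑ j, inner ℝ (w x j • b x) (dsynth j F d x) := fun x => by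
    rw [inner_adv]; simp only [real_inner_smul_left]
  simp only [e]
  rw [integral_finsetSum _ fun j _ =>
    integrable_inner_of_memLp (h.memLp_smul hb j) (memLp_dsynth j F d)]
  have e2 : ∀ j, ∫ x, inner ℝ (w x j • b x) (dsynth j F d x) =
      ∑ p ∈ F, inner ℝ (freq p j • coef (flip p) (fun x => w x j • b x)) (d p) := fun j => by
    rw [dsynth, integral_inner_synth (MemLp.integrable_two (h.memLp_smul hb j)), sum_flipSet]
    refine Finset.sum_congr rfl fun p _ => ?_
    rw [dcoef, flip_flip, real_inner_smul_left, real_inner_smul_right]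
  simp only [e2]
  rw [Finset.sum_comm, ← Finset.sum_add_distrib]
  refine Finset.sum_congr rfl fun p _ => ?_
  rw [h.forc_eq hb, inner_add_left, sum_inner]

lemma IsSlice.abs_sum_grad_le (h : IsSlice M K w Dw) (F : Finset Idx) (d : Idx → E3) :
    |∑ i, ∑ j, ∫ x, Dw i x j * inner ℝ (dsynth i F d x) (dsynth j F d x)| ≤
      9 * K * ∑ p ∈ F, mu p * ‖d p‖ ^ 2 := by
  have hK := h.nonneg_bound_grad
  set G := ∑ p ∈ F, mu p * ‖d p‖ ^ 2 with hG
  have hG0 : 0 ≤ G := Finset.sum_nonneg fun p _ => mul_nonneg (mu_nonneg p) (sq_nonneg _)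
  have h1 : ∀ i j, |∫ x, Dw i x j * inner ℝ (dsynth i F d x) (dsynth j F d x)| ≤ K * G := by
    intro i j
    refine (abs_integral_le_integral_abs).trans ?_
    calc ∫ x, |Dw i x j * inner ℝ (dsynth i F d x) (dsynth j F d x)|
        ≤ ∫ x, K * (‖dsynth i F d x‖ * ‖dsynth j F d x‖) := by
          refine integral_mono_ae (integrable_apply_mul_inner (h.integrable_grad i) j
            (continuous_dsynth _ _ _) (continuous_dsynth _ _ _)).abs
            ((integrable_norm_mul_norm (memLp_dsynth _ _ _) (memLp_dsynth _ _ _)).const_mul K) ?_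
          filter_upwards [h.bound_grad i] with x hx
          rw [abs_mul]
          exact mul_le_mul ((abs_apply_le _ _).trans hx) (abs_real_inner_le_norm _ _)
            (abs_nonneg _) hK
      _ ≤ K * (√G * √G) := by
          rw [integral_const_mul]
          refine mul_le_mul_of_nonneg_left ((integral_norm_mul_norm_le (memLp_dsynth _ _ _)
            (memLp_dsynth _ _ _)).trans ?_) hK
          gcongr
          · exact integral_normSq_dsynth_le i F d
          · exact integral_normSq_dsynth_le j F d
      _ = K * G := by rw [Real.mul_self_sqrt hG0]
  refine (Finset.abs_sum_le_sum_abs _ _).trans ?_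
  calc ∑ i, |∑ j, ∫ x, Dw i x j * inner ℝ (dsynth i F d x) (dsynth j F d x)|
      ≤ ∑ _i : Fin 3, ∑ _j : Fin 3, K * G :=
        Finset.sum_le_sum fun i _ => (Finset.abs_sum_le_sum_abs _ _).trans
          (Finset.sum_le_sum fun j _ => h1 i j)
    _ = 9 * K * G := by simp; ring

/-! ### The resolvent as smoothing operator and the transport error -/

/-- The symbol of the resolvent `(1 - ε Δ)⁻¹`. -/
noncomputable def res (ε : ℝ) (p : Idx) : ℝ := (1 + ε * mu p)⁻¹

lemma one_add_pos {ε : ℝ} (hε : 0 ≤ ε) (p : Idx) : 0 < 1 + ε * mu p := by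
  have := mul_nonneg hε (mu_nonneg p); linarith

lemma res_pos {ε : ℝ} (hε : 0 ≤ ε) (p : Idx) : 0 < res ε p := inv_pos.2 (one_add_pos hε p)

lemma res_le_one {ε : ℝ} (hε : 0 ≤ ε) (p : Idx) : res ε p ≤ 1 :=
  inv_le_one_of_one_le₀ (by have := mul_nonneg hε (mu_nonneg p); linarith)

lemma res_mul_mu {ε : ℝ} (hε : 0 ≤ ε) (p : Idx) : ε * mu p * res ε p = 1 - res ε p := by
  have := (one_add_pos hε p).ne'
  unfold res; field_simp; ring

/-- The resolvent gains a derivative at the price ε^(-1/2), which makes sums finite at fixed ε. -/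
lemma mu_mul_res_sq_le {ε : ℝ} (hε : 0 < ε) (p : Idx) : mu p * res ε p ^ 2 ≤ ε⁻¹ := by
  have h1 := res_mul_mu hε.le p
  have h2 := res_pos hε.le p
  have h3 := res_le_one hε.le p
  rw [← one_div, le_div_iff₀ hε]
  have : mu p * res ε p ^ 2 * ε = (1 - res ε p) * res ε p := by rw [← h1]; ring
  rw [this]
  nlinarith

/-- Mode by mode, ε‖∇b_ε‖² is dominated by the defect 1 − `res`, whose weighted sum tends to 0 with
ε. This makes the transport error vanish. -/
lemma eps_mul_mu_mul_res_sq_le {ε : ℝ} (hε : 0 ≤ ε) (p : Idx) :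
    ε * (mu p * res ε p ^ 2) ≤ 1 - res ε p := by
  have h1 := res_mul_mu hε p
  have h2 := res_pos hε p
  have h3 := res_le_one hε p
  have : ε * (mu p * res ε p ^ 2) = (1 - res ε p) * res ε p := by rw [← h1]; ring
  rw [this]
  nlinarith

lemma summable_one_sub_res {b : T3 → E3} (hb : MemLp b 2 volume) {ε : ℝ} (hε : 0 ≤ ε) :
    Summable fun p => (1 - res ε p) * ‖coef p b‖ ^ 2 := by
  refine Summable.of_nonneg_of_le (fun p => mul_nonneg (by linarith [res_le_one hε p])
    (sq_nonneg _)) (fun p => ?_) (hasSum_coef_sq hb).summable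
  exact mul_le_of_le_one_left (sq_nonneg _) (by linarith [res_pos hε p])

lemma sum_one_sub_res_le {b : T3 → E3} (hb : MemLp b 2 volume) {ε : ℝ} (hε : 0 ≤ ε)
    (F : Finset Idx) :
    ∑ p ∈ F, (1 - res ε p) * ‖coef p b‖ ^ 2 ≤ ∑' p, (1 - res ε p) * ‖coef p b‖ ^ 2 :=
  (summable_one_sub_res hb hε).sum_le_tsum F fun p _ =>
    mul_nonneg (by linarith [res_le_one hε p]) (sq_nonneg _)

/-- The error term of the energy identity for the smoothed field on a finite set of modes. -/
lemma IsSlice.abs_sum_res_le (h : IsSlice M K w Dw) {b : T3 → E3} (hb : MemLp b 2 volume)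
    {ε : ℝ} (hε : 0 < ε) (F : Finset Idx) :
    |∑ p ∈ F, inner ℝ (forc w Dw p b) (res ε p • coef p b) -
        ∫ x, inner ℝ (gradOp (fun j => Dw j x) (b x)) (b x)| ≤
      √((∫ x, ‖b x‖ ^ 2) - ∑ p ∈ F, ‖coef p b‖ ^ 2) *
          (√(9 * M ^ 2 * (ε⁻¹ * ∫ x, ‖b x‖ ^ 2)) + √((3 * K) ^ 2 * ∫ x, ‖b x‖ ^ 2)) +
        9 * K * (∑' p, (1 - res ε p) * ‖coef p b‖ ^ 2) +
        √((3 * K) ^ 2 * ∫ x, ‖b x‖ ^ 2) * √(∑' p, (1 - res ε p) * ‖coef p b‖ ^ 2) := by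
  have hK := h.nonneg_bound_grad
  set E := ∫ x, ‖b x‖ ^ 2 with hE
  set Q := ∑' p, (1 - res ε p) * ‖coef p b‖ ^ 2 with hQ
  set d : Idx → E3 := fun p => res ε p • coef p b with hd
  set bF := synth F fun p => coef p b with hbF
  have hbFm : MemLp bF 2 volume := memLp_synth _ _
  have hr : MemLp (b - bF) 2 volume := hb.sub hbFm
  have hV : ∀ j, MemLp (dsynth j F d) 2 volume := fun j => memLp_dsynth _ _ _
  have hadv := h.memLp_adv hV
  have hst := h.memLp_stretch hb
  have hcs : MemLp (synth F d) 2 volume := memLp_synth _ _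
  have hlap : MemLp (lapSynth F d) 2 volume := memLp_synth _ _
  have hq : MemLp (synth F fun p => (1 - res ε p) • coef p b) 2 volume := memLp_synth _ _
  have hEF : ∑ p ∈ F, ‖coef p b‖ ^ 2 ≤ E :=
    sum_le_hasSum F (fun p _ => by positivity) (hasSum_coef_sq hb)
  -- The polynomial with coefficients `d` is b_ε truncated to F, and the truncation of b is (1 − εΔ)
  -- of it.
  have e1 : ∀ x, bF x = synth F d x - ε • lapSynth F d x := by
    intro x
    simp only [hbF, hd, lapSynth, synth, Finset.smul_sum]
    rw [← Finset.sum_sub_distrib]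
    refine Finset.sum_congr rfl fun p _ => ?_
    have : (1 : ℝ) = res ε p + ε * (mu p * res ε p) := by
      have := res_mul_mu hε.le p; linarith
    conv_lhs => rw [← one_smul ℝ (coef p b), this]
    module
  have e2 : ∀ x, b x = (b - bF) x + synth F d x +
      synth F (fun p => (1 - res ε p) • coef p b) x := by
    intro x
    have : synth F d x + synth F (fun p => (1 - res ε p) • coef p b) x = bF x := by
      simp only [hbF, hd, synth]
      rw [← Finset.sum_add_distrib]
      refine Finset.sum_congr rfl fun p _ => ?_
      module
    rw [add_assoc, this, Pi.sub_apply, sub_add_cancel]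
  -- With b = (b − bF) + b_ε − εΔb_ε, the b_ε term vanishes by antisymmetry and the Laplacian term
  -- becomes ε times a quadratic form in ∇b_ε with coefficients ∇w.
  have t1 : ∫ x, inner ℝ (b x) (adv w (fun j => dsynth j F d) x) =
      (∫ x, inner ℝ ((b - bF) x) (adv w (fun j => dsynth j F d) x)) +
        ε * ∑ i, ∑ j, ∫ x, Dw i x j * inner ℝ (dsynth i F d x) (dsynth j F d x) := by
    have : ∀ x, inner ℝ (b x) (adv w (fun j => dsynth j F d) x) =
        (inner ℝ ((b - bF) x) (adv w (fun j => dsynth j F d) x) +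
          inner ℝ (synth F d x) (adv w (fun j => dsynth j F d) x)) -
          ε * inner ℝ (lapSynth F d x) (adv w (fun j => dsynth j F d) x) := by
      intro x
      rw [Pi.sub_apply, inner_sub_left, e1, inner_sub_left, real_inner_smul_left]
      ring
    simp only [this]
    rw [integral_sub (integrable_fun_add (integrable_inner_of_memLp hr hadv)
        (integrable_inner_of_memLp hcs hadv))
      ((integrable_inner_of_memLp hlap hadv).const_mul ε),
      integral_add (integrable_inner_of_memLp hr hadv) (integrable_inner_of_memLp hcs hadv),
      integral_const_mul, h.integral_inner_adv_self, h.integral_inner_lap_adv]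
    ring
  have t2 : ∫ x, inner ℝ (gradOp (fun j => Dw j x) (b x)) (b x) =
      (∫ x, inner ℝ (gradOp (fun j => Dw j x) (b x)) ((b - bF) x)) +
      (∫ x, inner ℝ (gradOp (fun j => Dw j x) (b x)) (synth F d x)) +
      ∫ x, inner ℝ (gradOp (fun j => Dw j x) (b x))
        (synth F (fun p => (1 - res ε p) • coef p b) x) := by
    rw [← integral_add (integrable_inner_of_memLp hst hr) (integrable_inner_of_memLp hst hcs),
      ← integral_add (integrable_fun_add (integrable_inner_of_memLp hst hr)
        (integrable_inner_of_memLp hst hcs))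
        (integrable_inner_of_memLp hst hq)]
    refine integral_congr_ae (Filter.Eventually.of_forall fun x => ?_)
    simp only [← inner_add_right]
    rw [← e2]
  have hsum : ∑ p ∈ F, mu p * ‖d p‖ ^ 2 ≤ ε⁻¹ * E := by
    calc ∑ p ∈ F, mu p * ‖d p‖ ^ 2 ≤ ∑ p ∈ F, ε⁻¹ * ‖coef p b‖ ^ 2 := by
          refine Finset.sum_le_sum fun p _ => ?_
          rw [hd, norm_smul, mul_pow, ← mul_assoc, Real.norm_eq_abs, sq_abs]
          exact mul_le_mul_of_nonneg_right (mu_mul_res_sq_le hε p) (sq_nonneg _)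
      _ ≤ ε⁻¹ * E := by rw [← Finset.mul_sum]; gcongr
  have hsum2 : ε * ∑ p ∈ F, mu p * ‖d p‖ ^ 2 ≤ Q := by
    refine le_trans ?_ (sum_one_sub_res_le hb hε.le F)
    rw [Finset.mul_sum]
    refine Finset.sum_le_sum fun p _ => ?_
    rw [hd, norm_smul, mul_pow, ← mul_assoc (mu p), ← mul_assoc, Real.norm_eq_abs, sq_abs]
    exact mul_le_mul_of_nonneg_right (eps_mul_mu_mul_res_sq_le hε.le p) (sq_nonneg _)
  -- The truncation error carries ε⁻¹, so F has to exhaust all modes at fixed ε before ε tends to 0.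
  have b1 : |∫ x, inner ℝ ((b - bF) x) (adv w (fun j => dsynth j F d) x)| ≤
      √(E - ∑ p ∈ F, ‖coef p b‖ ^ 2) * √(9 * M ^ 2 * (ε⁻¹ * E)) := by
    refine (abs_integral_inner_le hr hadv).trans ?_
    gcongr
    · exact integral_normSq_sub_synth_le hb F
    · exact h.integral_normSq_adv_le hV fun j => (integral_normSq_dsynth_le j F d).trans hsum
  have b2 : |ε * ∑ i, ∑ j, ∫ x, Dw i x j * inner ℝ (dsynth i F d x) (dsynth j F d x)| ≤
      9 * K * Q := by
    rw [abs_mul, abs_of_pos hε]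
    refine (mul_le_mul_of_nonneg_left (h.abs_sum_grad_le F d) hε.le).trans ?_
    have := mul_le_mul_of_nonneg_left hsum2 (show 0 ≤ 9 * K by positivity)
    linarith
  have b3 : |∫ x, inner ℝ (gradOp (fun j => Dw j x) (b x)) ((b - bF) x)| ≤
      √((3 * K) ^ 2 * E) * √(E - ∑ p ∈ F, ‖coef p b‖ ^ 2) := by
    refine (abs_integral_inner_le hst hr).trans ?_
    gcongr
    · exact h.integral_normSq_stretch_le hb
    · exact integral_normSq_sub_synth_le hb F
  have b4 : |∫ x, inner ℝ (gradOp (fun j => Dw j x) (b x))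
        (synth F (fun p => (1 - res ε p) • coef p b) x)| ≤ √((3 * K) ^ 2 * E) * √Q := by
    refine (abs_integral_inner_le hst hq).trans ?_
    gcongr
    · exact h.integral_normSq_stretch_le hb
    · refine (integral_normSq_synth_le _ _).trans (le_trans ?_ (sum_one_sub_res_le hb hε.le F))
      refine Finset.sum_le_sum fun p _ => ?_
      rw [norm_smul, mul_pow, Real.norm_eq_abs, sq_abs]
      refine mul_le_mul_of_nonneg_right ?_ (sq_nonneg _)
      have := res_pos hε.le p
      have := res_le_one hε.le p
      nlinarith
  rw [h.sum_inner_forc hb, t1, t2]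
  rw [abs_le] at b1 b2 b3 b4 ⊢
  constructor <;> linarith [b1.1, b1.2, b2.1, b2.2, b3.1, b3.2, b4.1, b4.2]

end

/-! ### Removing the smoothing in the transport term -/

section

variable {M K : ℝ} {w : T3 → E3} {Dw : Fin 3 → T3 → E3}

lemma sqrt_sq_mul {a c : ℝ} (ha : 0 ≤ a) : √(a ^ 2 * c) = a * √c := by
  rw [Real.sqrt_mul (sq_nonneg a), Real.sqrt_sq ha]

lemma sum_coef_mul_coef_le {f g : T3 → E3} (hf : MemLp f 2 volume) (hg : MemLp g 2 volume)
    (F : Finset Idx) :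
    ∑ p ∈ F, ‖coef p f‖ * ‖coef p g‖ ≤ √(∫ x, ‖f x‖ ^ 2) * √(∫ x, ‖g x‖ ^ 2) := by
  refine (Real.sum_mul_le_sqrt_mul_sqrt F _ _).trans ?_
  gcongr
  · exact sum_le_hasSum _ (fun p _ => by positivity) (hasSum_coef_sq hf)
  · exact sum_le_hasSum _ (fun p _ => by positivity) (hasSum_coef_sq hg)

lemma sum_coef_flip_mul_coef_le {f g : T3 → E3} (hf : MemLp f 2 volume) (hg : MemLp g 2 volume)
    (F : Finset Idx) :
    ∑ p ∈ F, ‖coef (flip p) f‖ * ‖coef p g‖ ≤ √(∫ x, ‖f x‖ ^ 2) * √(∫ x, ‖g x‖ ^ 2) := by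
  refine (Real.sum_mul_le_sqrt_mul_sqrt F _ _).trans ?_
  gcongr
  · rw [← sum_flipSet F fun p => ‖coef p f‖ ^ 2]
    exact sum_le_hasSum _ (fun p _ => by positivity) (hasSum_coef_sq hf)
  · exact sum_le_hasSum _ (fun p _ => by positivity) (hasSum_coef_sq hg)

/-- The derivative in the transport term costs √`mu`, which the resolvent symbol absorbs into √ε⁻¹;
the rest is Cauchy–Schwarz between coefficient sequences. Independence of F permits exchanging the
sum over modes with the time integral. -/
lemma IsSlice.sum_abs_res_le (h : IsSlice M K w Dw) {b : T3 → E3} (hb : MemLp b 2 volume)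
    {ε : ℝ} (hε : 0 < ε) (F : Finset Idx) :
    ∑ p ∈ F, |inner ℝ (forc w Dw p b) (res ε p • coef p b)| ≤
      (3 * √ε⁻¹ * M + 3 * K) * ∫ x, ‖b x‖ ^ 2 := by
  have hM := h.nonneg_bound
  have hK := h.nonneg_bound_grad
  set E := ∫ x, ‖b x‖ ^ 2 with hE
  have hE0 : 0 ≤ E := integral_nonneg fun x => by positivity
  have h1 : ∀ p, |inner ℝ (forc w Dw p b) (res ε p • coef p b)| ≤
      √ε⁻¹ * (∑ j, ‖coef (flip p) (fun x => w x j • b x)‖ * ‖coef p b‖) +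
        ‖coef p (fun x => gradOp (fun j => Dw j x) (b x))‖ * ‖coef p b‖ := by
    intro p
    have r0 := (res_pos hε.le p).le
    have r1 := res_le_one hε.le p
    have r2 : res ε p * √(mu p) ≤ √ε⁻¹ := by
      refine Real.le_sqrt_of_sq_le ?_
      rw [mul_pow, Real.sq_sqrt (mu_nonneg p), mul_comm]
      exact mu_mul_res_sq_le hε p
    refine (abs_real_inner_le_norm _ _).trans ?_
    rw [norm_smul, Real.norm_eq_abs, abs_of_nonneg r0, ← Finset.sum_mul]
    set S := ∑ j, ‖coef (flip p) (fun x => w x j • b x)‖ with hS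
    have hS0 : 0 ≤ S := Finset.sum_nonneg fun _ _ => norm_nonneg _
    calc ‖forc w Dw p b‖ * (res ε p * ‖coef p b‖)
        ≤ (√(mu p) * S + ‖coef p (fun x => gradOp (fun j => Dw j x) (b x))‖) *
          (res ε p * ‖coef p b‖) := by
          gcongr; exact h.norm_forc_le_coef hb p
      _ = (res ε p * √(mu p)) * (S * ‖coef p b‖) +
          res ε p * (‖coef p (fun x => gradOp (fun j => Dw j x) (b x))‖ * ‖coef p b‖) := by ring
      _ ≤ √ε⁻¹ * (S * ‖coef p b‖) +
          1 * (‖coef p (fun x => gradOp (fun j => Dw j x) (b x))‖ * ‖coef p b‖) := by gcongr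
      _ = _ := by ring
  refine (Finset.sum_le_sum fun p _ => h1 p).trans ?_
  rw [Finset.sum_add_distrib, ← Finset.mul_sum, Finset.sum_comm]
  have h2 : ∀ j, ∑ p ∈ F, ‖coef (flip p) (fun x => w x j • b x)‖ * ‖coef p b‖ ≤ M * E := by
    intro j
    refine (sum_coef_flip_mul_coef_le (h.memLp_smul hb j) hb F).trans ?_
    calc _ ≤ √(M ^ 2 * E) * √E := by gcongr; exact h.integral_normSq_smul_le hb j
      _ = M * E := by rw [sqrt_sq_mul hM, mul_assoc, Real.mul_self_sqrt hE0]
  have h3 : ∑ p ∈ F, ‖coef p (fun x => gradOp (fun j => Dw j x) (b x))‖ * ‖coef p b‖ ≤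
      3 * K * E := by
    refine (sum_coef_mul_coef_le (h.memLp_stretch hb) hb F).trans ?_
    calc _ ≤ √((3 * K) ^ 2 * E) * √E := by gcongr; exact h.integral_normSq_stretch_le hb
      _ = 3 * K * E := by rw [sqrt_sq_mul (by positivity), mul_assoc, Real.mul_self_sqrt hE0]
  have h4 := mul_le_mul_of_nonneg_left (Finset.sum_le_sum fun j (_ : j ∈ Finset.univ) => h2 j)
    (Real.sqrt_nonneg ε⁻¹)
  simp only [Finset.sum_const, Finset.card_univ, Fintype.card_fin, nsmul_eq_mul] at h4
  push_cast at h4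
  linarith

lemma IsSlice.summable_res (h : IsSlice M K w Dw) {b : T3 → E3} (hb : MemLp b 2 volume)
    {ε : ℝ} (hε : 0 < ε) :
    Summable fun p => inner ℝ (forc w Dw p b) (res ε p • coef p b) :=
  Summable.of_abs (summable_of_sum_le (fun _ => abs_nonneg _) (h.sum_abs_res_le hb hε))

/-- The transport term does not contribute to the energy of the smoothed field in the limit. -/
lemma IsSlice.abs_tsum_res_sub_le (h : IsSlice M K w Dw) {b : T3 → E3} (hb : MemLp b 2 volume)
    {ε : ℝ} (hε : 0 < ε) :
    |∑' p, inner ℝ (forc w Dw p b) (res ε p • coef p b) -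
        ∫ x, inner ℝ (gradOp (fun j => Dw j x) (b x)) (b x)| ≤
      9 * K * (∑' p, (1 - res ε p) * ‖coef p b‖ ^ 2) +
        √((3 * K) ^ 2 * ∫ x, ‖b x‖ ^ 2) * √(∑' p, (1 - res ε p) * ‖coef p b‖ ^ 2) := by
  have h1 := ((tendsto_of_hasSum (h.summable_res hb hε).hasSum).sub_const
    (∫ x, inner ℝ (gradOp (fun j => Dw j x) (b x)) (b x))).abs
  have h2 := ((((Real.continuous_sqrt.tendsto 0).comp (tendsto_normSq_sub_synth hb)).mul_const
    (√(9 * M ^ 2 * (ε⁻¹ * ∫ x, ‖b x‖ ^ 2)) + √((3 * K) ^ 2 * ∫ x, ‖b x‖ ^ 2))).add_const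
    (9 * K * (∑' p, (1 - res ε p) * ‖coef p b‖ ^ 2))).add_const
    (√((3 * K) ^ 2 * ∫ x, ‖b x‖ ^ 2) * √(∑' p, (1 - res ε p) * ‖coef p b‖ ^ 2))
  rw [Real.sqrt_zero, zero_mul, zero_add] at h2
  exact le_of_tendsto_of_tendsto' h1 h2 fun F => h.abs_sum_res_le hb hε F

lemma tsum_one_sub_res_le {b : T3 → E3} (hb : MemLp b 2 volume) {ε : ℝ} (hε : 0 ≤ ε) :
    ∑' p, (1 - res ε p) * ‖coef p b‖ ^ 2 ≤ ∫ x, ‖b x‖ ^ 2 := by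
  rw [← (hasSum_coef_sq hb).tsum_eq]
  refine (summable_one_sub_res hb hε).tsum_le_tsum (fun p => ?_) (hasSum_coef_sq hb).summable
  exact mul_le_of_le_one_left (sq_nonneg _) (by linarith [res_pos hε p])

/-- The defect sum is at most ‖b‖², so both error terms have bounds independent of ε, with 12 = 9 +
3. This is the majorant for dominated convergence in time. -/
lemma IsSlice.abs_tsum_res_sub_le' (h : IsSlice M K w Dw) {b : T3 → E3} (hb : MemLp b 2 volume)
    {ε : ℝ} (hε : 0 < ε) :
    |∑' p, inner ℝ (forc w Dw p b) (res ε p • coef p b) -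
        ∫ x, inner ℝ (gradOp (fun j => Dw j x) (b x)) (b x)| ≤ 12 * K * ∫ x, ‖b x‖ ^ 2 := by
  have hK := h.nonneg_bound_grad
  have hE0 : 0 ≤ ∫ x, ‖b x‖ ^ 2 := integral_nonneg fun x => by positivity
  have hQ := tsum_one_sub_res_le hb hε.le
  refine (h.abs_tsum_res_sub_le hb hε).trans ?_
  calc _ ≤ 9 * K * (∫ x, ‖b x‖ ^ 2) +
        √((3 * K) ^ 2 * ∫ x, ‖b x‖ ^ 2) * √(∫ x, ‖b x‖ ^ 2) := by gcongr
    _ = _ := by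
        rw [sqrt_sq_mul (by positivity), mul_assoc (3 * K), Real.mul_self_sqrt hE0]; ring

lemma tendsto_res (p : Idx) : Filter.Tendsto (fun n : ℕ => res (1 / (n + 1)) p) Filter.atTop
    (nhds 1) := by
  have h1 : Filter.Tendsto (fun n : ℕ => 1 + (1 / ((n : ℝ) + 1)) * mu p) Filter.atTop
      (nhds (1 + 0 * mu p)) :=
    (tendsto_one_div_add_atTop_nhds_zero_nat.mul_const _).const_add 1
  have := h1.inv₀ (by simp)
  simpa [res] using this

lemma tendsto_tsum_one_sub_res {b : T3 → E3} (hb : MemLp b 2 volume) :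
    Filter.Tendsto (fun n : ℕ => ∑' p, (1 - res (1 / (n + 1)) p) * ‖coef p b‖ ^ 2) Filter.atTop
      (nhds 0) := by
  have h0 : (0 : ℝ) = ∑' p : Idx, (1 - 1) * ‖coef p b‖ ^ 2 := by simp
  rw [h0]
  refine tendsto_tsum_of_dominated_convergence (hasSum_coef_sq hb).summable
    (fun p => ((tendsto_res p).const_sub 1).mul_const _)
    (Filter.Eventually.of_forall fun n p => ?_)
  have hn : (0 : ℝ) ≤ 1 / ((n : ℝ) + 1) := by positivity
  rw [Real.norm_eq_abs, abs_of_nonneg (mul_nonneg (by linarith [res_le_one hn p]) (sq_nonneg _))]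
  exact mul_le_of_le_one_left (sq_nonneg _) (by linarith [res_pos hn p])

lemma IsSlice.tendsto_tsum_res (h : IsSlice M K w Dw) {b : T3 → E3} (hb : MemLp b 2 volume) :
    Filter.Tendsto
      (fun n : ℕ => ∑' p, inner ℝ (forc w Dw p b) (res (1 / (n + 1)) p • coef p b)) Filter.atTop
      (nhds (∫ x, inner ℝ (gradOp (fun j => Dw j x) (b x)) (b x))) := by
  rw [tendsto_iff_norm_sub_tendsto_zero]
  have h1 := tendsto_tsum_one_sub_res hb
  have h2 := (h1.const_mul (9 * K)).add
    (((Real.continuous_sqrt.tendsto 0).comp h1).const_mul √((3 * K) ^ 2 * ∫ x, ‖b x‖ ^ 2))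
  rw [Real.sqrt_zero, mul_zero, mul_zero, add_zero] at h2
  exact squeeze_zero (fun _ => norm_nonneg _)
    (fun n => h.abs_tsum_res_sub_le hb (by positivity)) h2

lemma IsSlice.abs_integral_stretch_le (h : IsSlice M K w Dw) {b : T3 → E3}
    (hb : MemLp b 2 volume) {k : ℝ} (hk : ∀ᵐ x, ‖gradOp (fun j => Dw j x)‖ ≤ k) :
    |∫ x, inner ℝ (gradOp (fun j => Dw j x) (b x)) (b x)| ≤ k * ∫ x, ‖b x‖ ^ 2 := by
  refine (abs_integral_le_integral_abs).trans ?_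
  rw [← integral_const_mul]
  refine integral_mono_ae (integrable_inner_of_memLp (h.memLp_stretch hb) hb).abs
    ((integrable_normSq hb).const_mul _) ?_
  filter_upwards [hk] with x hx
  refine (abs_real_inner_le_norm _ _).trans ?_
  rw [sq, ← mul_assoc]
  gcongr
  exact ((gradOp fun j => Dw j x).le_opNorm _).trans (by gcongr)

/-! ### The forcing of an H¹ field -/

lemma IsSlice.integral_normSq_rhsSynth_le (h : IsSlice M K w Dw) (F : Finset Idx)
    (d : Idx → E3) :
    ∫ x, ‖rhsSynth w Dw F d x‖ ^ 2 ≤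
      18 * (K ^ 2 + M ^ 2) * ∑ p ∈ F, (1 + mu p) * ‖d p‖ ^ 2 := by
  have hs := memLp_synth F d
  have h1 := h.memLp_stretch hs
  have h2 := h.memLp_adv fun j => memLp_dsynth j F d
  have h3 := h.integral_normSq_stretch_le hs
  have h4 := h.integral_normSq_adv_le (fun j => memLp_dsynth j F d)
    fun j => integral_normSq_dsynth_le j F d
  have h5 := integral_normSq_synth_le F d
  have h6 : ∫ x, ‖rhsSynth w Dw F d x‖ ^ 2 ≤
      2 * (∫ x, ‖gradOp (fun j => Dw j x) (synth F d x)‖ ^ 2) +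
        2 * ∫ x, ‖adv w (fun j => dsynth j F d) x‖ ^ 2 := by
    rw [← integral_const_mul, ← integral_const_mul,
      ← integral_add ((integrable_normSq h1).const_mul 2) ((integrable_normSq h2).const_mul 2)]
    refine integral_mono (integrable_normSq (h.memLp_rhsSynth F d))
      (((integrable_normSq h1).const_mul 2).add ((integrable_normSq h2).const_mul 2)) fun x => ?_
    have := norm_sub_le (gradOp (fun j => Dw j x) (synth F d x)) (adv w (fun j => dsynth j F d) x)
    simp only [rhsSynth]
    nlinarith [norm_nonneg (gradOp (fun j => Dw j x) (synth F d x) -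
      adv w (fun j => dsynth j F d) x), sq_nonneg (‖gradOp (fun j => Dw j x) (synth F d x)‖ -
      ‖adv w (fun j => dsynth j F d) x‖)]
  have h7 : ∑ p ∈ F, (1 + mu p) * ‖d p‖ ^ 2 = ∑ p ∈ F, ‖d p‖ ^ 2 + ∑ p ∈ F, mu p * ‖d p‖ ^ 2 := by
    rw [← Finset.sum_add_distrib]; exact Finset.sum_congr rfl fun p _ => by ring
  have h8 : 0 ≤ ∑ p ∈ F, mu p * ‖d p‖ ^ 2 :=
    Finset.sum_nonneg fun p _ => mul_nonneg (mu_nonneg p) (sq_nonneg _)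
  have h9 : 0 ≤ ∑ p ∈ F, ‖d p‖ ^ 2 := Finset.sum_nonneg fun p _ => sq_nonneg _
  rw [h7]
  nlinarith [mul_le_mul_of_nonneg_left h5 (sq_nonneg K), mul_nonneg (sq_nonneg K) h8,
    mul_nonneg (sq_nonneg M) h9]

lemma synth_sub_of_subset {F G : Finset Idx} (hFG : F ⊆ G) (d : Idx → E3) :
    synth G d - synth F d = synth (G \ F) d := by
  funext x
  simp only [Pi.sub_apply, synth]
  rw [← Finset.sum_sdiff hFG, add_sub_cancel_right]

lemma summable_one_add_mu {b : T3 → E3} (hb : MemLp b 2 volume)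
    (hs : Summable fun p => mu p * ‖coef p b‖ ^ 2) :
    Summable fun p => (1 + mu p) * ‖coef p b‖ ^ 2 := by
  simpa only [add_mul, one_mul] using (hasSum_coef_sq hb).summable.add hs

/-- For polynomials over G ⊇ F the difference of forcings consists of the coefficients of an L²
field, so Parseval bounds it by the H¹ mass of the modes in G \ F. Each coefficient is L²-continuous
in the field, so G may grow to all modes. -/
lemma IsSlice.sum_normSq_forc_sub_le (h : IsSlice M K w Dw) {b : T3 → E3} (hb : MemLp b 2 volume)
    (hs : Summable fun p => mu p * ‖coef p b‖ ^ 2) (F F' : Finset Idx) :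
    ∑ p ∈ F', ‖forc w Dw p b - forc w Dw p (synth F fun q => coef q b)‖ ^ 2 ≤
      18 * (K ^ 2 + M ^ 2) * ((∑' p, (1 + mu p) * ‖coef p b‖ ^ 2) -
        ∑ p ∈ F, (1 + mu p) * ‖coef p b‖ ^ 2) := by
  have hlim := tendsto_finsetSum F' fun p _ => (((h.tendsto_forc_synth hb p).sub_const
    (forc w Dw p (synth F fun q => coef q b))).norm.pow 2)
  refine le_of_tendsto hlim ?_
  filter_upwards [Filter.eventually_ge_atTop F] with G hG
  have h1 : ∀ p, forc w Dw p (synth G fun q => coef q b) - forc w Dw p (synth F fun q => coef q b) =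
      coef p (rhsSynth w Dw (G \ F) fun q => coef q b) := fun p => by
    rw [← h.forc_sub (memLp_synth _ _) (memLp_synth _ _), synth_sub_of_subset hG, h.forc_synth]
  simp only [h1]
  refine (sum_le_hasSum F' (fun p _ => by positivity)
    (hasSum_coef_sq (h.memLp_rhsSynth _ _))).trans ((h.integral_normSq_rhsSynth_le _ _).trans ?_)
  refine mul_le_mul_of_nonneg_left ?_ (by positivity)
  rw [le_sub_iff_add_le, Finset.sum_sdiff hG]
  exact (summable_one_add_mu hb hs).sum_le_tsum G fun p _ =>
    mul_nonneg (by linarith [mu_nonneg p]) (sq_nonneg _)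

lemma IsSlice.sum_normSq_forc_le (h : IsSlice M K w Dw) {b : T3 → E3} (hb : MemLp b 2 volume)
    (hs : Summable fun p => mu p * ‖coef p b‖ ^ 2) (F' : Finset Idx) :
    ∑ p ∈ F', ‖forc w Dw p b‖ ^ 2 ≤
      18 * (K ^ 2 + M ^ 2) * ∑' p, (1 + mu p) * ‖coef p b‖ ^ 2 := by
  simpa [synth, forc] using h.sum_normSq_forc_sub_le hb hs ∅ F'

/-- The two identities for Δv, from stretching and from transport, each give nine terms of size
K‖∇v‖², hence 18K. The nine terms with second derivatives of w are paired with v and ∇v only. -/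
lemma IsSlice.abs_integral_rhs_lap_le (h : IsSlice M K w Dw) {D2w : Fin 3 → Fin 3 → T3 → E3}
    (h2 : ∀ i j, HasWeakPartial i (Dw j) (D2w i j)) {H : ℝ} (hH : ∀ i j, ∀ᵐ x, ‖D2w i j x‖ ≤ H)
    (F : Finset Idx) (d : Idx → E3) :
    |∫ x, inner ℝ (rhsSynth w Dw F d x) (lapSynth F d x)| ≤
      18 * K * (∑ p ∈ F, mu p * ‖d p‖ ^ 2) +
        9 * H * (√(∑ p ∈ F, ‖d p‖ ^ 2) * √(∑ p ∈ F, mu p * ‖d p‖ ^ 2)) := by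
  have hK := h.nonneg_bound_grad
  have hH0 : 0 ≤ H := by
    obtain ⟨x, hx⟩ := (hH 0 0).exists
    exact (norm_nonneg _).trans hx
  set G := ∑ p ∈ F, mu p * ‖d p‖ ^ 2 with hG
  set E := ∑ p ∈ F, ‖d p‖ ^ 2 with hE
  have hG0 : 0 ≤ G := Finset.sum_nonneg fun p _ => mul_nonneg (mu_nonneg p) (sq_nonneg _)
  have hs := memLp_synth F d
  have hl : MemLp (lapSynth F d) 2 volume := memLp_synth _ _
  have hst := h.memLp_stretch hs
  have hadv := h.memLp_adv fun j => memLp_dsynth j F d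
  have hcs : ∀ l, Continuous fun x => synth F d x l := fun l =>
    (smoothOnTorus_synth F d l).continuous
  have hcd : ∀ i l, Continuous fun x => dsynth i F d x l := fun i l =>
    (smoothOnTorus_synth _ _ l).continuous
  have b1 : ∀ i j, |∫ x, dsynth i F d x j * inner ℝ (Dw j x) (dsynth i F d x)| ≤ K * G := by
    intro i j
    refine (abs_integral_le_integral_abs).trans ?_
    calc ∫ x, |dsynth i F d x j * inner ℝ (Dw j x) (dsynth i F d x)|
        ≤ ∫ x, K * ‖dsynth i F d x‖ ^ 2 := by
          refine integral_mono_of_nonneg (Filter.Eventually.of_forall fun x => abs_nonneg _)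
            ((integrable_normSq (memLp_dsynth _ _ _)).const_mul K) ?_
          filter_upwards [h.bound_grad j] with x hx
          simp only [abs_mul]
          calc |dsynth i F d x j| * |inner ℝ (Dw j x) (dsynth i F d x)|
              ≤ ‖dsynth i F d x‖ * (‖Dw j x‖ * ‖dsynth i F d x‖) :=
                mul_le_mul (abs_apply_le _ _) (abs_real_inner_le_norm _ _) (abs_nonneg _)
                  (norm_nonneg _)
            _ ≤ ‖dsynth i F d x‖ * (K * ‖dsynth i F d x‖) := by gcongr
            _ = _ := by ring
      _ ≤ K * G := by
          rw [integral_const_mul]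
          exact mul_le_mul_of_nonneg_left (integral_normSq_dsynth_le i F d) hK
  have b2 : ∀ i j, |∫ x, synth F d x j * inner ℝ (D2w i j x) (dsynth i F d x)| ≤
      H * (√E * √G) := by
    intro i j
    refine (abs_integral_le_integral_abs).trans ?_
    calc ∫ x, |synth F d x j * inner ℝ (D2w i j x) (dsynth i F d x)|
        ≤ ∫ x, H * (‖synth F d x‖ * ‖dsynth i F d x‖) := by
          refine integral_mono_of_nonneg (Filter.Eventually.of_forall fun x => abs_nonneg _)
            ((integrable_norm_mul_norm hs (memLp_dsynth _ _ _)).const_mul H) ?_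
          filter_upwards [hH i j] with x hx
          simp only [abs_mul]
          calc |synth F d x j| * |inner ℝ (D2w i j x) (dsynth i F d x)|
              ≤ ‖synth F d x‖ * (‖D2w i j x‖ * ‖dsynth i F d x‖) :=
                mul_le_mul (abs_apply_le _ _) (abs_real_inner_le_norm _ _) (abs_nonneg _)
                  (norm_nonneg _)
            _ ≤ ‖synth F d x‖ * (H * ‖dsynth i F d x‖) := by gcongr
            _ = _ := by ring
      _ ≤ H * (√E * √G) := by
          rw [integral_const_mul]
          refine mul_le_mul_of_nonneg_left ((integral_norm_mul_norm_le hs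
            (memLp_dsynth _ _ _)).trans ?_) hH0
          gcongr
          · exact integral_normSq_synth_le F d
          · exact integral_normSq_dsynth_le i F d
  have b3 : |∑ i, ∑ j, ((∫ x, dsynth i F d x j * inner ℝ (Dw j x) (dsynth i F d x)) +
        ∫ x, synth F d x j * inner ℝ (D2w i j x) (dsynth i F d x))| ≤
      9 * K * G + 9 * H * (√E * √G) := by
    calc _ ≤ ∑ i : Fin 3, ∑ j : Fin 3, (K * G + H * (√E * √G)) :=
          (Finset.abs_sum_le_sum_abs _ _).trans (Finset.sum_le_sum fun i _ =>
            (Finset.abs_sum_le_sum_abs _ _).trans (Finset.sum_le_sum fun j _ =>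
              (abs_add_le _ _).trans (add_le_add (b1 i j) (b2 i j))))
      _ = _ := by simp; ring
  have e : ∫ x, inner ℝ (rhsSynth w Dw F d x) (lapSynth F d x) =
      (∫ x, inner ℝ (gradOp (fun j => Dw j x) (synth F d x)) (lapSynth F d x)) -
        ∫ x, inner ℝ (lapSynth F d x) (adv w (fun j => dsynth j F d) x) := by
    rw [← integral_sub (integrable_inner_of_memLp hst hl) (integrable_inner_of_memLp hl hadv)]
    refine integral_congr_ae (Filter.Eventually.of_forall fun x => ?_)
    simp only [rhsSynth]
    rw [inner_sub_left, real_inner_comm (lapSynth F d x) (adv w _ x)]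
  rw [e, h.integral_inner_stretch_lap h2, h.integral_inner_lap_adv]
  have b4 := h.abs_sum_grad_le F d
  rw [abs_le] at b3 b4 ⊢
  constructor <;> linarith [b3.1, b3.2, b4.1, b4.2]

end

/-! ### The production rate of the gradient energy -/

section

variable {M K : ℝ} {w : T3 → E3} {Dw : Fin 3 → T3 → E3}

lemma IsSlice.sum_abs_mu_inner_le (h : IsSlice M K w Dw) {b : T3 → E3} (hb : MemLp b 2 volume)
    (hs : Summable fun p => mu p * ‖coef p b‖ ^ 2)
    (hs2 : Summable fun p => mu p ^ 2 * ‖coef p b‖ ^ 2) (F : Finset Idx) :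
    ∑ p ∈ F, |mu p * inner ℝ (forc w Dw p b) (coef p b)| ≤
      18 * (K ^ 2 + M ^ 2) * (∑' p, (1 + mu p) * ‖coef p b‖ ^ 2) +
        ∑' p, mu p ^ 2 * ‖coef p b‖ ^ 2 := by
  have h1 : ∀ p, |mu p * inner ℝ (forc w Dw p b) (coef p b)| ≤
      ‖forc w Dw p b‖ ^ 2 + mu p ^ 2 * ‖coef p b‖ ^ 2 := fun p => by
    rw [abs_mul, abs_of_nonneg (mu_nonneg p)]
    have h2 : mu p * |inner ℝ (forc w Dw p b) (coef p b)| ≤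
        mu p * (‖forc w Dw p b‖ * ‖coef p b‖) :=
      mul_le_mul_of_nonneg_left (abs_real_inner_le_norm _ _) (mu_nonneg p)
    nlinarith [sq_nonneg (‖forc w Dw p b‖ - mu p * ‖coef p b‖),
      mul_nonneg (mu_nonneg p) (mul_nonneg (norm_nonneg (forc w Dw p b)) (norm_nonneg (coef p b)))]
  refine (Finset.sum_le_sum fun p _ => h1 p).trans ?_
  rw [Finset.sum_add_distrib]
  exact add_le_add (h.sum_normSq_forc_le hb hs F)
    (hs2.sum_le_tsum F fun p _ => mul_nonneg (sq_nonneg _) (sq_nonneg _))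

lemma IsSlice.summable_mu_inner (h : IsSlice M K w Dw) {b : T3 → E3} (hb : MemLp b 2 volume)
    (hs : Summable fun p => mu p * ‖coef p b‖ ^ 2)
    (hs2 : Summable fun p => mu p ^ 2 * ‖coef p b‖ ^ 2) :
    Summable fun p => mu p * inner ℝ (forc w Dw p b) (coef p b) :=
  Summable.of_abs (summable_of_sum_le (fun _ => abs_nonneg _) (h.sum_abs_mu_inner_le hb hs hs2))

/-- The growth rate of the gradient energy is controlled by the derivatives of the velocity. -/
lemma IsSlice.abs_tsum_mu_inner_le (h : IsSlice M K w Dw) {b : T3 → E3} (hb : MemLp b 2 volume)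
    (hs : Summable fun p => mu p * ‖coef p b‖ ^ 2)
    (hs2 : Summable fun p => mu p ^ 2 * ‖coef p b‖ ^ 2)
    {D2w : Fin 3 → Fin 3 → T3 → E3}
    (h2 : ∀ i j, HasWeakPartial i (Dw j) (D2w i j)) {H : ℝ}
    (hH : ∀ i j, ∀ᵐ x, ‖D2w i j x‖ ≤ H) :
    |∑' p, mu p * inner ℝ (forc w Dw p b) (coef p b)| ≤
      18 * K * (∑' p, mu p * ‖coef p b‖ ^ 2) +
        9 * H * (√(∫ x, ‖b x‖ ^ 2) * √(∑' p, mu p * ‖coef p b‖ ^ 2)) := by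
  have hK := h.nonneg_bound_grad
  have hH0 : 0 ≤ H := by
    obtain ⟨x, hx⟩ := (hH 0 0).exists
    exact (norm_nonneg _).trans hx
  have hlim := (tendsto_of_hasSum (h.summable_mu_inner hb hs hs2).hasSum).abs
  have hs3 := summable_one_add_mu hb hs
  have hr := (tendsto_of_hasSum hs3.hasSum).const_sub (∑' p, (1 + mu p) * ‖coef p b‖ ^ 2)
  rw [sub_self] at hr
  have hr2 := (((Real.continuous_sqrt.tendsto _).comp
    (hr.const_mul (18 * (K ^ 2 + M ^ 2)))).mul_const
    √(∑' p, mu p ^ 2 * ‖coef p b‖ ^ 2)).const_add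
    (18 * K * (∑' p, mu p * ‖coef p b‖ ^ 2) +
        9 * H * (√(∫ x, ‖b x‖ ^ 2) * √(∑' p, mu p * ‖coef p b‖ ^ 2)))
  rw [mul_zero, Real.sqrt_zero, zero_mul, add_zero] at hr2
  refine le_of_tendsto_of_tendsto' hlim hr2 fun F => ?_
  set β : Idx → E3 := fun q => coef q b with hβ
  -- Replacing the forcing of b by that of its partial sum leaves a polynomial tested against its
  -- own Laplacian, where the integrations by parts apply. The replacement costs the H¹ tail times
  -- the norm of Δb, which tends to 0; this is where H² regularity of b is used.
  have e1 : ∑ p ∈ F, mu p * inner ℝ (forc w Dw p b) (coef p b) =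
      (∑ p ∈ F, inner ℝ (forc w Dw p b - forc w Dw p (synth F β)) (mu p • coef p b)) -
        ∫ x, inner ℝ (rhsSynth w Dw F β x) (lapSynth F β x) := by
    rw [lapSynth, integral_inner_synth (MemLp.integrable_two (h.memLp_rhsSynth F β)),
      ← Finset.sum_sub_distrib]
    refine Finset.sum_congr rfl fun p _ => ?_
    rw [h.forc_synth, inner_sub_left, neg_smul, inner_neg_right, real_inner_smul_right,
      real_inner_smul_right]
    ring
  have b1 : |∑ p ∈ F, inner ℝ (forc w Dw p b - forc w Dw p (synth F β)) (mu p • coef p b)| ≤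
      √(18 * (K ^ 2 + M ^ 2) * ((∑' p, (1 + mu p) * ‖coef p b‖ ^ 2) -
        ∑ p ∈ F, (1 + mu p) * ‖coef p b‖ ^ 2)) * √(∑' p, mu p ^ 2 * ‖coef p b‖ ^ 2) := by
    refine (Finset.abs_sum_le_sum_abs _ _).trans
      ((Finset.sum_le_sum fun p _ => abs_real_inner_le_norm _ _).trans
        ((Real.sum_mul_le_sqrt_mul_sqrt F _ _).trans ?_))
    gcongr
    · exact h.sum_normSq_forc_sub_le hb hs F F
    · simp only [norm_smul, mul_pow, Real.norm_eq_abs, sq_abs]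
      exact hs2.sum_le_tsum F fun p _ => mul_nonneg (sq_nonneg _) (sq_nonneg _)
  have b2 : |∫ x, inner ℝ (rhsSynth w Dw F β x) (lapSynth F β x)| ≤
      18 * K * (∑' p, mu p * ‖coef p b‖ ^ 2) +
        9 * H * (√(∫ x, ‖b x‖ ^ 2) * √(∑' p, mu p * ‖coef p b‖ ^ 2)) := by
    refine (h.abs_integral_rhs_lap_le h2 hH F β).trans ?_
    have i1 : ∑ p ∈ F, mu p * ‖β p‖ ^ 2 ≤ ∑' p, mu p * ‖coef p b‖ ^ 2 :=
      hs.sum_le_tsum F fun p _ => mul_nonneg (mu_nonneg p) (sq_nonneg _)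
    have i2 : ∑ p ∈ F, ‖β p‖ ^ 2 ≤ ∫ x, ‖b x‖ ^ 2 :=
      sum_le_hasSum F (fun p _ => by positivity) (hasSum_coef_sq hb)
    gcongr
  rw [e1]
  refine (abs_sub _ _).trans ?_
  simp only [Function.comp_apply]
  linarith

/-! ### A mean-zero field is bounded by its gradient -/

lemma integrable_of_continuous {f : T3 → ℝ} (hf : Continuous f) : Integrable f volume := by
  simpa using integrable_mul_continuous (integrable_const (1 : ℝ)) hf

/-- Translation of a function on the torus. -/
lemma SmoothOnTorus.translate {φ : T3 → ℝ} (h : SmoothOnTorus φ) (y : T3) :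
    SmoothOnTorus fun x => φ (x + y) := by
  obtain ⟨z, rfl⟩ := toTorus_surjective y
  exact h.contDiff_lift.comp (contDiff_id.add (contDiff_const (c := z)))

lemma partialD_translate (φ : T3 → ℝ) (y : T3) (i : Fin 3) (x : T3) :
    partialD i (fun x => φ (x + y)) x = partialD i φ (x + y) := by
  simp only [partialD, add_right_comm]

/-- The derivative in s of the translated pairing is ∫ ∂ᵢφ(x + s eᵢ) f = −∫ φ(x + s eᵢ) g, of size
at most H times the L¹ norm of φ; the mean value inequality finishes. -/
lemma HasWeakPartial.norm_translate_sub_le {f g : T3 → E3} {i : Fin 3}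
    (h : HasWeakPartial i f g) {H : ℝ} (hg : ∀ᵐ x, ‖g x‖ ≤ H) {φ : T3 → ℝ}
    (hφ : SmoothOnTorus φ) {s : ℝ} (hs : s ∈ Icc (0 : ℝ) 1) :
    ‖(∫ x, φ (x + Pi.single i (s : UnitAddCircle)) • f x) - ∫ x, φ x • f x‖ ≤
      H * ∫ x, |φ x| := by
  have hH : 0 ≤ H := by
    obtain ⟨x, hx⟩ := hg.exists
    exact (norm_nonneg _).trans hx
  set D : ℝ → E3 := fun s => ∫ x, φ (x + Pi.single i (s : UnitAddCircle)) • f x with hD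
  obtain ⟨C, hC⟩ := (isCompact_univ (X := T3)).exists_bound_of_continuousOn
    (hφ.partialD i).continuous.continuousOn
  have hpt : ∀ (x : T3) (s : ℝ), HasDerivAt
      (fun s : ℝ => φ (x + Pi.single i (s : UnitAddCircle)))
      (partialD i φ (x + Pi.single i (s : UnitAddCircle))) s := by
    intro x s
    have h0 := hφ.hasDerivAt i (x + Pi.single i (s : UnitAddCircle))
    have h1 : HasDerivAt (fun r : ℝ => r - s) 1 s := by
      simpa using (hasDerivAt_id s).sub_const s
    have h2 := HasDerivAt.scomp_of_eq (x := s) h0 h1 (by simp)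
    rw [one_smul] at h2
    refine h2.congr_of_eventuallyEq (Filter.Eventually.of_forall fun r => ?_)
    simp only [Function.comp_apply]
    rw [add_assoc, ← Pi.single_add, ← AddCircle.coe_add, add_sub_cancel]
  have hder : ∀ s : ℝ, HasDerivAt D
      (∫ x, partialD i φ (x + Pi.single i (s : UnitAddCircle)) • f x) s := by
    intro s
    refine (hasDerivAt_integral_of_dominated_loc_of_deriv_le (bound := fun x => C * ‖f x‖)
      (F := fun (s : ℝ) x => φ (x + Pi.single i (s : UnitAddCircle)) • f x)
      (F' := fun (s : ℝ) x => partialD i φ (x + Pi.single i (s : UnitAddCircle)) • f x)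
      (x₀ := s) Filter.univ_mem ?_ ?_ ?_ ?_ ?_ ?_).2
    · exact Filter.Eventually.of_forall fun r =>
        (integrable_smul_continuous h.integrable (hφ.translate _).continuous).1
    · exact integrable_smul_continuous h.integrable (hφ.translate _).continuous
    · exact (integrable_smul_continuous h.integrable ((hφ.partialD i).translate _).continuous).1
    · refine Filter.Eventually.of_forall fun x r _ => ?_
      rw [norm_smul]
      exact mul_le_mul_of_nonneg_right (hC _ (mem_univ _)) (norm_nonneg _)
    · exact h.integrable.norm.const_mul C
    · exact Filter.Eventually.of_forall fun x r _ => (hpt x r).smul_const (f x)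
  have hbound : ∀ s : ℝ, ‖∫ x, partialD i φ (x + Pi.single i (s : UnitAddCircle)) • f x‖ ≤
      H * ∫ x, |φ x| := by
    intro s
    have h1 := h.eq _ (hφ.translate (Pi.single i (s : UnitAddCircle)))
    simp only [partialD_translate] at h1
    rw [h1, norm_neg]
    refine (norm_integral_le_integral_norm _).trans ?_
    have h2 : ∫ x, |φ x| = ∫ x : T3, |φ (x + Pi.single i (s : UnitAddCircle))| :=
      (integral_add_right_eq_self (fun x => |φ x|) _).symm
    rw [h2, ← integral_const_mul]
    refine integral_mono_of_nonneg (Filter.Eventually.of_forall fun x => norm_nonneg _)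
      ?_ ?_
    · exact (integrable_of_continuous (hφ.translate _).continuous.abs).const_mul H
    · filter_upwards [hg] with x hx
      rw [norm_smul, mul_comm, Real.norm_eq_abs]
      exact mul_le_mul_of_nonneg_right hx (abs_nonneg _)
  have := (convex_Icc (0 : ℝ) 1).norm_image_sub_le_of_norm_hasDerivWithin_le
    (fun s _ => (hder s).hasDerivWithinAt) (fun s _ => hbound s) (left_mem_Icc.2 zero_le_one) hs
  have h0 : D 0 = ∫ x, φ x • f x := by simp [hD]
  rw [h0] at this
  refine this.trans (mul_le_of_le_one_right ?_ ?_)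
  · exact mul_nonneg hH (integral_nonneg fun x => abs_nonneg _)
  · rw [sub_zero, Real.norm_eq_abs, abs_of_nonneg hs.1]; exact hs.2

/-- Averaged over all translations y, ∫ φ(x + y) f(x) dx vanishes because f has mean zero. Hence ∫ φ
f is minus an average of translation differences, each bounded uniformly in y. -/
lemma HasWeakPartial.norm_integral_smul_le {f : T3 → E3} {g : Fin 3 → T3 → E3}
    (h : ∀ i, HasWeakPartial i f (g i)) (hf : ∫ x, f x = 0) {H : ℝ}
    (hg : ∀ i, ∀ᵐ x, ‖g i x‖ ≤ H) {φ : T3 → ℝ} (hφ : SmoothOnTorus φ) :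
    ‖∫ x, φ x • f x‖ ≤ 3 * H * ∫ x, |φ x| := by
  have hfi : Integrable f volume := (h 0).integrable
  have hpt : ∀ y : T3, ‖(∫ x, φ (x + y) • f x) - ∫ x, φ x • f x‖ ≤ 3 * H * ∫ x, |φ x| := by
    intro y
    have hl : ∀ i, ∃ s ∈ Icc (0 : ℝ) 1, (s : UnitAddCircle) = y i := fun i => by
      obtain ⟨s, hs, hs'⟩ := (AddCircle.coe_image_Icc_eq (1 : ℝ) 0).symm ▸ mem_univ (y i)
      exact ⟨s, by simpa using hs, hs'⟩
    choose s hs hs' using hl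
    -- Any translation is three coordinate moves of length at most 1, each costing H ∫ |φ|.
    have hy : y = Pi.single 0 (s 0 : UnitAddCircle) + Pi.single 1 (s 1 : UnitAddCircle) +
        Pi.single 2 (s 2 : UnitAddCircle) := by
      funext i
      fin_cases i <;> simp [hs']
    have n1 : ∀ z, ∫ x, |φ (x + z)| = ∫ x, |φ x| := fun z =>
      integral_add_right_eq_self (fun x => |φ x|) z
    have s1 := (h 0).norm_translate_sub_le (hg 0) hφ (hs 0)
    have s2 := (h 1).norm_translate_sub_le (hg 1)
      (hφ.translate (Pi.single 0 (s 0 : UnitAddCircle))) (hs 1)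
    have s3 := (h 2).norm_translate_sub_le (hg 2)
      (hφ.translate (Pi.single 0 (s 0 : UnitAddCircle) + Pi.single 1 (s 1 : UnitAddCircle))) (hs 2)
    rw [n1] at s2 s3
    have e2 : ∀ x : T3, x + Pi.single 1 (s 1 : UnitAddCircle) + Pi.single 0 (s 0 : UnitAddCircle) =
        x + (Pi.single 0 (s 0 : UnitAddCircle) + Pi.single 1 (s 1 : UnitAddCircle)) :=
      fun x => by abel
    have e3 : ∀ x : T3, x + Pi.single 2 (s 2 : UnitAddCircle) +
        (Pi.single 0 (s 0 : UnitAddCircle) + Pi.single 1 (s 1 : UnitAddCircle)) = x + y :=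
      fun x => by rw [hy]; abel
    simp only [e2] at s2
    simp only [e3] at s3
    refine (norm_sub_le_norm_sub_add_norm_sub _ _ _).trans ((add_le_add s3
      ((norm_sub_le_norm_sub_add_norm_sub _ _ _).trans (add_le_add s2 s1))).trans (le_of_eq ?_))
    ring
  have hprod : Integrable (fun z : T3 × T3 => φ (z.2 + z.1) • f z.2)
      ((volume : Measure T3).prod volume) := by
    obtain ⟨C, hC⟩ := (isCompact_univ (X := T3)).exists_bound_of_continuousOn
      hφ.continuous.continuousOn
    refine (hfi.comp_snd (μ := (volume : Measure T3))).bdd_smul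
      (φ := fun z : T3 × T3 => φ (z.2 + z.1)) C ?_
      (Filter.Eventually.of_forall fun x => hC _ (mem_univ _))
    exact (hφ.continuous.comp (continuous_snd.add continuous_fst)).aestronglyMeasurable
  have hzero : ∫ y : T3, ∫ x : T3, φ (x + y) • f x = 0 := by
    rw [integral_integral_swap hprod]
    have : ∀ x : T3, ∫ y : T3, φ (x + y) • f x = (∫ y, φ y) • f x := fun x => by
      rw [integral_smul_const, integral_add_left_eq_self (fun y => φ y)]
    simp only [this]
    rw [integral_smul, hf, smul_zero]
  have hi : Integrable (fun y : T3 => ∫ x : T3, φ (x + y) • f x) volume :=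
    hprod.integral_prod_left
  have e : ∫ x, φ x • f x =
      -∫ y : T3, ((∫ x : T3, φ (x + y) • f x) - ∫ x, φ x • f x) := by
    rw [integral_sub hi (integrable_const _), hzero]
    simp
  rw [e, norm_neg]
  refine (norm_integral_le_of_norm_le_const (Filter.Eventually.of_forall hpt)).trans ?_
  simp

lemma integral_norm_le_sqrt {f : T3 → E3} (hf : MemLp f 2 volume) :
    ∫ x, ‖f x‖ ≤ √(∫ x, ‖f x‖ ^ 2) := by
  obtain ⟨e, he⟩ := exists_norm_eq E3 zero_le_one
  have := integral_norm_mul_norm_le hf (memLp_of_continuous (continuous_const (y := e)) 2)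
  simpa [he] using this

/-- A mean-zero vector field is bounded by the supremum of its weak gradient. -/
lemma HasWeakPartial.ae_norm_le {f : T3 → E3} (hfm : Measurable f) (hf2 : MemLp f 2 volume)
    {g : Fin 3 → T3 → E3} (h : ∀ i, HasWeakPartial i f (g i)) (hf : ∫ x, f x = 0) {H : ℝ}
    (hg : ∀ i, ∀ᵐ x, ‖g i x‖ ≤ H) : ∀ᵐ x, ‖f x‖ ≤ 9 * H := by
  have hH : 0 ≤ H := by
    obtain ⟨x, hx⟩ := (hg 0).exists
    exact (norm_nonneg _).trans hx
  -- The estimate against L¹ norms is summed over the three components, so 3H becomes 9H. It is then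
  -- extended from polynomials to L² fields by density.
  have hsynth : ∀ F d, |∫ x, inner ℝ (f x) (synth F d x)| ≤ 9 * H * ∫ x, ‖synth F d x‖ := by
    intro F d
    have hc : Continuous (synth F d) := continuous_synth F d
    have hl : ∀ l, |∫ x, f x l * synth F d x l| ≤ 3 * H * ∫ x, ‖synth F d x‖ := by
      intro l
      have h1 := HasWeakPartial.norm_integral_smul_le h hf hg (smoothOnTorus_synth F d l)
      have h2 := (abs_apply_le _ l).trans h1
      rw [integral_E3_apply (integrable_smul_continuous (h 0).integrable
        (smoothOnTorus_synth F d l).continuous)] at h2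
      simp only [PiLp.smul_apply, smul_eq_mul] at h2
      simp only [mul_comm (f _ l)]
      refine h2.trans ?_
      refine mul_le_mul_of_nonneg_left (integral_mono
        (integrable_of_continuous (smoothOnTorus_synth F d l).continuous.abs)
        (integrable_of_continuous hc.norm) fun x => abs_apply_le _ _) (by positivity)
    rw [integral_inner_eq_sum hf2 (memLp_synth F d)]
    refine (Finset.abs_sum_le_sum_abs _ _).trans
      ((Finset.sum_le_sum fun l _ => hl l).trans (le_of_eq ?_))
    simp; ring
  have hall : ∀ ψ : T3 → E3, MemLp ψ 2 volume →
      |∫ x, inner ℝ (f x) (ψ x)| ≤ 9 * H * ∫ x, ‖ψ x‖ := by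
    intro ψ hψ
    have h1 := ((Real.continuous_sqrt.tendsto 0).comp (tendsto_normSq_sub_synth hψ))
    rw [Real.sqrt_zero] at h1
    have h2 := ((h1.const_mul (√(∫ x, ‖f x‖ ^ 2))).add (h1.const_mul (9 * H))).add_const
      (9 * H * ∫ x, ‖ψ x‖)
    rw [mul_zero, mul_zero, add_zero, zero_add] at h2
    refine ge_of_tendsto' h2 fun F => ?_
    simp only [Function.comp_apply]
    set v := synth F fun q => coef q ψ with hv
    have hvm : MemLp v 2 volume := memLp_synth _ _
    have hr : MemLp (ψ - v) 2 volume := hψ.sub hvm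
    have hrs : √(∫ x, ‖(ψ - v) x‖ ^ 2) ≤ √((∫ x, ‖ψ x‖ ^ 2) - ∑ p ∈ F, ‖coef p ψ‖ ^ 2) :=
      Real.sqrt_le_sqrt (integral_normSq_sub_synth_le hψ F)
    have e : ∫ x, inner ℝ (f x) (ψ x) =
        (∫ x, inner ℝ (f x) ((ψ - v) x)) + ∫ x, inner ℝ (f x) (v x) := by
      rw [← integral_add (integrable_inner_of_memLp hf2 hr) (integrable_inner_of_memLp hf2 hvm)]
      refine integral_congr_ae (Filter.Eventually.of_forall fun x => ?_)
      simp only [← inner_add_right, Pi.sub_apply, sub_add_cancel]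
    have e2 : ∫ x, ‖v x‖ ≤ (∫ x, ‖ψ x‖) + ∫ x, ‖(ψ - v) x‖ := by
      have i1 := (MemLp.integrable_two hψ).norm
      have i2 := (MemLp.integrable_two hr).norm
      rw [← integral_add i1 i2]
      refine integral_mono (MemLp.integrable_two hvm).norm (i1.add i2) fun x => ?_
      have := norm_sub_le (ψ x) ((ψ - v) x)
      simpa using this
    have b1 := (abs_integral_inner_le hf2 hr).trans
      (mul_le_mul_of_nonneg_left hrs (Real.sqrt_nonneg _))
    have b2 := hsynth F fun q => coef q ψ
    have b3 := mul_le_mul_of_nonneg_left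
      (e2.trans (add_le_add le_rfl ((integral_norm_le_sqrt hr).trans hrs)))
      (show 0 ≤ 9 * H by positivity)
    rw [e]
    refine (abs_add_le _ _).trans ?_
    rw [← hv] at b2
    linarith
  -- Testing with f restricted to the set where |f| > 9H contradicts the L¹ bound unless that set is
  -- null.
  set S : Set T3 := {x | 9 * H < ‖f x‖} with hS
  have hSm : MeasurableSet S := measurableSet_lt measurable_const hfm.norm
  have h1 := (le_abs_self _).trans (hall (S.indicator f) (hf2.indicator hSm))
  have i1 : Integrable (fun x => inner ℝ (f x) (S.indicator f x)) volume :=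
    integrable_inner_of_memLp hf2 (hf2.indicator hSm)
  have i2 : Integrable (fun x => 9 * H * ‖S.indicator f x‖) volume :=
    (MemLp.integrable_two (hf2.indicator hSm)).norm.const_mul _
  have hnn : ∀ x, 0 ≤ inner ℝ (f x) (S.indicator f x) - 9 * H * ‖S.indicator f x‖ := by
    intro x
    by_cases hx : x ∈ S
    · rw [indicator_of_mem hx, real_inner_self_eq_norm_sq]
      have : 9 * H < ‖f x‖ := hx
      nlinarith [norm_nonneg (f x)]
    · simp [indicator_of_notMem hx]
  have hz : ∫ x, (inner ℝ (f x) (S.indicator f x) - 9 * H * ‖S.indicator f x‖) = 0 := by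
    refine le_antisymm ?_ (integral_nonneg hnn)
    rw [integral_sub i1 i2, integral_const_mul]
    linarith
  filter_upwards [(integral_eq_zero_iff_of_nonneg hnn (i1.sub i2)).1 hz] with x hx
  by_contra! hlt
  have hxS : x ∈ S := hlt
  simp only [indicator_of_mem hxS, real_inner_self_eq_norm_sq, Pi.zero_apply] at hx
  nlinarith [norm_nonneg (f x)]

end

/-! ### Absolutely continuous functions and Grönwall's inequality -/

lemma absolutelyContinuous_comp {f g : ℝ → ℝ} {a b : ℝ}
    (hf : AbsolutelyContinuousOnInterval f a b) (hg : ContDiff ℝ 1 g) :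
    AbsolutelyContinuousOnInterval (fun t => g (f t)) a b := by
  obtain ⟨C, hC⟩ := hf.exists_bound
  obtain ⟨L, hL⟩ := (hg.contDiffOn (s := Icc (-C) C)).exists_lipschitzOnWith (by simp)
    (convex_Icc _ _) isCompact_Icc
  have hmem : ∀ x ∈ uIcc a b, f x ∈ Icc (-C) C := fun x hx => abs_le.1 (hC x hx)
  have h0 := Filter.Tendsto.const_mul (L : ℝ) hf
  rw [mul_zero] at h0
  refine squeeze_zero' (Filter.Eventually.of_forall fun E =>
    Finset.sum_nonneg fun i _ => dist_nonneg) ?_ h0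
  have hev : ∀ᶠ E in AbsolutelyContinuousOnInterval.totalLengthFilter ⊓
      Filter.principal (AbsolutelyContinuousOnInterval.disjWithin a b),
      E ∈ AbsolutelyContinuousOnInterval.disjWithin a b :=
    Filter.mem_inf_of_right (Filter.mem_principal_self _)
  filter_upwards [hev] with E hE
  rw [Finset.mul_sum]
  refine Finset.sum_le_sum fun i hi => ?_
  exact hL.dist_le_mul _ (hmem _ (hE.1 i hi).1) _ (hmem _ (hE.1 i hi).2)

lemma intervalIntegrable_sub {T t : ℝ} {E : Type*} [NormedAddCommGroup E] {x : ℝ → E}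
    (hx : IntervalIntegrable x volume 0 T) (ht : t ∈ Icc 0 T) :
    IntervalIntegrable x volume 0 t :=
  hx.mono_set (by
    rw [uIcc_of_le ht.1, uIcc_of_le (ht.1.trans ht.2)]; exact Icc_subset_Icc_right ht.2)

lemma ae_hasDerivAt_primitive {T : ℝ} {x : ℝ → ℝ} (c : ℝ) (hT : 0 ≤ T)
    (hx : IntervalIntegrable x volume 0 T) :
    ∀ᵐ s, s ∈ Icc 0 T → HasDerivAt (fun t => c + ∫ r in (0 : ℝ)..t, x r) (x s) s := by
  filter_upwards [hx.ae_hasDerivAt_integral] with s hs hs'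
  rw [uIcc_of_le hT] at hs
  exact (hs hs' 0 (left_mem_Icc.2 hT)).const_add c

lemma absolutelyContinuous_primitive {T : ℝ} {x : ℝ → ℝ} (c : ℝ)
    (hx : IntervalIntegrable x volume 0 T) :
    AbsolutelyContinuousOnInterval (fun t => c + ∫ r in (0 : ℝ)..t, x r) 0 T :=
  (contDiffOn_const.absolutelyContinuousOnInterval).fun_add
    (hx.absolutelyContinuousOnInterval_intervalIntegral left_mem_uIcc)

/-- The integrating factor exp(−A) makes the derivative of the product nonpositive almost
everywhere. The product is absolutely continuous, so this suffices for its monotone comparison, and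
the rate may be merely integrable. -/
lemma le_mul_exp_of_absolutelyContinuous {t : ℝ} (ht : 0 ≤ t) {Y A x a : ℝ → ℝ}
    (hY : AbsolutelyContinuousOnInterval Y 0 t) (hA : AbsolutelyContinuousOnInterval A 0 t)
    (hYx : ∀ᵐ s, s ∈ Icc 0 t → HasDerivAt Y (x s) s)
    (hAa : ∀ᵐ s, s ∈ Icc 0 t → HasDerivAt A (a s) s) (hA0 : A 0 = 0)
    (hle : ∀ᵐ s, s ∈ Icc 0 t → x s ≤ a s * Y s) : Y t ≤ Y 0 * Real.exp (A t) := by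
  have hZ : AbsolutelyContinuousOnInterval (fun t => Real.exp (-A t)) 0 t :=
    absolutelyContinuous_comp (g := fun y => Real.exp (-y)) hA
      (Real.contDiff_exp.comp contDiff_neg)
  have hW := hY.fun_mul hZ
  have hint := hW.integral_deriv_eq_sub
  have h1 : ∀ᵐ s, s ∈ Icc 0 t → deriv (fun s => Y s * Real.exp (-A s)) s ≤ 0 := by
    filter_upwards [hYx, hAa, hle] with s h1 h2 h3 hs
    have h4 : HasDerivAt (fun s => Y s * Real.exp (-A s))
        (x s * Real.exp (-A s) + Y s * (Real.exp (-A s) * -a s)) s :=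
      (h1 hs).fun_mul (h2 hs).fun_neg.exp
    rw [h4.deriv]
    have h5 := h3 hs
    have h6 := Real.exp_pos (-A s)
    nlinarith
  have h2 := intervalIntegral.integral_mono_ae_restrict ht hW.intervalIntegrable_deriv
    (intervalIntegrable_const (c := (0 : ℝ))) ((ae_restrict_iff' measurableSet_Icc).2 h1)
  rw [hint, intervalIntegral.integral_zero, hA0, neg_zero, Real.exp_zero, mul_one] at h2
  have h3 : Y t * Real.exp (-A t) ≤ Y 0 := by linarith
  have := mul_le_mul_of_nonneg_right h3 (Real.exp_pos (A t)).le
  rwa [mul_assoc, ← Real.exp_add, neg_add_cancel, Real.exp_zero, mul_one] at this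

/-- Grönwall's inequality for absolutely continuous functions. -/
lemma gronwall_le {T : ℝ} {X x a : ℝ → ℝ} (hx : IntervalIntegrable x volume 0 T)
    (ha : IntervalIntegrable a volume 0 T)
    (hX : ∀ t ∈ Icc 0 T, X t = X 0 + ∫ s in (0 : ℝ)..t, x s)
    (hle : ∀ᵐ s, s ∈ Icc 0 T → x s ≤ a s * X s) :
    ∀ t ∈ Icc 0 T, X t ≤ X 0 * Real.exp (∫ s in (0 : ℝ)..t, a s) := by
  intro t ht
  have hx' := intervalIntegrable_sub hx ht
  have ha' := intervalIntegrable_sub ha ht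
  have h := le_mul_exp_of_absolutelyContinuous ht.1 (absolutelyContinuous_primitive (X 0) hx')
    (absolutelyContinuous_primitive 0 ha') (ae_hasDerivAt_primitive (X 0) ht.1 hx')
    (ae_hasDerivAt_primitive 0 ht.1 ha') (by simp) (by
      filter_upwards [hle] with s hs hs'
      have hs2 : s ∈ Icc 0 T := ⟨hs'.1, hs'.2.trans ht.2⟩
      rw [← hX s hs2]
      exact hs hs2)
  rw [← hX t ht] at h
  simpa using h

lemma gronwall_ge {T : ℝ} {X x a : ℝ → ℝ} (hx : IntervalIntegrable x volume 0 T)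
    (ha : IntervalIntegrable a volume 0 T)
    (hX : ∀ t ∈ Icc 0 T, X t = X 0 + ∫ s in (0 : ℝ)..t, x s)
    (hle : ∀ᵐ s, s ∈ Icc 0 T → a s * X s ≤ x s) :
    ∀ t ∈ Icc 0 T, X 0 * Real.exp (∫ s in (0 : ℝ)..t, a s) ≤ X t := by
  intro t ht
  have := gronwall_le (X := fun t => -X t) (x := fun s => -x s) hx.neg ha
    (fun t ht => by rw [intervalIntegral.integral_neg, hX t ht]; ring)
    (by filter_upwards [hle] with s hs hs'; have := hs hs'; linarith) t ht
  linarith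

lemma sq_eq_of_primitive {T : ℝ} {X x : ℝ → ℝ} (hx : IntervalIntegrable x volume 0 T)
    (hX : ∀ t ∈ Icc 0 T, X t = X 0 + ∫ s in (0 : ℝ)..t, x s) :
    ∀ t ∈ Icc 0 T, X t ^ 2 = X 0 ^ 2 + ∫ s in (0 : ℝ)..t, 2 * (x s * X s) := by
  intro t ht
  have hx' := intervalIntegrable_sub hx ht
  have h1 := (absolutelyContinuous_primitive (X 0) hx')
  have h2 := h1.integral_deriv_mul_eq_sub h1
  simp only [intervalIntegral.integral_same, add_zero] at h2
  rw [← hX t ht] at h2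
  rw [sq, sq, ← sub_eq_iff_eq_add', ← h2]
  refine intervalIntegral.integral_congr_ae ?_
  filter_upwards [ae_hasDerivAt_primitive (X 0) ht.1 hx'] with s hs hs'
  rw [uIoc_of_le ht.1] at hs'
  have hs2 : s ∈ Icc 0 t := Ioc_subset_Icc_self hs'
  rw [(hs hs2).deriv, ← hX s ⟨hs2.1, hs2.2.trans ht.2⟩]
  ring

lemma continuousOn_of_primitive {T : ℝ} (hT : 0 ≤ T) {E : Type*} [NormedAddCommGroup E]
    [NormedSpace ℝ E] {X x : ℝ → E} (hx : IntervalIntegrable x volume 0 T)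
    (hX : ∀ t ∈ Icc 0 T, X t = X 0 + ∫ s in (0 : ℝ)..t, x s) : ContinuousOn X (Icc 0 T) := by
  have := (intervalIntegral.continuousOn_primitive_interval' hx left_mem_uIcc).const_add (X 0)
  rw [uIcc_of_le hT] at this
  exact this.congr hX

lemma intervalIntegral_E3_apply {x : ℝ → E3} {a b : ℝ} (hx : IntervalIntegrable x volume a b)
    (l : Fin 3) : (∫ s in a..b, x s) l = ∫ s in a..b, x s l :=
  ((EuclideanSpace.proj l : E3 →L[ℝ] ℝ).intervalIntegral_comp_comm hx).symm

lemma intervalIntegrable_apply {x : ℝ → E3} {a b : ℝ} (hx : IntervalIntegrable x volume a b)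
    (l : Fin 3) : IntervalIntegrable (fun s => x s l) volume a b :=
  ⟨(EuclideanSpace.proj l : E3 →L[ℝ] ℝ).integrable_comp hx.1,
    (EuclideanSpace.proj l : E3 →L[ℝ] ℝ).integrable_comp hx.2⟩

lemma normSq_eq_of_primitive {T : ℝ} {X x : ℝ → E3} (hx : IntervalIntegrable x volume 0 T)
    (hX : ∀ t ∈ Icc 0 T, X t = X 0 + ∫ s in (0 : ℝ)..t, x s) :
    ∀ t ∈ Icc 0 T, ‖X t‖ ^ 2 = ‖X 0‖ ^ 2 + ∫ s in (0 : ℝ)..t, 2 * inner ℝ (x s) (X s) := by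
  intro t ht
  have hT : 0 ≤ T := ht.1.trans ht.2
  have hc := continuousOn_of_primitive hT hx hX
  have h1 : ∀ l, X t l ^ 2 = X 0 l ^ 2 + ∫ s in (0 : ℝ)..t, 2 * (x s l * X s l) := fun l =>
    sq_eq_of_primitive (X := fun t => X t l) (intervalIntegrable_apply hx l)
      (fun t ht => by
        have := congrArg (fun v : E3 => v l) (hX t ht)
        simp only [PiLp.add_apply] at this
        rw [intervalIntegral_E3_apply (intervalIntegrable_sub hx ht)] at this
        exact this) t ht
  have hi : ∀ l, IntervalIntegrable (fun s => 2 * (x s l * X s l)) volume 0 t := fun l =>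
    ((intervalIntegrable_sub (intervalIntegrable_apply hx l) ht).mul_continuousOn (by
      rw [uIcc_of_le ht.1]
      exact ((EuclideanSpace.proj l : E3 →L[ℝ] ℝ).continuous.comp_continuousOn
        (hc.mono (Icc_subset_Icc_right ht.2))))).const_mul 2
  rw [EuclideanSpace.real_norm_sq_eq, EuclideanSpace.real_norm_sq_eq,
    Finset.sum_congr rfl fun l _ => h1 l, Finset.sum_add_distrib,
    ← intervalIntegral.integral_finsetSum fun l _ => hi l]
  congr 1
  refine intervalIntegral.integral_congr fun s _ => ?_
  simp only [inner_E3, Finset.mul_sum]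

/-! ### Evolution of the coefficients of a solution -/

section

variable {κ T : ℝ} {u : ℝ → T3 → E3} {Du : ℝ → Fin 3 → T3 → E3}
  {b : ℝ → Lp E3 2 (volume : Measure T3)}

lemma IsVelocity.exists_slice (hu : IsVelocity T u Du) :
    ∃ M : ℝ, 0 ≤ M ∧ ∀ᵐ s ∂(volume.restrict (Icc 0 T)), IsSlice M M (u s) (Du s) := by
  obtain ⟨M, hM⟩ := hu.bounded
  refine ⟨max M 0, le_max_right _ _, ?_⟩
  filter_upwards [hM, hu.weak_grad, hu.div_free] with s h1 h2 h3
  refine ⟨?_, fun j => ?_, h2, h3⟩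
  · filter_upwards [h1] with x hx using hx.1.trans (le_max_left _ _)
  · filter_upwards [h1] with x hx using (hx.2 j).trans (le_max_left _ _)

lemma normSq_Lp (f : Lp E3 2 (volume : Measure T3)) : ‖f‖ ^ 2 = ∫ x, ‖f x‖ ^ 2 := by
  rw [← real_inner_self_eq_norm_sq, L2.inner_def]
  simp

lemma coef_Lp_sub (f g : Lp E3 2 (volume : Measure T3)) (p : Idx) :
    coef p (f - g : Lp E3 2 (volume : Measure T3)) = coef p f - coef p g := by
  rw [← coef_sub (MemLp.integrable_two (Lp.memLp f)) (MemLp.integrable_two (Lp.memLp g))]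
  refine integral_congr_ae ?_
  filter_upwards [Lp.coeFn_sub f g] with x hx
  rw [hx]

lemma norm_coef_Lp_le (f : Lp E3 2 (volume : Measure T3)) (p : Idx) : ‖coef p f‖ ≤ ‖f‖ := by
  have := norm_coef_le (Lp.memLp f) p
  rwa [← normSq_Lp, Real.sqrt_sq (norm_nonneg _)] at this

lemma continuous_coef_Lp (p : Idx) :
    Continuous fun f : Lp E3 2 (volume : Measure T3) => coef p f := by
  refine (LipschitzWith.of_dist_le_mul (K := 1) fun f g => ?_).continuous
  rw [dist_eq_norm, dist_eq_norm, ← coef_Lp_sub, NNReal.coe_one, one_mul]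
  exact norm_coef_Lp_le _ _

lemma IsSolution.continuousOn_coef (hb : IsSolution κ T u Du b) (p : Idx) :
    ContinuousOn (fun s => coef p (b s)) (Icc 0 T) :=
  (continuous_coef_Lp p).comp_continuousOn hb.continuousOn

lemma IsSolution.aestronglyMeasurable_coef (hb : IsSolution κ T u Du b) (p : Idx) :
    AEStronglyMeasurable (fun s => coef p (b s)) (volume.restrict (Icc 0 T)) :=
  (hb.continuousOn_coef p).aestronglyMeasurable measurableSet_Icc

/-- Since b is a curve of almost-everywhere classes, (s, x) ↦ b s x need not be jointly measurable.
Parseval expresses the spatial integral as a limit of finite sums of coefficients, each measurable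
in s. -/
lemma aestronglyMeasurable_integral_inner {μ : Measure ℝ} {V : ℝ → T3 → E3}
    (hV : Measurable fun q : ℝ × T3 => V q.1 q.2) (hVm : ∀ᵐ s ∂μ, MemLp (V s) 2 volume)
    (hb : ∀ p, AEStronglyMeasurable (fun s => coef p (b s)) μ) :
    AEStronglyMeasurable (fun s => ∫ x, inner ℝ (V s x) (b s x)) μ := by
  refine aestronglyMeasurable_of_tendsto_ae (Filter.atTop : Filter (Finset Idx))
    (f := fun F s => ∑ p ∈ F, inner ℝ (coef p (V s)) (coef p (b s))) (fun F => ?_) ?_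
  · refine Finset.aestronglyMeasurable_fun_sum _ fun p _ => ?_
    refine AEStronglyMeasurable.inner ?_ (hb p)
    have : StronglyMeasurable fun q : ℝ × T3 => trig p q.2 • V q.1 q.2 :=
      ((continuous_trig p).measurable.comp measurable_snd).stronglyMeasurable.smul
        hV.stronglyMeasurable
    exact (this.integral_prod_right (ν := (volume : Measure T3))).aestronglyMeasurable
  · filter_upwards [hVm] with s hs
    exact tendsto_of_hasSum (hasSum_inner_coef hs (Lp.memLp (b s)))

lemma E3_eq_sum (v : E3) : v = ∑ l, v l • (EuclideanSpace.single l (1 : ℝ) : E3) := by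
  ext i
  simp [Pi.single_apply]

lemma aestronglyMeasurable_of_apply {μ : Measure ℝ} {f : ℝ → E3}
    (h : ∀ l, AEStronglyMeasurable (fun s => f s l) μ) : AEStronglyMeasurable f μ := by
  have e : f = fun s => ∑ l, f s l • (EuclideanSpace.single l (1 : ℝ) : E3) :=
    funext fun s => E3_eq_sum (f s)
  rw [e]
  exact Finset.aestronglyMeasurable_fun_sum _ fun l _ => (h l).smul_const _

lemma smoothOnTorus_partialD_trig (p : Idx) (j : Fin 3) : Continuous (partialD j (trig p)) :=
  ((smoothOnTorus_trig p).partialD j).continuous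

lemma IsSolution.aestronglyMeasurable_forc (hb : IsSolution κ T u Du b) (hu : IsVelocity T u Du)
    (p : Idx) :
    AEStronglyMeasurable (fun s => forc (u s) (Du s) p (b s)) (volume.restrict (Icc 0 T)) := by
  obtain ⟨M, hM0, hM⟩ := hu.exists_slice
  refine aestronglyMeasurable_of_apply fun l => ?_
  -- The l-th component of the forcing coefficient is the L² pairing of b with this jointly
  -- measurable field, obtained by transposing the stretching matrix.
  set V : ℝ → T3 → E3 := fun s x =>
    (∑ j, u s x j * partialD j (trig p) x) • (EuclideanSpace.single l (1 : ℝ) : E3) +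
      ∑ j, (trig p x * Du s j x l) • (EuclideanSpace.single j (1 : ℝ) : E3) with hV
  have hap : ∀ {f : ℝ × T3 → E3}, Measurable f → ∀ l, Measurable fun q => f q l :=
    fun hf l => (EuclideanSpace.proj l : E3 →L[ℝ] ℝ).measurable.comp hf
  have hVmeas : Measurable fun q : ℝ × T3 => V q.1 q.2 := by
    refine ((Finset.measurable_fun_sum _ fun j _ => ?_).smul_const _).add
      (Finset.measurable_fun_sum _ fun j _ => Measurable.smul_const ?_ _)
    · exact (hap hu.measurable j).mul
        ((smoothOnTorus_partialD_trig p j).measurable.comp measurable_snd)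
    · exact ((continuous_trig p).measurable.comp measurable_snd).mul (hap (hu.measurable_grad j) l)
  have hVL : ∀ᵐ s ∂(volume.restrict (Icc 0 T)), MemLp (V s) 2 volume := by
    filter_upwards [hM] with s hs
    have m1 : ∀ {c : T3 → ℝ} {f : T3 → ℝ} {C : ℝ} (e : E3), Continuous c →
        AEStronglyMeasurable f volume → (∀ᵐ x, |f x| ≤ C) →
        MemLp (fun x => (f x * c x) • e) 2 volume := by
      intro c f C e hc hf hC
      simp only [mul_smul]
      exact memLp_bdd_smul hf hC (memLp_of_continuous (hc.smul continuous_const) 2)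
    refine MemLp.add ?_ ?_
    · simp only [Finset.sum_smul]
      refine memLp_finsetSum _ fun j _ => ?_
      exact m1 _ (smoothOnTorus_partialD_trig p j) (integrable_apply hs.integrable j).1
        (hs.abs_apply j)
    · refine memLp_finsetSum _ fun j _ => ?_
      simp only [mul_comm (trig p _)]
      refine m1 (C := M) _ (continuous_trig p) (integrable_apply (hs.integrable_grad j) l).1 ?_
      filter_upwards [hs.bound_grad j] with x hx using (abs_apply_le _ _).trans hx
  refine (aestronglyMeasurable_integral_inner hVmeas hVL
    fun q => hb.aestronglyMeasurable_coef q).congr ?_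
  filter_upwards [hM] with s hs
  have i1 := (hs.integrable_transport (smoothOnTorus_trig p) (Lp.memLp (b s))).add
    (hs.integrable_smul_stretch (continuous_trig p) (Lp.memLp (b s)))
  rw [forc]
  refine Eq.trans ?_ (integral_E3_apply i1 l).symm
  refine integral_congr_ae (Filter.Eventually.of_forall fun x => ?_)
  simp only [hV, Pi.add_apply, inner_add_left, sum_inner, real_inner_smul_left,
    EuclideanSpace.inner_single_left, PiLp.add_apply, PiLp.smul_apply, gradOp_apply, smul_eq_mul,
    map_one, one_mul, WithLp.ofLp_sum, Finset.sum_apply, Finset.mul_sum, WithLp.ofLp_smul,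
    Pi.smul_apply]
  congr 1
  exact Finset.sum_congr rfl fun j _ => by ring

lemma IsSolution.exists_bound (hb : IsSolution κ T u Du b) :
    ∃ B, 0 ≤ B ∧ ∀ s ∈ Icc 0 T, ‖b s‖ ≤ B := by
  obtain ⟨B, hB⟩ := isCompact_Icc.exists_bound_of_continuousOn hb.continuousOn
  exact ⟨max B 0, le_max_right _ _, fun s hs => (hB s hs).trans (le_max_left _ _)⟩

lemma ae_restrict_Icc {P : ℝ → Prop} (h : ∀ᵐ s ∂(volume.restrict (Icc 0 T)), P s) :
    ∀ᵐ s, s ∈ Icc 0 T → P s := (ae_restrict_iff' measurableSet_Icc).1 h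

lemma intervalIntegrable_of_bound (hT : 0 ≤ T) {E : Type*} [NormedAddCommGroup E] {f : ℝ → E}
    (hf : AEStronglyMeasurable f (volume.restrict (Icc 0 T))) {C : ℝ}
    (hC : ∀ᵐ s ∂(volume.restrict (Icc 0 T)), ‖f s‖ ≤ C) : IntervalIntegrable f volume 0 T := by
  rw [intervalIntegrable_iff_integrableOn_Icc_of_le hT]
  exact Integrable.of_bound hf C hC

lemma IsSolution.intervalIntegrable_forc (hT : 0 ≤ T) (hb : IsSolution κ T u Du b)
    (hu : IsVelocity T u Du) (p : Idx) :
    IntervalIntegrable (fun s => forc (u s) (Du s) p (b s)) volume 0 T := by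
  obtain ⟨M, hM0, hM⟩ := hu.exists_slice
  obtain ⟨B, hB0, hB⟩ := hb.exists_bound
  refine intervalIntegrable_of_bound hT (hb.aestronglyMeasurable_forc hu p)
    (C := (3 * √(mu p) * M + 3 * M) * B) ?_
  filter_upwards [hM, ae_restrict_mem measurableSet_Icc] with s hs hsT
  refine (hs.norm_forc_le (Lp.memLp (b s)) p).trans ?_
  rw [← normSq_Lp, Real.sqrt_sq (norm_nonneg _)]
  exact mul_le_mul_of_nonneg_left (hB s hsT) (by positivity)

lemma laplacian_trig (p : Idx) (x : T3) : laplacian (trig p) x = -mu p * trig p x := by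
  have e : ∀ i, partialD i (trig p) = fun x => freq p i * trig (flip p) x := fun i =>
    funext fun x => partialD_trig p i x
  rw [laplacian, mu, ← Finset.sum_neg_distrib, Finset.sum_mul]
  refine Finset.sum_congr rfl fun i _ => ?_
  rw [e, partialD_mul (SmoothOnTorus.const _) (smoothOnTorus_trig _), partialD_const, partialD_trig,
    freq_flip, flip_flip]
  ring

lemma intervalIntegrable_of_continuousOn (hT : 0 ≤ T) {E : Type*} [NormedAddCommGroup E]
    {f : ℝ → E} (hf : ContinuousOn f (Icc 0 T)) : IntervalIntegrable f volume 0 T := by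
  rw [← uIcc_of_le hT] at hf
  exact hf.intervalIntegrable

/-- The right-hand side of the evolution equation of a coefficient. -/
noncomputable def coefRate (κ : ℝ) (u : ℝ → T3 → E3) (Du : ℝ → Fin 3 → T3 → E3)
    (b : ℝ → Lp E3 2 (volume : Measure T3)) (p : Idx) (s : ℝ) : E3 :=
  forc (u s) (Du s) p (b s) - (κ * mu p) • coef p (b s)

lemma IsSolution.intervalIntegrable_coefRate (hT : 0 ≤ T) (hb : IsSolution κ T u Du b)
    (hu : IsVelocity T u Du) (p : Idx) :
    IntervalIntegrable (coefRate κ u Du b p) volume 0 T :=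
  (hb.intervalIntegrable_forc hT hu p).sub
    ((intervalIntegrable_of_continuousOn hT (hb.continuousOn_coef p)).smul (κ * mu p))

lemma IsSolution.coef_eq (hb : IsSolution κ T u Du b) (hu : IsVelocity T u Du) (p : Idx) :
    ∀ t ∈ Icc 0 T, coef p (b t) = coef p (b 0) + ∫ s in (0 : ℝ)..t, coefRate κ u Du b p s := by
  intro t ht
  obtain ⟨M, hM0, hM⟩ := hu.exists_slice
  have h1 := hb.weak_eq (trig p) (smoothOnTorus_trig p) t ht
  rw [← sub_eq_iff_eq_add']
  refine h1.trans (intervalIntegral.integral_congr_ae ?_)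
  filter_upwards [ae_restrict_Icc hM] with s hs hs'
  rw [uIoc_of_le ht.1] at hs'
  have hs := hs ⟨hs'.1.le, hs'.2.trans ht.2⟩
  have hm := Lp.memLp (b s)
  have i1 := hs.integrable_transport (smoothOnTorus_trig p) hm
  have i2 := hs.integrable_smul_stretch (continuous_trig p) hm
  have i4 : Integrable (fun x => (∑ j, u s x j * partialD j (trig p) x) • b s x +
      trig p x • gradOp (fun j => Du s j x) (b s x)) volume := i1.add i2
  have i5 : Integrable (fun x => (κ * mu p) • trig p x • b s x) volume :=
    (integrable_trig_smul (MemLp.integrable_two hm) p).smul (κ * mu p)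
  rw [coefRate, forc, coef, ← integral_smul, ← integral_sub i4 i5]
  refine integral_congr_ae (Filter.Eventually.of_forall fun x => ?_)
  simp only [laplacian_trig]
  module

lemma IsSolution.normSq_coef_eq (hT : 0 ≤ T) (hb : IsSolution κ T u Du b)
    (hu : IsVelocity T u Du) (p : Idx) :
    ∀ t ∈ Icc 0 T, ‖coef p (b t)‖ ^ 2 = ‖coef p (b 0)‖ ^ 2 + ∫ s in (0 : ℝ)..t,
      (2 * inner ℝ (forc (u s) (Du s) p (b s)) (coef p (b s)) -
        2 * κ * (mu p * ‖coef p (b s)‖ ^ 2)) := by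
  intro t ht
  rw [normSq_eq_of_primitive (X := fun t => coef p (b t)) (hb.intervalIntegrable_coefRate hT hu p)
    (hb.coef_eq hu p) t ht]
  congr 1
  refine intervalIntegral.integral_congr fun s _ => ?_
  simp only [coefRate, inner_sub_left, real_inner_smul_left, real_inner_self_eq_norm_sq]
  ring

end

/-! ### The energy equality -/

section

lemma ae_summable_of_summable_integral {ι α : Type*} [Countable ι] {m : MeasurableSpace α}
    {μ : Measure α} {f : ι → α → ℝ} (hf : ∀ i, Integrable (f i) μ)
    (hs : Summable fun i => ∫ a, |f i a| ∂μ) :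
    (∀ᵐ a ∂μ, Summable fun i => f i a) ∧ Integrable (fun a => ∑' i, f i a) μ := by
  have h1 : ∀ i, ∫⁻ a, ‖f i a‖ₑ ∂μ = ENNReal.ofReal (∫ a, |f i a| ∂μ) := fun i => by
    rw [← ofReal_integral_norm_eq_lintegral_enorm (hf i)]; rfl
  have h2 : ∫⁻ a, ∑' i, ‖f i a‖ₑ ∂μ < ⊤ := by
    rw [lintegral_tsum fun i => (hf i).1.enorm, funext h1]
    rw [← ENNReal.ofReal_tsum_of_nonneg (fun i => integral_nonneg fun a => abs_nonneg _) hs]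
    exact ENNReal.ofReal_lt_top
  have h3 : ∀ᵐ a ∂μ, Summable fun i => f i a := by
    filter_upwards [ae_lt_top' (AEMeasurable.tsum fun i => (hf i).1.enorm) h2.ne] with a ha
    exact Summable.of_norm (tsum_enorm_ne_top_iff_summable_norm.1 ha.ne)
  refine ⟨h3, ?_, ?_⟩
  · refine aestronglyMeasurable_of_tendsto_ae (Filter.atTop : Filter (Finset ι))
      (f := fun F a => ∑ i ∈ F, f i a)
      (fun F => Finset.aestronglyMeasurable_fun_sum _ fun i _ => (hf i).1) ?_
    filter_upwards [h3] with a ha using tendsto_of_hasSum ha.hasSum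
  · exact (lintegral_mono fun a => enorm_tsum_le_tsum_enorm).trans_lt h2

lemma intervalIntegral_tsum {ι : Type*} [Countable ι] {t : ℝ} (ht : 0 ≤ t) {f : ι → ℝ → ℝ}
    (hf : ∀ i, IntervalIntegrable (f i) volume 0 t)
    (hs : Summable fun i => ∫ s in (0 : ℝ)..t, |f i s|) :
    (∀ᵐ s, s ∈ Icc 0 t → Summable fun i => f i s) ∧
      IntervalIntegrable (fun s => ∑' i, f i s) volume 0 t ∧
      HasSum (fun i => ∫ s in (0 : ℝ)..t, f i s) (∫ s in (0 : ℝ)..t, ∑' i, f i s) := by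
  have h1 : ∀ i, Integrable (f i) (volume.restrict (Icc 0 t)) := fun i =>
    (intervalIntegrable_iff_integrableOn_Icc_of_le ht).1 (hf i)
  simp only [intervalIntegral.integral_of_le ht, ← integral_Icc_eq_integral_Ioc] at hs ⊢
  obtain ⟨h2, h3⟩ := ae_summable_of_summable_integral h1 hs
  exact ⟨ae_restrict_Icc h2, (intervalIntegrable_iff_integrableOn_Icc_of_le ht).2 h3,
    hasSum_integral_of_summable_integral_norm h1 hs⟩

lemma summable_intervalIntegral_abs {ι : Type*} {t : ℝ} (ht : 0 ≤ t) {f : ι → ℝ → ℝ}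
    (hf : ∀ i, IntervalIntegrable (f i) volume 0 t) {D : ℝ → ℝ}
    (hD : IntervalIntegrable D volume 0 t)
    (hfD : ∀ᵐ s, s ∈ Icc 0 t → ∀ F : Finset ι, ∑ i ∈ F, |f i s| ≤ D s) :
    Summable fun i => ∫ s in (0 : ℝ)..t, |f i s| := by
  refine summable_of_sum_le (c := ∫ s in (0 : ℝ)..t, D s)
    (fun i => intervalIntegral.integral_nonneg ht fun s _ => abs_nonneg _) fun F => ?_
  rw [← intervalIntegral.integral_finsetSum fun i _ => (hf i).abs]
  refine intervalIntegral.integral_mono_ae_restrict ht ?_ hD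
    ((ae_restrict_iff' measurableSet_Icc).2 ?_)
  · have := IntervalIntegrable.sum F (f := fun i s => |f i s|) fun i _ => (hf i).abs
    rwa [show ∑ i ∈ F, (fun s => |f i s|) = fun s => ∑ i ∈ F, |f i s| by ext; simp] at this
  · filter_upwards [hfD] with s hs hs' using hs hs' F

/-- A regularised summation for nonnegative terms. Finite partial sums are limits of weighted ones
and stay below c, which gives summability; weights at most 1 give the reverse inequality.
Summability is thus a conclusion. -/
lemma hasSum_of_tendsto_mul {ι : Type*} {m : ℕ → ι → ℝ} {a : ι → ℝ} {l : ℕ → ℝ} {c : ℝ}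
    (ha : ∀ i, 0 ≤ a i) (hm0 : ∀ n i, 0 ≤ m n i) (hm1 : ∀ n i, m n i ≤ 1)
    (hm : ∀ i, Filter.Tendsto (fun n => m n i) Filter.atTop (nhds 1))
    (hs : ∀ n, HasSum (fun i => m n i * a i) (l n))
    (hl : Filter.Tendsto l Filter.atTop (nhds c)) : HasSum a c := by
  have h1 : ∀ F : Finset ι, ∑ i ∈ F, a i ≤ c := fun F => by
    have : Filter.Tendsto (fun n => ∑ i ∈ F, m n i * a i) Filter.atTop
        (nhds (∑ i ∈ F, 1 * a i)) := tendsto_finsetSum F fun i _ => (hm i).mul_const (a i)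
    simp only [one_mul] at this
    exact le_of_tendsto_of_tendsto' this hl fun n =>
      sum_le_hasSum F (fun i _ => mul_nonneg (hm0 n i) (ha i)) (hs n)
  have h2 : Summable a := summable_of_sum_le ha h1
  have h3 : ∑' i, a i ≤ c := h2.tsum_le_of_sum_le h1
  have h4 : c ≤ ∑' i, a i := le_of_tendsto' hl fun n =>
    hasSum_le (fun i => mul_le_of_le_one_left (ha i) (hm1 n i)) (hs n) h2.hasSum
  rw [← le_antisymm h3 h4]
  exact h2.hasSum

lemma norm_gradOp_le {a : ℝ} (ha0 : 0 ≤ a) {du : Fin 3 → E3} (ha : ∀ j, ‖du j‖ ≤ a) :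
    ‖gradOp du‖ ≤ 3 * a :=
  ContinuousLinearMap.opNorm_le_bound _ (by positivity) fun v => norm_gradOp_apply_le du v ha

lemma IsSlice.ae_norm_gradOp_le {M K : ℝ} {w : T3 → E3} {Dw : Fin 3 → T3 → E3}
    (h : IsSlice M K w Dw) : ∀ᵐ x, ‖gradOp (fun j => Dw j x)‖ ≤ 3 * K := by
  filter_upwards [ae_all_iff.2 h.bound_grad] with x hx
  exact norm_gradOp_le h.nonneg_bound_grad hx

variable {κ T : ℝ} {u : ℝ → T3 → E3} {Du : ℝ → Fin 3 → T3 → E3}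
  {b : ℝ → Lp E3 2 (volume : Measure T3)}

/-- The rate `∫ (f · ∇w) · f` at which the energy of `f` is produced by stretching. -/
noncomputable def stretchRate (Dw : Fin 3 → T3 → E3) (f : T3 → E3) : ℝ :=
  ∫ x, inner ℝ (gradOp (fun j => Dw j x) (f x)) (f x)

/-- The squared `L²` norm of the gradient, in terms of the Fourier coefficients. -/
noncomputable def gradEnergy (f : T3 → E3) : ℝ := ∑' p, mu p * ‖coef p f‖ ^ 2

lemma hasSum_res_mul {f : T3 → E3} (hf : MemLp f 2 volume) {ε : ℝ} (hε : 0 ≤ ε) :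
    HasSum (fun p => res ε p * ‖coef p f‖ ^ 2)
      ((∫ x, ‖f x‖ ^ 2) - ∑' p, (1 - res ε p) * ‖coef p f‖ ^ 2) := by
  have := (hasSum_coef_sq hf).sub (summable_one_sub_res hf hε).hasSum
  simpa [sub_mul] using this

lemma IsSolution.intervalIntegrable_inner (hT : 0 ≤ T) (hb : IsSolution κ T u Du b)
    (hu : IsVelocity T u Du) (p : Idx) :
    IntervalIntegrable (fun s => inner ℝ (forc (u s) (Du s) p (b s)) (coef p (b s)))
      volume 0 T := by
  have h := hb.intervalIntegrable_forc hT hu p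
  have e : (fun s => inner ℝ (forc (u s) (Du s) p (b s)) (coef p (b s))) =
      fun s => ∑ l, forc (u s) (Du s) p (b s) l * coef p (b s) l := funext fun s => inner_E3 _ _
  have h2 : ∀ l, IntervalIntegrable (fun s => forc (u s) (Du s) p (b s) l * coef p (b s) l)
      volume 0 T := fun l => (intervalIntegrable_apply h l).mul_continuousOn (by
    rw [uIcc_of_le hT]
    exact (EuclideanSpace.proj l : E3 →L[ℝ] ℝ).continuous.comp_continuousOn
      (hb.continuousOn_coef p))
  have h3 := IntervalIntegrable.sum Finset.univ fun l _ => h2 l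
  rw [e]
  rwa [show ∑ l, (fun s => forc (u s) (Du s) p (b s) l * coef p (b s) l) =
    fun s => ∑ l, forc (u s) (Du s) p (b s) l * coef p (b s) l by ext; simp] at h3

lemma IsSolution.intervalIntegrable_mu_normSq (hT : 0 ≤ T) (hb : IsSolution κ T u Du b)
    (c : ℝ) (p : Idx) :
    IntervalIntegrable (fun s => c * ‖coef p (b s)‖ ^ 2) volume 0 T :=
  intervalIntegrable_of_continuousOn hT
    (((hb.continuousOn_coef p).norm.pow 2).const_mul c)

lemma IsSolution.continuousOn_normSq (hb : IsSolution κ T u Du b) :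
    ContinuousOn (fun s => ‖b s‖ ^ 2) (Icc 0 T) := hb.continuousOn.norm.pow 2

/-- The energy balance of a single mode. -/
lemma IsSolution.integral_mu_normSq_eq (hT : 0 ≤ T) (hb : IsSolution κ T u Du b)
    (hu : IsVelocity T u Du) (p : Idx) {t : ℝ} (ht : t ∈ Icc 0 T) :
    ∫ s in (0 : ℝ)..t, κ * (mu p * ‖coef p (b s)‖ ^ 2) =
      (‖coef p (b 0)‖ ^ 2 - ‖coef p (b t)‖ ^ 2) / 2 +
        ∫ s in (0 : ℝ)..t, inner ℝ (forc (u s) (Du s) p (b s)) (coef p (b s)) := by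
  have h1 := hb.normSq_coef_eq hT hu p t ht
  have i1 := (intervalIntegrable_sub (hb.intervalIntegrable_inner hT hu p) ht).const_mul 2
  have i2 := (intervalIntegrable_sub (hb.intervalIntegrable_mu_normSq hT (mu p) p) ht).const_mul
    (2 * κ)
  rw [intervalIntegral.integral_sub i1 i2, intervalIntegral.integral_const_mul,
    intervalIntegral.integral_const_mul] at h1
  rw [intervalIntegral.integral_const_mul]
  linarith

/-- The stretching rate of the smoothed solution. -/
lemma IsSolution.hasSum_integral_res (hT : 0 ≤ T) (hb : IsSolution κ T u Du b)
    (hu : IsVelocity T u Du) {ε : ℝ} (hε : 0 < ε) {t : ℝ} (ht : t ∈ Icc 0 T) :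
    IntervalIntegrable (fun s => ∑' p, inner ℝ (forc (u s) (Du s) p (b s)) (res ε p • coef p (b s)))
      volume 0 t ∧
    HasSum (fun p => res ε p * ∫ s in (0 : ℝ)..t, inner ℝ (forc (u s) (Du s) p (b s)) (coef p (b s)))
      (∫ s in (0 : ℝ)..t,
        ∑' p, inner ℝ (forc (u s) (Du s) p (b s)) (res ε p • coef p (b s))) := by
  obtain ⟨M, hM0, hM⟩ := hu.exists_slice
  have hi : ∀ p, IntervalIntegrable
      (fun s => inner ℝ (forc (u s) (Du s) p (b s)) (res ε p • coef p (b s))) volume 0 t := by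
    intro p
    simp only [real_inner_smul_right]
    exact (intervalIntegrable_sub (hb.intervalIntegrable_inner hT hu p) ht).const_mul _
  have hs := summable_intervalIntegral_abs ht.1 hi
    (D := fun s => (3 * √ε⁻¹ * M + 3 * M) * ‖b s‖ ^ 2)
    (intervalIntegrable_sub (intervalIntegrable_of_continuousOn hT
      (hb.continuousOn_normSq.const_mul _)) ht) (by
        filter_upwards [ae_restrict_Icc hM] with s h1 hs F
        rw [normSq_Lp]
        exact (h1 ⟨hs.1, hs.2.trans ht.2⟩).sum_abs_res_le (Lp.memLp _) hε F)
  obtain ⟨-, h2, h3⟩ := intervalIntegral_tsum ht.1 hi hs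
  refine ⟨h2, ?_⟩
  simpa only [real_inner_smul_right, intervalIntegral.integral_const_mul] using h3

lemma IsSolution.tendsto_integral_res (hT : 0 ≤ T) (hb : IsSolution κ T u Du b)
    (hu : IsVelocity T u Du) :
    IntervalIntegrable (fun s => stretchRate (Du s) (b s)) volume 0 T ∧ ∀ t ∈ Icc 0 T,
      Filter.Tendsto (fun n : ℕ => ∫ s in (0 : ℝ)..t,
        ∑' p, inner ℝ (forc (u s) (Du s) p (b s)) (res (1 / (n + 1)) p • coef p (b s)))
        Filter.atTop (nhds (∫ s in (0 : ℝ)..t, stretchRate (Du s) (b s))) := by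
  obtain ⟨M, hM0, hM⟩ := hu.exists_slice
  set S : ℕ → ℝ → ℝ := fun n s =>
    ∑' p, inner ℝ (forc (u s) (Du s) p (b s)) (res (1 / (n + 1)) p • coef p (b s)) with hS
  have hSi : ∀ n t, t ∈ Icc 0 T → IntervalIntegrable (S n) volume 0 t := fun n t ht =>
    (hb.hasSum_integral_res hT hu (by positivity) ht).1
  have hlim : ∀ᵐ s, s ∈ Icc 0 T →
      Filter.Tendsto (fun n => S n s) Filter.atTop (nhds (stretchRate (Du s) (b s))) := by
    filter_upwards [ae_restrict_Icc hM] with s h1 hs using (h1 hs).tendsto_tsum_res (Lp.memLp _)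
  have hA : IntervalIntegrable (fun s => stretchRate (Du s) (b s)) volume 0 T := by
    refine intervalIntegrable_of_bound hT ?_ (C := ?_) ?_
    rotate_left
    · exact 3 * M * (hb.exists_bound.choose) ^ 2
    · filter_upwards [hM, ae_restrict_mem measurableSet_Icc] with s h1 hs
      obtain ⟨hB0, hB⟩ := hb.exists_bound.choose_spec
      refine (h1.abs_integral_stretch_le (Lp.memLp _) (k := 3 * M) h1.ae_norm_gradOp_le).trans ?_
      rw [← normSq_Lp]
      have := hB s hs
      gcongr
    · refine aestronglyMeasurable_of_tendsto_ae Filter.atTop (f := S) (fun n => ?_)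
        ((ae_restrict_iff' measurableSet_Icc).2 hlim)
      exact ((intervalIntegrable_iff_integrableOn_Icc_of_le hT).1 (hSi n T ⟨hT, le_rfl⟩)).1
  refine ⟨hA, fun t ht => ?_⟩
  have hAt := intervalIntegrable_sub hA ht
  refine intervalIntegral.tendsto_integral_filter_of_dominated_convergence
    (fun s => 12 * M * ‖b s‖ ^ 2 + |stretchRate (Du s) (b s)|) (Filter.Eventually.of_forall fun n =>
      ?_) (Filter.Eventually.of_forall fun n => ?_) ?_ ?_
  · exact (intervalIntegrable_iff.1 (hSi n t ht)).1
  · filter_upwards [ae_restrict_Icc hM] with s h1 hs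
    rw [uIoc_of_le ht.1] at hs
    have h2 := (h1 ⟨hs.1.le, hs.2.trans ht.2⟩).abs_tsum_res_sub_le' (Lp.memLp (b s))
      (ε := 1 / (n + 1)) (by positivity)
    rw [← normSq_Lp] at h2
    have h3 := abs_sub_abs_le_abs_sub (S n s) (stretchRate (Du s) (b s))
    rw [Real.norm_eq_abs]
    change |S n s - stretchRate (Du s) (b s)| ≤ _ at h2
    linarith
  · exact (intervalIntegrable_sub (intervalIntegrable_of_continuousOn hT
      (hb.continuousOn_normSq.const_mul _)) ht).add hAt.abs
  · filter_upwards [hlim] with s h1 hs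
    rw [uIoc_of_le ht.1] at hs
    exact h1 ⟨hs.1.le, hs.2.trans ht.2⟩

/-- The balances of the single modes, weighted by `res`, sum to quantities whose limit as ε → 0 is
known. Since the dissipation of each mode is nonnegative, removing the weights yields convergence of
the total dissipation as well as its value. -/
lemma IsSolution.hasSum_dissipation (hκ : 0 ≤ κ) (hT : 0 ≤ T) (hb : IsSolution κ T u Du b)
    (hu : IsVelocity T u Du) {t : ℝ} (ht : t ∈ Icc 0 T) :
    HasSum (fun p => ∫ s in (0 : ℝ)..t, κ * (mu p * ‖coef p (b s)‖ ^ 2))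
      ((‖b 0‖ ^ 2 - ‖b t‖ ^ 2) / 2 + ∫ s in (0 : ℝ)..t, stretchRate (Du s) (b s)) := by
  have hn : ∀ n : ℕ, (0 : ℝ) < 1 / ((n : ℝ) + 1) := fun n => by positivity
  have hQ : ∀ s, Filter.Tendsto (fun n : ℕ => ‖b s‖ ^ 2 -
      ∑' p, (1 - res (1 / (n + 1)) p) * ‖coef p (b s)‖ ^ 2) Filter.atTop (nhds (‖b s‖ ^ 2)) :=
    fun s => by simpa using (tendsto_tsum_one_sub_res (Lp.memLp (b s))).const_sub (‖b s‖ ^ 2)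
  refine hasSum_of_tendsto_mul (m := fun n p => res (1 / (n + 1)) p) (fun p => ?_)
    (fun n p => (res_pos (hn n).le p).le) (fun n p => res_le_one (hn n).le p) tendsto_res
    (fun n => ?_)
    ((((hQ 0).sub (hQ t)).div_const 2).add ((hb.tendsto_integral_res hT hu).2 t ht))
  · exact intervalIntegral.integral_nonneg ht.1 fun s _ =>
      mul_nonneg hκ (mul_nonneg (mu_nonneg p) (sq_nonneg _))
  · have h0 := hasSum_res_mul (Lp.memLp (b 0)) (hn n).le
    have h1 := hasSum_res_mul (Lp.memLp (b t)) (hn n).le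
    rw [← normSq_Lp] at h0 h1
    have h2 := ((h0.sub h1).div_const 2).add (hb.hasSum_integral_res hT hu (hn n) ht).2
    convert! h2 using 2 with p
    rw [hb.integral_mu_normSq_eq hT hu p ht]
    ring

/-- The energy equality. -/
lemma IsSolution.normSq_eq (hκ : 0 ≤ κ) (hT : 0 ≤ T) (hb : IsSolution κ T u Du b)
    (hu : IsVelocity T u Du) :
    (∀ᵐ s, s ∈ Icc 0 T → Summable fun p => κ * (mu p * ‖coef p (b s)‖ ^ 2)) ∧
      IntervalIntegrable (fun s => κ * gradEnergy (b s)) volume 0 T ∧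
      ∀ t ∈ Icc 0 T, ‖b t‖ ^ 2 = ‖b 0‖ ^ 2 +
        ∫ s in (0 : ℝ)..t, (2 * stretchRate (Du s) (b s) - 2 * (κ * gradEnergy (b s))) := by
  have hi : ∀ p t, t ∈ Icc 0 T →
      IntervalIntegrable (fun s => κ * (mu p * ‖coef p (b s)‖ ^ 2)) volume 0 t := fun p t ht =>
    (intervalIntegrable_sub (hb.intervalIntegrable_mu_normSq hT (mu p) p) ht).const_mul κ
  have habs : ∀ p s, |κ * (mu p * ‖coef p (b s)‖ ^ 2)| = κ * (mu p * ‖coef p (b s)‖ ^ 2) :=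
    fun p s => abs_of_nonneg (mul_nonneg hκ (mul_nonneg (mu_nonneg p) (sq_nonneg _)))
  have key : ∀ t, t ∈ Icc 0 T → _ := fun t ht => intervalIntegral_tsum ht.1 (fun p => hi p t ht)
    (by simpa only [habs] using (hb.hasSum_dissipation hκ hT hu ht).summable)
  have he : ∀ f : T3 → E3, ∑' p, mu p * ‖coef p f‖ ^ 2 = gradEnergy f := fun _ => rfl
  simp only [tsum_mul_left, he] at key
  obtain ⟨h1, h2, -⟩ := key T ⟨hT, le_rfl⟩
  refine ⟨h1, h2, fun t ht => ?_⟩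
  have h3 := (key t ht).2.2.unique (hb.hasSum_dissipation hκ hT hu ht)
  rw [intervalIntegral.integral_sub
    ((intervalIntegrable_sub (hb.tendsto_integral_res hT hu).1 ht).const_mul 2)
    ((intervalIntegrable_sub h2 ht).const_mul 2), intervalIntegral.integral_const_mul,
    intervalIntegral.integral_const_mul, h3]
  ring

end

/-! ### The balance of the gradient energy -/

section

lemma HasWeakPartial.coef_eq {f g : T3 → E3} {j : Fin 3} (h : HasWeakPartial j f g) (p : Idx) :
    coef p g = -(freq p j • coef (flip p) f) := by
  have := h.eq (trig p) (smoothOnTorus_trig p)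
  simp only [partialD_trig, mul_smul] at this
  rw [integral_smul] at this
  rw [coef, coef, this, neg_neg]

lemma IsH1Gradient.hasSum_mu {f : Lp E3 2 (volume : Measure T3)} {Df : Fin 3 → T3 → E3}
    (h : IsH1Gradient f Df) : HasSum (fun p => mu p * ‖coef p f‖ ^ 2) (gradL2Sq Df) := by
  have h1 := hasSum_sum fun j (_ : j ∈ Finset.univ) => hasSum_coef_sq (h.memLp j)
  rw [← integral_finsetSum _ fun j _ => integrable_normSq (h.memLp j)] at h1
  -- Differentiation exchanges cosine and sine, so the two sums agree after reindexing by `flip`.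
  have hinv : Function.Involutive flip := flip_flip
  rw [← (hinv.toPerm flip).hasSum_iff]
  convert! h1 using 2 with p
  simp only [Function.comp_apply, Function.Involutive.coe_toPerm, freq_flip, neg_sq, (h.weak _).coef_eq,
    norm_neg, norm_smul, mul_pow, Real.norm_eq_abs, sq_abs, mu, Finset.sum_mul]

/-- Cauchy–Schwarz on the coefficients with `mu` = 1 · `mu`. This is the inequality G² ≤ E L that
lets diffusion only decrease the Dirichlet quotient. -/
lemma gradEnergy_sq_le {f : T3 → E3} (hf : MemLp f 2 volume)
    (hs : Summable fun p => mu p * ‖coef p f‖ ^ 2)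
    (hs2 : Summable fun p => mu p ^ 2 * ‖coef p f‖ ^ 2) :
    gradEnergy f ^ 2 ≤ (∫ x, ‖f x‖ ^ 2) * ∑' p, mu p ^ 2 * ‖coef p f‖ ^ 2 := by
  have h0 : 0 ≤ ∫ x, ‖f x‖ ^ 2 := integral_nonneg fun x => by positivity
  have hL : 0 ≤ ∑' p, mu p ^ 2 * ‖coef p f‖ ^ 2 := tsum_nonneg fun p => by positivity
  have hg : 0 ≤ gradEnergy f := tsum_nonneg fun p => mul_nonneg (mu_nonneg p) (sq_nonneg _)
  have h1 : gradEnergy f ≤ √(∫ x, ‖f x‖ ^ 2) * √(∑' p, mu p ^ 2 * ‖coef p f‖ ^ 2) := by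
    refine hs.tsum_le_of_sum_le fun F => ?_
    have := Real.sum_mul_le_sqrt_mul_sqrt F (fun p => ‖coef p f‖) fun p => mu p * ‖coef p f‖
    simp only [mul_pow] at this
    refine (le_of_eq (Finset.sum_congr rfl fun p _ => by ring)).trans (this.trans ?_)
    gcongr
    · exact sum_le_hasSum F (fun p _ => by positivity) (hasSum_coef_sq hf)
    · exact hs2.sum_le_tsum F fun p _ => by positivity
  rw [← Real.sqrt_mul h0] at h1
  exact (pow_le_pow_left₀ hg h1 2).trans (Real.sq_sqrt (by positivity)).le

/-- A nonzero frequency gives at least 4π²; the weaker bound 1 is enough and makes the Poincaré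
constant 1. -/
lemma one_le_mu {p : Idx} (hp : p.1 ≠ 0) : 1 ≤ mu p := by
  obtain ⟨j, hj⟩ := Function.ne_iff.1 hp
  refine le_trans ?_ (freq_sq_le_mu p j)
  have h1 : (1 : ℝ) ≤ (p.1 j : ℝ) ^ 2 := by
    have : (1 : ℤ) ≤ p.1 j ^ 2 := (sq_pos_of_ne_zero hj : 0 < p.1 j ^ 2)
    exact_mod_cast this
  have h2 : freq p j ^ 2 = (2 * Real.pi) ^ 2 * (p.1 j : ℝ) ^ 2 := by
    unfold freq; split_ifs <;> ring
  rw [h2]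
  nlinarith [Real.pi_gt_three]

lemma coef_eq_zero {f : T3 → E3} (hf : ∫ x, f x = 0) {p : Idx} (hp : p.1 = 0) : coef p f = 0 := by
  obtain ⟨k, _ | _⟩ := p <;> obtain rfl : k = 0 := hp <;> simp [coef, trig, hf, mFourier]

/-- Poincaré's inequality. -/
lemma integral_normSq_le_gradEnergy {f : T3 → E3} (hf : MemLp f 2 volume) (h0 : ∫ x, f x = 0)
    (hs : Summable fun p => mu p * ‖coef p f‖ ^ 2) : ∫ x, ‖f x‖ ^ 2 ≤ gradEnergy f := by
  refine hasSum_le (fun p => ?_) (hasSum_coef_sq hf) hs.hasSum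
  by_cases hp : p.1 = 0
  · simp [coef_eq_zero h0 hp]
  · exact le_mul_of_one_le_left (sq_nonneg _) (one_le_mu hp)

variable {κ T : ℝ} {u : ℝ → T3 → E3} {Du : ℝ → Fin 3 → T3 → E3}
  {b : ℝ → Lp E3 2 (volume : Measure T3)}

lemma IsSolution.intervalIntegrable_normSq_forc (hT : 0 ≤ T) (hb : IsSolution κ T u Du b)
    (hu : IsVelocity T u Du) (p : Idx) :
    IntervalIntegrable (fun s => ‖forc (u s) (Du s) p (b s)‖ ^ 2) volume 0 T := by
  obtain ⟨M, hM0, hM⟩ := hu.exists_slice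
  obtain ⟨B, hB0, hB⟩ := hb.exists_bound
  refine intervalIntegrable_of_bound hT ((hb.aestronglyMeasurable_forc hu p).norm.pow 2)
    (C := ((3 * √(mu p) * M + 3 * M) * B) ^ 2) ?_
  filter_upwards [hM, ae_restrict_mem measurableSet_Icc] with s hs hsT
  rw [Real.norm_eq_abs, abs_of_nonneg (sq_nonneg _)]
  refine pow_le_pow_left₀ (norm_nonneg _) ((hs.norm_forc_le (Lp.memLp (b s)) p).trans ?_) 2
  rw [← normSq_Lp, Real.sqrt_sq (norm_nonneg _)]
  exact mul_le_mul_of_nonneg_left (hB s hsT) (by positivity)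

lemma IsSolution.ae_summable_mu (hκ : 0 < κ) (hT : 0 ≤ T) (hb : IsSolution κ T u Du b)
    (hu : IsVelocity T u Du) :
    (∀ᵐ s, s ∈ Icc 0 T → Summable fun p => mu p * ‖coef p (b s)‖ ^ 2) ∧
      IntervalIntegrable (fun s => gradEnergy (b s)) volume 0 T := by
  obtain ⟨h1, h2, -⟩ := hb.normSq_eq hκ.le hT hu
  constructor
  · filter_upwards [h1] with s hs hs' using (summable_mul_left_iff hκ.ne').1 (hs hs')
  · simpa [hκ.ne'] using h2.const_mul κ⁻¹

lemma tsum_one_add_mu {f : T3 → E3} (hf : MemLp f 2 volume)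
    (hs : Summable fun p => mu p * ‖coef p f‖ ^ 2) :
    ∑' p, (1 + mu p) * ‖coef p f‖ ^ 2 = (∫ x, ‖f x‖ ^ 2) + gradEnergy f := by
  simp only [add_mul, one_mul]
  rw [(hasSum_coef_sq hf).summable.tsum_add hs, (hasSum_coef_sq hf).tsum_eq, gradEnergy]

/-- The rate at which the gradient energy is produced. -/
noncomputable def gradRate (w : T3 → E3) (Dw : Fin 3 → T3 → E3) (f : T3 → E3) : ℝ :=
  ∑' p, mu p * inner ℝ (forc w Dw p f) (coef p f)

/-- The squared `L²` norm of the Laplacian, in terms of the Fourier coefficients. -/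
noncomputable def lapEnergy (f : T3 → E3) : ℝ := ∑' p, mu p ^ 2 * ‖coef p f‖ ^ 2

lemma IsSolution.mu_normSq_eq (hT : 0 ≤ T) (hb : IsSolution κ T u Du b) (hu : IsVelocity T u Du)
    (p : Idx) {t : ℝ} (ht : t ∈ Icc 0 T) :
    mu p * ‖coef p (b t)‖ ^ 2 = mu p * ‖coef p (b 0)‖ ^ 2 +
      2 * (∫ s in (0 : ℝ)..t, mu p * inner ℝ (forc (u s) (Du s) p (b s)) (coef p (b s))) -
      2 * κ * ∫ s in (0 : ℝ)..t, mu p ^ 2 * ‖coef p (b s)‖ ^ 2 := by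
  have h1 := hb.integral_mu_normSq_eq hT hu p ht
  rw [intervalIntegral.integral_const_mul, intervalIntegral.integral_const_mul] at h1
  rw [intervalIntegral.integral_const_mul, intervalIntegral.integral_const_mul]
  linear_combination 2 * mu p * h1

/-- Parabolic regularity: for almost every time the forcing is square summable over the modes
because b is in H¹, and Young's inequality lets half of the dissipation absorb the production of
gradient energy. -/
lemma IsSolution.summable_integral_lap (hκ : 0 < κ) (hT : 0 ≤ T) (hb : IsSolution κ T u Du b)
    (hu : IsVelocity T u Du) (h0 : Summable fun p => mu p * ‖coef p (b 0)‖ ^ 2) :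
    Summable fun p => ∫ s in (0 : ℝ)..T, |mu p ^ 2 * ‖coef p (b s)‖ ^ 2| := by
  obtain ⟨M, hM0, hM⟩ := hu.exists_slice
  obtain ⟨hs, hg⟩ := hb.ae_summable_mu hκ hT hu
  have hf := hb.intervalIntegrable_normSq_forc hT hu
  have h1 := summable_intervalIntegral_abs hT hf
    (D := fun s => 18 * (M ^ 2 + M ^ 2) * (‖b s‖ ^ 2 + gradEnergy (b s)))
    (((intervalIntegrable_of_continuousOn hT hb.continuousOn_normSq).add hg).const_mul _) (by
      filter_upwards [ae_restrict_Icc hM, hs] with s h2 h3 hsT F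
      have h4 := (h2 hsT).sum_normSq_forc_le (Lp.memLp (b s)) (h3 hsT) F
      rw [tsum_one_add_mu (Lp.memLp _) (h3 hsT), ← normSq_Lp] at h4
      simpa using h4)
  refine Summable.of_nonneg_of_le
    (fun p => intervalIntegral.integral_nonneg hT fun s _ => abs_nonneg _) (fun p => ?_)
    ((h0.add (h1.mul_left κ⁻¹)).mul_left κ⁻¹)
  have h2 := hb.mu_normSq_eq hT hu p ⟨hT, le_rfl⟩
  have i1 := (hb.intervalIntegrable_inner hT hu p).const_mul (mu p)
  have i2 := hb.intervalIntegrable_mu_normSq hT (mu p ^ 2) p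
  -- Young's inequality with weight κ, the expansion of κ⁻¹(|f| − κ μ|c|)² ≥ 0; one of the two units
  -- of κ ∫ μ²|c|² survives on the left of the balance.
  have h3 : 2 * ∫ s in (0 : ℝ)..T, mu p * inner ℝ (forc (u s) (Du s) p (b s)) (coef p (b s)) ≤
      (κ * ∫ s in (0 : ℝ)..T, mu p ^ 2 * ‖coef p (b s)‖ ^ 2) +
        κ⁻¹ * ∫ s in (0 : ℝ)..T, |‖forc (u s) (Du s) p (b s)‖ ^ 2| := by
    simp only [← intervalIntegral.integral_const_mul]
    rw [← intervalIntegral.integral_add (i2.const_mul κ) ((hf p).abs.const_mul κ⁻¹)]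
    refine intervalIntegral.integral_mono_on hT (i1.const_mul 2)
      ((i2.const_mul κ).add ((hf p).abs.const_mul κ⁻¹)) fun s _ => ?_
    rw [abs_of_nonneg (sq_nonneg ‖forc (u s) (Du s) p (b s)‖)]
    have h4 := real_inner_le_norm (forc (u s) (Du s) p (b s)) (coef p (b s))
    have h5 := mul_le_mul_of_nonneg_left h4 (mu_nonneg p)
    have h6 : 0 ≤ κ⁻¹ * (‖forc (u s) (Du s) p (b s)‖ - κ * (mu p * ‖coef p (b s)‖)) ^ 2 := by
      positivity
    have h7 : κ⁻¹ * (‖forc (u s) (Du s) p (b s)‖ - κ * (mu p * ‖coef p (b s)‖)) ^ 2 =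
        κ⁻¹ * ‖forc (u s) (Du s) p (b s)‖ ^ 2 -
          2 * (mu p * (‖forc (u s) (Du s) p (b s)‖ * ‖coef p (b s)‖)) +
          κ * (mu p ^ 2 * ‖coef p (b s)‖ ^ 2) := by
      field_simp; ring
    linarith
  have h4 : ∀ s, |mu p ^ 2 * ‖coef p (b s)‖ ^ 2| = mu p ^ 2 * ‖coef p (b s)‖ ^ 2 := fun s =>
    abs_of_nonneg (by positivity)
  simp only [h4]
  have h5 : 0 ≤ mu p * ‖coef p (b T)‖ ^ 2 := mul_nonneg (mu_nonneg p) (sq_nonneg _)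
  rw [le_inv_mul_iff₀ hκ]
  linarith

/-- The balance of the gradient energy. -/
lemma IsSolution.gradEnergy_eq (hκ : 0 < κ) (hT : 0 ≤ T) (hb : IsSolution κ T u Du b)
    (hu : IsVelocity T u Du) (h0 : Summable fun p => mu p * ‖coef p (b 0)‖ ^ 2) :
    (∀ᵐ s, s ∈ Icc 0 T → Summable fun p => mu p ^ 2 * ‖coef p (b s)‖ ^ 2) ∧
      IntervalIntegrable (fun s => 2 * gradRate (u s) (Du s) (b s) - 2 * κ * lapEnergy (b s))
        volume 0 T ∧
      ∀ t ∈ Icc 0 T, (Summable fun p => mu p * ‖coef p (b t)‖ ^ 2) ∧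
        gradEnergy (b t) = gradEnergy (b 0) + ∫ s in (0 : ℝ)..t,
          (2 * gradRate (u s) (Du s) (b s) - 2 * κ * lapEnergy (b s)) := by
  obtain ⟨M, hM0, hM⟩ := hu.exists_slice
  obtain ⟨hs, hg⟩ := hb.ae_summable_mu hκ hT hu
  have i1 := fun p => (hb.intervalIntegrable_inner hT hu p).const_mul (mu p)
  have i2 := fun p => hb.intervalIntegrable_mu_normSq hT (mu p ^ 2) p
  have hlap := hb.summable_integral_lap hκ hT hu h0
  obtain ⟨hs2, hL', -⟩ := intervalIntegral_tsum hT i2 hlap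
  have hL : IntervalIntegrable (fun s => lapEnergy (b s)) volume 0 T := hL'
  have hbd : ∀ᵐ s, s ∈ Icc 0 T → ∀ F : Finset Idx,
      ∑ p ∈ F, |mu p * inner ℝ (forc (u s) (Du s) p (b s)) (coef p (b s))| ≤
        18 * (M ^ 2 + M ^ 2) * (‖b s‖ ^ 2 + gradEnergy (b s)) + lapEnergy (b s) := by
    filter_upwards [ae_restrict_Icc hM, hs, hs2] with s h2 h3 h4 hsT F
    have h5 := (h2 hsT).sum_abs_mu_inner_le (Lp.memLp (b s)) (h3 hsT) (h4 hsT) F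
    rwa [tsum_one_add_mu (Lp.memLp _) (h3 hsT), ← normSq_Lp] at h5
  have hD : IntervalIntegrable (fun s => 18 * (M ^ 2 + M ^ 2) * (‖b s‖ ^ 2 + gradEnergy (b s)) +
      lapEnergy (b s)) volume 0 T :=
    (((intervalIntegrable_of_continuousOn hT hb.continuousOn_normSq).add hg).const_mul _).add hL
  have hR : IntervalIntegrable (fun s => gradRate (u s) (Du s) (b s)) volume 0 T :=
    (intervalIntegral_tsum hT i1 (summable_intervalIntegral_abs hT i1 hD hbd)).2.1
  refine ⟨hs2, (hR.const_mul 2).sub (hL.const_mul (2 * κ)), fun t ht => ?_⟩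
  have sub : ∀ s ∈ Icc 0 t, s ∈ Icc 0 T := fun s hs => ⟨hs.1, hs.2.trans ht.2⟩
  have j1 := fun p => intervalIntegrable_sub (i1 p) ht
  have j2 := fun p => intervalIntegrable_sub (i2 p) ht
  have k1 := (intervalIntegral_tsum ht.1 j1 (summable_intervalIntegral_abs ht.1 j1
    (intervalIntegrable_sub hD ht)
    (by filter_upwards [hbd] with s h1 h2 using h1 (sub s h2)))).2.2
  have k2 := (intervalIntegral_tsum ht.1 j2 (summable_intervalIntegral_abs ht.1 j2
    (intervalIntegrable_sub hL ht) (by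
      filter_upwards [hs2] with s h1 h2 F
      have h3 : ∀ p, |mu p ^ 2 * ‖coef p (b s)‖ ^ 2| = mu p ^ 2 * ‖coef p (b s)‖ ^ 2 := fun p =>
        abs_of_nonneg (by positivity)
      simp only [h3]
      exact (h1 (sub s h2)).sum_le_tsum F fun p _ => by positivity))).2.2
  have k3 := (h0.hasSum.add (k1.mul_left 2)).sub (k2.mul_left (2 * κ))
  simp only [← hb.mu_normSq_eq hT hu _ ht] at k3
  refine ⟨k3.summable, k3.tsum_eq.trans ?_⟩
  rw [intervalIntegral.integral_sub (intervalIntegrable_sub (hR.const_mul 2) ht)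
    (intervalIntegrable_sub (hL.const_mul (2 * κ)) ht), intervalIntegral.integral_const_mul,
    intervalIntegral.integral_const_mul]
  exact add_sub_assoc _ _ _

end

/-! ### Essential suprema in time and growth of the Dirichlet quotient -/

section

/-- The essential supremum of a slice is at most a exactly when the slice of {F > a} is null, and
the measure of slices is measurable in s. -/
lemma measurable_essSup_slice {α X : Type*} [MeasurableSpace α] [MeasurableSpace X]
    {ν : Measure X} [SFinite ν] {F : α × X → ENNReal} (hF : Measurable F) :
    Measurable fun s => essSup (fun x => F (s, x)) ν := by
  refine measurable_of_Iic fun a => ?_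
  have h1 : (fun s => essSup (fun x => F (s, x)) ν) ⁻¹' Iic a =
      (fun s => ν (Prod.mk s ⁻¹' (F ⁻¹' Ioi a))) ⁻¹' {0} := by
    ext s
    have h2 : ν (Prod.mk s ⁻¹' (F ⁻¹' Ioi a)) = 0 ↔ ∀ᵐ x ∂ν, F (s, x) ≤ a := by
      rw [ae_iff]
      refine Eq.congr_left (congrArg ν ?_)
      ext x
      simp
    simp only [mem_preimage, mem_Iic, mem_singleton_iff, h2]
    exact ⟨fun h => (ENNReal.ae_le_essSup _).mono fun x hx => hx.trans h, essSup_le_of_ae_le a⟩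
  rw [h1]
  exact measurable_measure_prodMk_left (hF measurableSet_Ioi) (measurableSet_singleton 0)

variable {κ T : ℝ} {u : ℝ → T3 → E3} {Du : ℝ → Fin 3 → T3 → E3}
  {D2u : ℝ → Fin 3 → Fin 3 → T3 → E3} {b : ℝ → Lp E3 2 (volume : Measure T3)}

lemma continuous_gradOp : Continuous gradOp := by
  unfold gradOp
  refine continuous_finsetSum _ fun j _ => ?_
  exact (ContinuousLinearMap.smulRightL ℝ E3 E3 (EuclideanSpace.proj j)).continuous.comp
    (continuous_apply j)

lemma IsVelocity.measurable_gradSup (hu : IsVelocity T u Du) :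
    Measurable fun s => gradSup (Du s) := by
  have h : Measurable fun q : ℝ × T3 => ‖gradOp (fun j => Du q.1 j q.2)‖ₑ :=
    continuous_gradOp.enorm.measurable.comp (measurable_pi_lambda _ hu.measurable_grad)
  simpa only [gradSup, eLpNorm_exponent_top, eLpNormEssSup] using measurable_essSup_slice h

lemma IsHessianL1.measurable_hessSup (h : IsHessianL1 T Du D2u) :
    Measurable fun s => hessSup (D2u s) := by
  have h1 : Measurable fun q : ℝ × T3 => ‖√(∑ i, ∑ j, ‖D2u q.1 i j q.2‖ ^ 2)‖ₑ :=
    (Finset.measurable_fun_sum _ fun i _ => Finset.measurable_fun_sum _ fun j _ =>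
      (h.measurable i j).norm.pow_const 2).sqrt.enorm
  simpa only [hessSup, eLpNorm_exponent_top, eLpNormEssSup] using measurable_essSup_slice h1

lemma ae_norm_le_toReal {E : Type*} [NormedAddCommGroup E] {f : T3 → E}
    (hf : eLpNorm f ⊤ volume ≠ ⊤) : ∀ᵐ x, ‖f x‖ ≤ (eLpNorm f ⊤ volume).toReal := by
  filter_upwards [ae_le_eLpNormEssSup (f := f) (μ := volume)] with x hx
  rw [← toReal_enorm]
  exact ENNReal.toReal_mono hf (by rwa [eLpNorm_exponent_top])

lemma IsSlice.gradSup_le {M K : ℝ} {w : T3 → E3} {Dw : Fin 3 → T3 → E3} (h : IsSlice M K w Dw) :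
    gradSup Dw ≤ ENNReal.ofReal (3 * K) := by
  rw [gradSup, eLpNorm_exponent_top]
  exact eLpNormEssSup_le_of_ae_bound h.ae_norm_gradOp_le

lemma IsSlice.ae_norm_gradOp_le_gradSup {M K : ℝ} {w : T3 → E3} {Dw : Fin 3 → T3 → E3}
    (h : IsSlice M K w Dw) : ∀ᵐ x, ‖gradOp (fun j => Dw j x)‖ ≤ (gradSup Dw).toReal :=
  ae_norm_le_toReal (h.gradSup_le.trans_lt ENNReal.ofReal_lt_top).ne

lemma IsVelocity.intervalIntegrable_gradSup (hT : 0 ≤ T) (hu : IsVelocity T u Du) :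
    IntervalIntegrable (fun s => (gradSup (Du s)).toReal) volume 0 T := by
  obtain ⟨M, hM0, hM⟩ := hu.exists_slice
  refine intervalIntegrable_of_bound hT hu.measurable_gradSup.ennreal_toReal.aestronglyMeasurable
    (C := 3 * M) ?_
  filter_upwards [hM] with s hs
  rw [Real.norm_eq_abs, abs_of_nonneg ENNReal.toReal_nonneg]
  exact ENNReal.toReal_le_of_le_ofReal (by positivity) hs.gradSup_le

lemma IsHessianL1.intervalIntegrable (hT : 0 ≤ T) (h : IsHessianL1 T Du D2u) :
    IntervalIntegrable (fun s => (hessSup (D2u s)).toReal) volume 0 T := by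
  rw [intervalIntegrable_iff_integrableOn_Icc_of_le hT]
  exact integrable_toReal_of_lintegral_ne_top h.measurable_hessSup.aemeasurable h.integrable.ne

lemma IsHessianL1.ae_norm_le (h : IsHessianL1 T Du D2u) :
    ∀ᵐ s ∂(volume.restrict (Icc 0 T)), ∀ i j, ∀ᵐ x,
      ‖D2u s i j x‖ ≤ (hessSup (D2u s)).toReal := by
  filter_upwards [ae_lt_top h.measurable_hessSup h.integrable.ne] with s hs i j
  filter_upwards [ae_norm_le_toReal (f := fun x => √(∑ i, ∑ j, ‖D2u s i j x‖ ^ 2)) hs.ne] with x hx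
  refine le_trans ?_ ((le_abs_self _).trans hx)
  refine Real.le_sqrt_of_sq_le ?_
  calc ‖D2u s i j x‖ ^ 2 ≤ ∑ j, ‖D2u s i j x‖ ^ 2 :=
        Finset.single_le_sum (f := fun j => ‖D2u s i j x‖ ^ 2) (fun _ _ => sq_nonneg _)
          (Finset.mem_univ j)
    _ ≤ _ := Finset.single_le_sum (f := fun i => ∑ j, ‖D2u s i j x‖ ^ 2)
          (fun _ _ => Finset.sum_nonneg fun _ _ => sq_nonneg _) (Finset.mem_univ i)

lemma HasWeakPartial.integral_deriv_eq_zero {i : Fin 3} {f g : T3 → E3}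
    (h : HasWeakPartial i f g) : ∫ x, g x = 0 := by
  have := h.eq (fun _ => 1) (SmoothOnTorus.const 1)
  simpa [partialD_const] using this

/-- The gradient of the velocity is bounded by its second derivatives. -/
lemma IsVelocity.ae_isSlice_hessSup (hu : IsVelocity T u Du) (h : IsHessianL1 T Du D2u) :
    ∃ M : ℝ, ∀ᵐ s ∂(volume.restrict (Icc 0 T)),
      IsSlice M (9 * (hessSup (D2u s)).toReal) (u s) (Du s) := by
  obtain ⟨M, hM0, hM⟩ := hu.exists_slice
  refine ⟨M, ?_⟩
  filter_upwards [hM, h.ae_norm_le, h.weak_hess] with s h1 h2 h3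
  refine ⟨h1.bound, fun j => ?_, h1.weak, h1.div⟩
  have hm : Measurable (Du s j) := (hu.measurable_grad j).comp measurable_prodMk_left
  exact HasWeakPartial.ae_norm_le hm
    (MemLp.of_bound hm.aestronglyMeasurable M (h1.bound_grad j)) (fun i => h3 i j)
    (h1.weak j).integral_deriv_eq_zero fun i => h2 i j

/-- Poincaré's inequality for the mean-zero f turns the mixed term √E √G into G, and 171 = 18 · 9 +
9. -/
lemma IsSlice.abs_gradRate_le {M H : ℝ} {w : T3 → E3} {Dw : Fin 3 → T3 → E3}
    (h : IsSlice M (9 * H) w Dw) {D2w : Fin 3 → Fin 3 → T3 → E3}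
    (h2 : ∀ i j, HasWeakPartial i (Dw j) (D2w i j)) (hH : ∀ i j, ∀ᵐ x, ‖D2w i j x‖ ≤ H)
    {f : T3 → E3} (hf : MemLp f 2 volume) (h0 : ∫ x, f x = 0)
    (hs : Summable fun p => mu p * ‖coef p f‖ ^ 2)
    (hs2 : Summable fun p => mu p ^ 2 * ‖coef p f‖ ^ 2) :
    |gradRate w Dw f| ≤ 171 * H * gradEnergy f := by
  have hH0 : 0 ≤ H := by have := h.nonneg_bound_grad; linarith
  have h3 := h.abs_tsum_mu_inner_le hf hs hs2 h2 hH
  have hg : 0 ≤ gradEnergy f := tsum_nonneg fun p => mul_nonneg (mu_nonneg p) (sq_nonneg _)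
  have h4 : √(∫ x, ‖f x‖ ^ 2) * √(gradEnergy f) ≤ gradEnergy f := by
    calc _ ≤ √(gradEnergy f) * √(gradEnergy f) := by
          gcongr; exact integral_normSq_le_gradEnergy hf h0 hs
      _ = _ := Real.mul_self_sqrt hg
  change |gradRate w Dw f| ≤ 18 * (9 * H) * gradEnergy f +
    9 * H * (√(∫ x, ‖f x‖ ^ 2) * √(gradEnergy f)) at h3
  nlinarith [mul_le_mul_of_nonneg_left h4 hH0]

lemma gradEnergy_nonneg (f : T3 → E3) : 0 ≤ gradEnergy f :=
  tsum_nonneg fun p => mul_nonneg (mu_nonneg p) (sq_nonneg _)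

/-- As long as the solution does not vanish, the ratio of the gradient energy and the energy grows
at most exponentially. -/
lemma IsSolution.gradEnergy_le (hκ : 0 < κ) (hb : IsSolution κ T u Du b)
    (hu : IsVelocity T u Du) (hH : IsHessianL1 T Du D2u)
    (h0 : Summable fun p => mu p * ‖coef p (b 0)‖ ^ 2) {t : ℝ} (ht : t ∈ Icc 0 T)
    (hne : ∀ s ∈ Icc 0 t, b s ≠ 0) :
    ∀ s ∈ Icc 0 t, gradEnergy (b s) ≤
      Real.exp (396 * ∫ r in (0 : ℝ)..s, (hessSup (D2u r)).toReal) *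
        (gradEnergy (b 0) / ‖b 0‖ ^ 2) * ‖b s‖ ^ 2 := by
  have hT : 0 ≤ T := ht.1.trans ht.2
  have sub : ∀ s ∈ Icc 0 t, s ∈ Icc 0 T := fun s hs => ⟨hs.1, hs.2.trans ht.2⟩
  obtain ⟨M, hM⟩ := hu.ae_isSlice_hessSup hH
  obtain ⟨hs1, -⟩ := hb.ae_summable_mu hκ hT hu
  obtain ⟨-, hgi, hE⟩ := hb.normSq_eq hκ.le hT hu
  obtain ⟨hs2, hxi, hG⟩ := hb.gradEnergy_eq hκ hT hu h0
  have hAi := (hb.tendsto_integral_res hT hu).1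
  have he : ∀ s ∈ Icc 0 t, 0 < ‖b s‖ ^ 2 := fun s hs => pow_pos (norm_pos_iff.2 (hne s hs)) 2
  -- This is the logarithmic derivative of the energy. Comparing E and G with the same exponential
  -- of ∫ α replaces differentiating the quotient G/E.
  set α : ℝ → ℝ := fun s =>
    (2 * stretchRate (Du s) (b s) - 2 * (κ * gradEnergy (b s))) * (‖b s‖ ^ 2)⁻¹ with hα
  have hxe : IntervalIntegrable
      (fun s => 2 * stretchRate (Du s) (b s) - 2 * (κ * gradEnergy (b s))) volume 0 t :=
    intervalIntegrable_sub ((hAi.const_mul 2).sub (hgi.const_mul 2)) ht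
  -- Nonvanishing on the compact interval enters here: the energy is continuous and positive, so its
  -- inverse is continuous.
  have hαi : IntervalIntegrable α volume 0 t := by
    refine hxe.mul_continuousOn ?_
    rw [uIcc_of_le ht.1]
    exact (hb.continuousOn_normSq.mono sub).inv₀ fun s hs => (he s hs).ne'
  have hhi := intervalIntegrable_sub ((hH.intervalIntegrable hT).const_mul 396) ht
  have g1 := gronwall_ge (X := fun s => ‖b s‖ ^ 2) hxe hαi (fun s hs => hE s (sub s hs)) (by
    filter_upwards with s hs
    simp only [hα]
    rw [mul_assoc, inv_mul_cancel₀ (he s hs).ne', mul_one])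
  have g2 := gronwall_le (X := fun s => gradEnergy (b s)) (intervalIntegrable_sub hxi ht)
    (hαi.add hhi) (fun s hs => (hG s (sub s hs)).2) (by
      filter_upwards [ae_restrict_Icc hM, ae_restrict_Icc hH.ae_norm_le,
        ae_restrict_Icc hH.weak_hess, hs1, hs2] with s k1 k2 k3 k4 k5 hs
      have hsT := sub s hs
      have m1 := (k1 hsT).abs_gradRate_le (k3 hsT) (k2 hsT) (Lp.memLp (b s)) (hb.mem s hsT).2
        (k4 hsT) (k5 hsT)
      have m2 := (k1 hsT).abs_integral_stretch_le (Lp.memLp (b s)) (k1 hsT).ae_norm_gradOp_le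
      have m3 := gradEnergy_sq_le (Lp.memLp (b s)) (k4 hsT) (k5 hsT)
      change |stretchRate (Du s) (b s)| ≤ _ at m2
      change _ ≤ _ * lapEnergy (b s) at m3
      rw [← normSq_Lp] at m2 m3
      have hg := gradEnergy_nonneg (b s)
      have hes := he s hs
      set e := ‖b s‖ ^ 2
      set g := gradEnergy (b s)
      set H := (hessSup (D2u s)).toReal
      simp only [hα]
      -- Here 27 = 3 · 9, from the operator norm of ∇u bounded through ∇²u. Together with the bound
      -- 171 on the gradient rate this gives 396 = 2(171 + 27).
      have n1 : stretchRate (Du s) (b s) * e⁻¹ * g ≥ -(27 * H) * g := by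
        have : -(27 * H) ≤ stretchRate (Du s) (b s) * e⁻¹ := by
          rw [← div_eq_mul_inv, le_div_iff₀ hes]
          linarith [neg_abs_le (stretchRate (Du s) (b s))]
        exact mul_le_mul_of_nonneg_right this hg
      -- The diffusive part of α · G is at least −2κL, so it is absorbed by the dissipation in the
      -- balance of G.
      have n2 : g * e⁻¹ * g ≤ lapEnergy (b s) := by
        rw [mul_right_comm, ← sq, ← div_eq_mul_inv, div_le_iff₀ hes, mul_comm]
        exact m3
      have n3 := mul_le_mul_of_nonneg_left n2 hκ.le
      have n4 := le_abs_self (gradRate (u s) (Du s) (b s))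
      linarith)
  intro s hs
  have g1s := g1 s hs
  have g2s := g2 s hs
  have es : IntervalIntegrable α volume 0 s := intervalIntegrable_sub hαi hs
  rw [intervalIntegral.integral_add es (intervalIntegrable_sub hhi hs),
    intervalIntegral.integral_const_mul, Real.exp_add] at g2s
  have he0 := he 0 ⟨le_rfl, ht.1⟩
  calc gradEnergy (b s) ≤ _ := g2s
    _ = Real.exp (396 * ∫ r in (0 : ℝ)..s, (hessSup (D2u r)).toReal) *
        (gradEnergy (b 0) / ‖b 0‖ ^ 2) * (‖b 0‖ ^ 2 * Real.exp (∫ r in (0 : ℝ)..s, α r)) := by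
          nth_rewrite 1 [← div_mul_cancel₀ (gradEnergy (b 0)) he0.ne']
          ring
    _ ≤ _ := by
          refine mul_le_mul_of_nonneg_left g1s ?_
          have := gradEnergy_nonneg (b 0)
          positivity

end

/-! ### The lower bound and nonvanishing -/

section

variable {κ T : ℝ} {u : ℝ → T3 → E3} {Du : ℝ → Fin 3 → T3 → E3}
  {D2u : ℝ → Fin 3 → Fin 3 → T3 → E3} {b : ℝ → Lp E3 2 (volume : Measure T3)}
  {Db0 : Fin 3 → T3 → E3}

/-- The exponential rate in the lower bound for the energy. -/
noncomputable def decayRate (κ : ℝ) (Du : ℝ → Fin 3 → T3 → E3)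
    (D2u : ℝ → Fin 3 → Fin 3 → T3 → E3) (q s : ℝ) : ℝ :=
  κ * Real.exp (396 * ∫ r in (0 : ℝ)..s, (hessSup (D2u r)).toReal) * q + (gradSup (Du s)).toReal

lemma decayRate_nonneg (hκ : 0 ≤ κ) {q : ℝ} (hq : 0 ≤ q) (s : ℝ) :
    0 ≤ decayRate κ Du D2u q s := by
  unfold decayRate
  positivity

lemma intervalIntegrable_decayRate (hT : 0 ≤ T) (hu : IsVelocity T u Du)
    (hH : IsHessianL1 T Du D2u) (q : ℝ) :
    IntervalIntegrable (decayRate κ Du D2u q) volume 0 T := by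
  refine IntervalIntegrable.add ?_ (hu.intervalIntegrable_gradSup hT)
  refine intervalIntegrable_of_continuousOn hT ?_
  have := intervalIntegral.continuousOn_primitive_interval' (hH.intervalIntegrable hT) left_mem_uIcc
  rw [uIcc_of_le hT] at this
  exact (continuousOn_const.mul (this.const_mul 396).rexp).mul continuousOn_const

/-- The lower bound for the energy, as long as the solution does not vanish. -/
lemma IsSolution.le_normSq_of_ne_zero (hκ : 0 ≤ κ) (hb : IsSolution κ T u Du b)
    (hu : IsVelocity T u Du) (hH : IsHessianL1 T Du D2u) (h1 : IsH1Gradient (b 0) Db0) {t : ℝ}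
    (ht : t ∈ Icc 0 T) (hne : ∀ s ∈ Icc 0 t, b s ≠ 0) :
    Real.exp (-2 * ∫ s in (0 : ℝ)..t, decayRate κ Du D2u (gradL2Sq Db0 / ‖b 0‖ ^ 2) s) *
      ‖b 0‖ ^ 2 ≤ ‖b t‖ ^ 2 := by
  have hT : 0 ≤ T := ht.1.trans ht.2
  have sub : ∀ s ∈ Icc 0 t, s ∈ Icc 0 T := fun s hs => ⟨hs.1, hs.2.trans ht.2⟩
  set q := gradL2Sq Db0 / ‖b 0‖ ^ 2 with hq
  obtain ⟨M, hM0, hM⟩ := hu.exists_slice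
  obtain ⟨-, hgi, hE⟩ := hb.normSq_eq hκ hT hu
  have hAi := (hb.tendsto_integral_res hT hu).1
  have hfi := intervalIntegrable_sub (intervalIntegrable_decayRate (κ := κ) hT hu hH q) ht
  have key : ∀ s ∈ Icc 0 t, κ * gradEnergy (b s) ≤
      κ * Real.exp (396 * ∫ r in (0 : ℝ)..s, (hessSup (D2u r)).toReal) * q * ‖b s‖ ^ 2 := by
    intro s hs
    -- For κ = 0 no H¹ regularity is available at positive times, but the term is multiplied by
    -- zero.
    rcases hκ.eq_or_lt with rfl | hκ
    · simp
    · have := hb.gradEnergy_le hκ hu hH h1.hasSum_mu.summable ht hne s hs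
      rw [gradEnergy, gradEnergy, h1.hasSum_mu.tsum_eq, ← hq] at this
      have := mul_le_mul_of_nonneg_left this hκ.le
      simpa only [mul_assoc, gradEnergy] using this
  have := gronwall_ge (X := fun s => ‖b s‖ ^ 2)
    (intervalIntegrable_sub ((hAi.const_mul 2).sub (hgi.const_mul 2)) ht)
    (hfi.const_mul (-2)) (fun s hs => hE s (sub s hs)) (by
      filter_upwards [ae_restrict_Icc hM] with s k1 hs
      have m1 := (k1 (sub s hs)).abs_integral_stretch_le (Lp.memLp (b s))
        (k1 (sub s hs)).ae_norm_gradOp_le_gradSup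
      change |stretchRate (Du s) (b s)| ≤ _ at m1
      rw [← normSq_Lp] at m1
      have m2 := neg_abs_le (stretchRate (Du s) (b s))
      have m3 := key s hs
      simp only [decayRate]
      linarith) t ⟨ht.1, le_rfl⟩
  rw [intervalIntegral.integral_const_mul, mul_comm] at this
  exact this

/-- At a first zero τ the lower bound holds on [0, τ). Its rate is nonnegative and integrable on [0,
T], so the bound there is at least a fixed positive constant, which passes to τ by continuity of the
energy. -/
lemma IsSolution.ne_zero (hκ : 0 ≤ κ) (hb : IsSolution κ T u Du b)
    (hu : IsVelocity T u Du) (hH : IsHessianL1 T Du D2u) (h1 : IsH1Gradient (b 0) Db0)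
    (h0 : b 0 ≠ 0) : ∀ t ∈ Icc 0 T, b t ≠ 0 := by
  by_contra! hcon
  obtain ⟨t, ht, hbt⟩ := hcon
  have hT : 0 ≤ T := ht.1.trans ht.2
  set Z : Set ℝ := Icc 0 T ∩ b ⁻¹' {0} with hZ
  have hZc : IsClosed Z := hb.continuousOn.preimage_isClosed_of_isClosed isClosed_Icc
    isClosed_singleton
  have hZb : BddBelow Z := ⟨0, fun s hs => hs.1.1⟩
  obtain ⟨hτ, hbτ⟩ : sInf Z ∈ Z := hZc.csInf_mem ⟨t, ht, hbt⟩ hZb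
  set τ := sInf Z
  have hτ0 : 0 < τ := lt_of_le_of_ne hτ.1 fun h => h0 (by rw [h]; exact hbτ)
  set q := gradL2Sq Db0 / ‖b 0‖ ^ 2 with hq
  have hq0 : 0 ≤ q := div_nonneg
    (integral_nonneg fun x => Finset.sum_nonneg fun j _ => sq_nonneg _) (sq_nonneg _)
  have hfi := intervalIntegrable_decayRate (κ := κ) hT hu hH q
  set c := Real.exp (-2 * ∫ s in (0 : ℝ)..T, decayRate κ Du D2u q s) * ‖b 0‖ ^ 2 with hc
  have hc0 : 0 < c := mul_pos (Real.exp_pos _) (pow_pos (norm_pos_iff.2 h0) 2)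
  have hlow : ∀ s ∈ Ico 0 τ, c ≤ ‖b s‖ ^ 2 := by
    intro s hs
    have hsT : s ∈ Icc 0 T := ⟨hs.1, hs.2.le.trans hτ.2⟩
    refine le_trans ?_ (hb.le_normSq_of_ne_zero hκ hu hH h1 hsT fun r hr hr0 =>
      (hr.2.trans_lt hs.2).not_ge (csInf_le hZb ⟨⟨hr.1, hr.2.trans hsT.2⟩, hr0⟩))
    have : ∫ r in (0 : ℝ)..s, decayRate κ Du D2u q r ≤ ∫ r in (0 : ℝ)..T, decayRate κ Du D2u q r :=
      intervalIntegral.integral_mono_interval le_rfl hsT.1 hsT.2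
        (Filter.Eventually.of_forall fun r => decayRate_nonneg hκ hq0 r) hfi
    refine mul_le_mul_of_nonneg_right (Real.exp_le_exp.2 ?_) (sq_nonneg _)
    linarith
  have hcont : ContinuousOn (fun s => ‖b s‖ ^ 2) (Icc 0 τ) :=
    hb.continuousOn_normSq.mono (Icc_subset_Icc_right hτ.2)
  have hle : c ≤ ‖b τ‖ ^ 2 := by
    have hlim : Filter.Tendsto (fun s => ‖b s‖ ^ 2) (nhdsWithin τ (Ico 0 τ)) (nhds (‖b τ‖ ^ 2)) :=
      (hcont τ ⟨hτ.1, le_rfl⟩).mono_left (nhdsWithin_mono _ Ico_subset_Icc_self)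
    have : (nhdsWithin τ (Ico 0 τ)).NeBot := by
      rw [← mem_closure_iff_nhdsWithin_neBot, closure_Ico hτ0.ne]
      exact ⟨hτ.1, le_rfl⟩
    exact ge_of_tendsto hlim (Filter.eventually_of_mem self_mem_nhdsWithin hlow)
  rw [show b τ = 0 from hbτ, norm_zero] at hle
  simp at hle
  linarith

end

end Induction

theorem mainTheorem4 :
    ∃ C : ℝ, 0 < C ∧
      ∀ (κ T : ℝ), 0 ≤ κ → 0 ≤ T →
      ∀ (u : ℝ → Induction.T3 → Induction.E3)
        (Du : ℝ → Fin 3 → Induction.T3 → Induction.E3)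
        (D2u : ℝ → Fin 3 → Fin 3 → Induction.T3 → Induction.E3)
        (b : ℝ → MeasureTheory.Lp Induction.E3 2
          (MeasureTheory.volume : MeasureTheory.Measure Induction.T3))
        (Db0 : Fin 3 → Induction.T3 → Induction.E3),
      Induction.IsVelocity T u Du →
      Induction.IsHessianL1 T Du D2u →
      Induction.IsSolution κ T u Du b →
      Induction.IsH1Gradient (b 0) Db0 →
      (∀ t ∈ Set.Icc 0 T,
        Real.exp (-2 * ∫ s in (0 : ℝ)..t,
            (κ * Real.exp (C * ∫ r in (0 : ℝ)..s, (Induction.hessSup (D2u r)).toReal)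
                * (Induction.gradL2Sq Db0 / ‖b 0‖ ^ 2)
              + (Induction.gradSup (Du s)).toReal))
          * ‖b 0‖ ^ 2 ≤ ‖b t‖ ^ 2) ∧
      (b 0 ≠ 0 → ∀ t ∈ Set.Icc 0 T, b t ≠ 0) := by
  refine ⟨396, by norm_num, fun κ T hκ hT u Du D2u b Db0 hu hH hb h1 =>
    ⟨fun t ht => ?_, hb.ne_zero hκ hu hH h1⟩⟩
  by_cases h0 : b 0 = 0
  · simp [h0]
  · exact hb.le_normSq_of_ne_zero hκ hu hH h1 ht fun s hs =>
      hb.ne_zero hκ hu hH h1 h0 s ⟨hs.1, hs.2.trans ht.2⟩
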